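/- Let $k$ be a field, let $A$ and $B$ be $k$-algebras, let $M$ be a $B$-$A$-bimodule and $N$ an $A$-$B$-bimodule (with central action of $k$), and assume that $M$ and $N$ are projective as bimodules, that is, as modules over $B\otimes_k A^{\mathrm{op}}$ and $A\otimes_k B^{\mathrm{op}}$ respectively. Let $$\Lambda=\begin{pmatrix}A&N\\ M&B\end{pmatrix}$$ be the corresponding null-square projective algebra: its product is matrix multiplication with $mn=0$ and $nm=0$ for all $m\in M$, $n\in N$. Let $C=A\times B\subset\Lambda$ be the diagonal subalgebra, and let $K$ be the kernel of the product map $\Lambda\otimes_C\Lambda\to\Lambda$, so that $$0\to K\to\Lambda\otimes_C\Lambda\to\Lambda\to 0\qquad(*)$$ is a short exact sequence of $\Lambda$-bimodules. For a $k$-algebra $R$ write $\mathrm{Tor}^{R-R}=\mathrm{Tor}^{R\otimes_k R^{\mathrm{op}}}$ and $HH_n(R)=\mathrm{Tor}_n^{R-R}(R,R)$, and for an $A$-bimodule $Z$ write $H_0(A,Z)=Z/\langle az-za\mid a\in A,\ z\in Z\rangle$. The cyclic group $C_{m+1}$ of order $m+1$ acts on $H_0\big(A,(N\otimes_BM)^{\otimes_A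 m+1}\big)$, its generator acting by the cyclic permutation $z_{m+1}\otimes\cdots\otimes z_2\otimes z_1\mapsto z_1\otimes z_{m+1}\otimes\cdots\otimes z_2$ with $z_i\in N\otimes_BM$; invariants and coinvariants are denoted by $(-)^{C_{m+1}}$ and $(-)_{C_{m+1}}$. Then there is a long exact sequence of $k$-vector spaces $$\begin{aligned} \cdots\to{}& H_0\big(A,(N\otimes_BM)^{\otimes_A m+1}\big)^{C_{m+1}}\to HH_{2m+1}(A)\oplus HH_{2m+1}(B)\to HH_{2m+1}(\Lambda)\\ \to{}& H_0\big(A,(N\otimes_BM)^{\otimes_A m+1}\big)_{C_{m+1}}\to HH_{2m}(A)\oplus HH_{2m}(B)\to HH_{2m}(\Lambda)\to\cdots\\ \to{}& H_0\big(A,N\otimes_BM\big)\to HH_1(A)\oplus HH_1(B)\to HH_1(\Lambda)\\ \to{}& H_0\big(A,N\otimes_BM\big)\to HH_0(A)\oplus HH_0(B)\to HH_0(\Lambda)\to 0 . \end{aligned}$$ The rows of the pattern are indexed by all $m\ge 0$; the last two displayed rows are the case $m=0$, where $C_1$ is trivial. This sequence is the long exact sequence of $\mathrm{Tor}^{\Lambda-\Lambda}_*(-,\Lambda)$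 associated with $(*)$, via $k$-linear isomorphisms $$\mathrm{Tor}^{\Lambda-\Lambda}_{2m+1}(K,\Lambda)\cong H_0\big(A,(N\otimes_BM)^{\otimes_A m+1}\big)^{C_{m+1}},\qquad \mathrm{Tor}^{\Lambda-\Lambda}_{2m}(K,\Lambda)\cong H_0\big(A,(N\otimes_BM)^{\otimes_A m+1}\big)_{C_{m+1}},$$ $$\mathrm{Tor}^{\Lambda-\Lambda}_n(\Lambda\otimes_C\Lambda,\Lambda)\cong HH_n(A)\oplus HH_n(B)\qquad(m,n\ge 0).$$ -/

import Mathlib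

open CategoryTheory MulOpposite
open scoped TensorProduct

universe u

set_option linter.unusedSectionVars false

namespace NullSquareHH

noncomputable section

/-! ### Tensor product of bimodules over a noncommutative algebra -/

section Balanced

variable (k R X Y : Type u) [Field k] [Ring R] [Algebra k R]
  [AddCommGroup X] [Module k X] [Module Rᵐᵒᵖ X]
  [AddCommGroup Y] [Module k Y] [Module R Y]

/-- The subspace of `X ⊗ₖ Y` spanned by the elements `x r ⊗ y - x ⊗ r y`. -/
def balancedRel : Submodule k (X ⊗[k] Y) :=
  Submodule.span k {z | ∃ (x : X) (r : R) (y : Y),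
    z = (op r • x) ⊗ₜ[k] y - x ⊗ₜ[k] (r • y)}

/-- The tensor product `X ⊗_R Y` of a right `R`-module `X` and a left `R`-module `Y`. -/
def BalTensor : Type u := (X ⊗[k] Y) ⧸ balancedRel k R X Y

instance : AddCommGroup (BalTensor k R X Y) :=
  inferInstanceAs (AddCommGroup ((X ⊗[k] Y) ⧸ balancedRel k R X Y))

instance : Module k (BalTensor k R X Y) :=
  inferInstanceAs (Module k ((X ⊗[k] Y) ⧸ balancedRel k R X Y))

/-- The canonical map `X ⊗ₖ Y → X ⊗_R Y`. -/
def BalTensor.mk : X ⊗[k] Y →ₗ[k] BalTensor k R X Y := (balancedRel k R X Y).mkQ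

variable {k R X Y}

theorem BalTensor.mk_smul (x : X) (r : R) (y : Y) :
    BalTensor.mk k R X Y ((op r • x) ⊗ₜ y) = BalTensor.mk k R X Y (x ⊗ₜ (r • y)) :=
  (Submodule.Quotient.eq _).2 (Submodule.subset_span ⟨x, r, y, rfl⟩)

theorem BalTensor.hom_ext {V : Type u} [AddCommGroup V] [Module k V]
    {f g : BalTensor k R X Y →ₗ[k] V}
    (h : ∀ x y, f (BalTensor.mk k R X Y (x ⊗ₜ y)) = g (BalTensor.mk k R X Y (x ⊗ₜ y))) :
    f = g :=
  Submodule.linearMap_qext _ (TensorProduct.ext' h)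

/-- The linear map `X ⊗_R Y → V` induced by an `R`-balanced linear map. -/
def BalTensor.lift {V : Type u} [AddCommGroup V] [Module k V] (f : X ⊗[k] Y →ₗ[k] V)
    (h : ∀ (x : X) (r : R) (y : Y), f ((op r • x) ⊗ₜ y) = f (x ⊗ₜ (r • y))) :
    BalTensor k R X Y →ₗ[k] V :=
  Submodule.liftQ _ f <| Submodule.span_le.2 <| by
    rintro _ ⟨x, r, y, rfl⟩
    simp [h]

theorem BalTensor.lift_mk {V : Type u} [AddCommGroup V] [Module k V] (f : X ⊗[k] Y →ₗ[k] V)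
    (h : ∀ (x : X) (r : R) (y : Y), f ((op r • x) ⊗ₜ y) = f (x ⊗ₜ (r • y))) (z : X ⊗[k] Y) :
    BalTensor.lift f h (BalTensor.mk k R X Y z) = f z := rfl

section Left

variable (k R X Y)
variable (S : Type u) [Ring S] [Algebra k S] [Module S X] [IsScalarTower k S X]
  [SMulCommClass S Rᵐᵒᵖ X]

/-- The map `x ⊗ y ↦ s x ⊗ y` on `X ⊗_R Y`, for an `S`-`R`-bimodule `X`. -/
def BalTensor.leftMul (s : S) : Module.End k (BalTensor k R X Y) :=
  BalTensor.lift
    (BalTensor.mk k R X Y ∘ₗ TensorProduct.map (Algebra.lsmul k k X s) LinearMap.id) <| by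
      intro x r y
      simp [smul_comm s (op r) x, BalTensor.mk_smul]

theorem BalTensor.leftMul_mk (s : S) (x : X) (y : Y) :
    BalTensor.leftMul k R X Y S s (BalTensor.mk k R X Y (x ⊗ₜ y))
      = BalTensor.mk k R X Y ((s • x) ⊗ₜ y) := rfl

/-- The left `S`-action on `X ⊗_R Y` for an `S`-`R`-bimodule `X`. -/
def BalTensor.leftAct : S →+* Module.End k (BalTensor k R X Y) where
  toFun s := BalTensor.leftMul k R X Y S s
  map_one' := BalTensor.hom_ext fun x y => by simp [BalTensor.leftMul_mk]
  map_mul' s t := BalTensor.hom_ext fun x y => by simp [BalTensor.leftMul_mk, mul_smul]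
  map_zero' := BalTensor.hom_ext fun x y => by simp [BalTensor.leftMul_mk]
  map_add' s t := BalTensor.hom_ext fun x y => by
    simp [BalTensor.leftMul_mk, add_smul, TensorProduct.add_tmul]

instance (priority := 100) BalTensor.leftModule : Module S (BalTensor k R X Y) :=
  Module.compHom _ (BalTensor.leftAct k R X Y S)

variable {k R X Y S}

theorem BalTensor.smul_mk (s : S) (x : X) (y : Y) :
    s • BalTensor.mk k R X Y (x ⊗ₜ y) = BalTensor.mk k R X Y ((s • x) ⊗ₜ y) := rfl

instance BalTensor.leftTower : IsScalarTower k S (BalTensor k R X Y) where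
  smul_assoc c s z := by
    have : BalTensor.leftAct k R X Y S (c • s) = c • BalTensor.leftAct k R X Y S s :=
      BalTensor.hom_ext fun x y => by
        change BalTensor.mk k R X Y (((c • s) • x) ⊗ₜ y)
          = c • BalTensor.mk k R X Y ((s • x) ⊗ₜ y)
        rw [smul_assoc, ← TensorProduct.smul_tmul', map_smul]
    exact LinearMap.congr_fun this z

end Left

section Right

variable (k R X Y)
variable (T : Type u) [Ring T] [Algebra k T] [Module Tᵐᵒᵖ Y] [IsScalarTower k Tᵐᵒᵖ Y]
  [SMulCommClass R Tᵐᵒᵖ Y]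

/-- The map `x ⊗ y ↦ x ⊗ y t` on `X ⊗_R Y`, for an `R`-`T`-bimodule `Y`. -/
def BalTensor.rightMul (t : Tᵐᵒᵖ) : Module.End k (BalTensor k R X Y) :=
  BalTensor.lift
    (BalTensor.mk k R X Y ∘ₗ TensorProduct.map LinearMap.id (Algebra.lsmul k k Y t)) <| by
      intro x r y
      simp [← smul_comm r t y, BalTensor.mk_smul]

theorem BalTensor.rightMul_mk (t : Tᵐᵒᵖ) (x : X) (y : Y) :
    BalTensor.rightMul k R X Y T t (BalTensor.mk k R X Y (x ⊗ₜ y))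
      = BalTensor.mk k R X Y (x ⊗ₜ (t • y)) := rfl

/-- The right `T`-action on `X ⊗_R Y` for an `R`-`T`-bimodule `Y`. -/
def BalTensor.rightAct : Tᵐᵒᵖ →+* Module.End k (BalTensor k R X Y) where
  toFun t := BalTensor.rightMul k R X Y T t
  map_one' := BalTensor.hom_ext fun x y => by simp [BalTensor.rightMul_mk]
  map_mul' s t := BalTensor.hom_ext fun x y => by simp [BalTensor.rightMul_mk, mul_smul]
  map_zero' := BalTensor.hom_ext fun x y => by simp [BalTensor.rightMul_mk]
  map_add' s t := BalTensor.hom_ext fun x y => by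
    simp [BalTensor.rightMul_mk, add_smul, TensorProduct.tmul_add]

instance (priority := 100) BalTensor.rightModule : Module Tᵐᵒᵖ (BalTensor k R X Y) :=
  Module.compHom _ (BalTensor.rightAct k R X Y T)

variable {k R X Y T}

theorem BalTensor.op_smul_mk (t : Tᵐᵒᵖ) (x : X) (y : Y) :
    t • BalTensor.mk k R X Y (x ⊗ₜ y) = BalTensor.mk k R X Y (x ⊗ₜ (t • y)) := rfl

instance BalTensor.rightTower : IsScalarTower k Tᵐᵒᵖ (BalTensor k R X Y) where
  smul_assoc c t z := by
    have : BalTensor.rightAct k R X Y T (c • t) = c • BalTensor.rightAct k R X Y T t :=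
      BalTensor.hom_ext fun x y => by
        change BalTensor.mk k R X Y (x ⊗ₜ ((c • t) • y))
          = c • BalTensor.mk k R X Y (x ⊗ₜ (t • y))
        rw [smul_assoc, TensorProduct.tmul_smul, map_smul]
    exact LinearMap.congr_fun this z

end Right

instance BalTensor.smulComm {S T : Type u} [Ring S] [Algebra k S] [Module S X]
    [IsScalarTower k S X] [SMulCommClass S Rᵐᵒᵖ X] [Ring T] [Algebra k T] [Module Tᵐᵒᵖ Y]
    [IsScalarTower k Tᵐᵒᵖ Y] [SMulCommClass R Tᵐᵒᵖ Y] :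
    SMulCommClass S Tᵐᵒᵖ (BalTensor k R X Y) where
  smul_comm s t z := by
    have : BalTensor.leftAct k R X Y S s * BalTensor.rightAct k R X Y T t
        = BalTensor.rightAct k R X Y T t * BalTensor.leftAct k R X Y S s :=
      BalTensor.hom_ext fun x y => rfl
    exact LinearMap.congr_fun this z

end Balanced

/-! ### Tensor powers of a bimodule, zeroth Hochschild homology, and the cyclic action -/

section Power

variable (k A X : Type u) [Field k] [Ring A] [Algebra k A]
  [AddCommGroup X] [Module k X] [Module A X] [Module Aᵐᵒᵖ X]

/-- The subspace of the `(m + 1)`-fold tensor power of `X` over `k` spanned by the elements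
`⋯ ⊗ xᵢ a ⊗ xᵢ₊₁ ⊗ ⋯ - ⋯ ⊗ xᵢ ⊗ a xᵢ₊₁ ⊗ ⋯`. -/
def powRel (m : ℕ) : Submodule k (PiTensorProduct k fun _ : Fin (m + 1) => X) :=
  Submodule.span k {z | ∃ (x : Fin (m + 1) → X) (i : Fin m) (a : A),
    z = PiTensorProduct.tprod k (Function.update x i.castSucc (op a • x i.castSucc))
      - PiTensorProduct.tprod k (Function.update x i.succ (a • x i.succ))}

/-- The tensor power `X ⊗_A ⋯ ⊗_A X` with `m + 1` factors of an `A`-bimodule `X`. -/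
def TensorPow (m : ℕ) : Type u :=
  (PiTensorProduct k fun _ : Fin (m + 1) => X) ⧸ powRel k A X m

instance (m : ℕ) : AddCommGroup (TensorPow k A X m) :=
  inferInstanceAs (AddCommGroup ((PiTensorProduct k fun _ : Fin (m + 1) => X) ⧸ powRel k A X m))

instance (m : ℕ) : Module k (TensorPow k A X m) :=
  inferInstanceAs (Module k ((PiTensorProduct k fun _ : Fin (m + 1) => X) ⧸ powRel k A X m))

/-- The canonical map `X ⊗ₖ ⋯ ⊗ₖ X → X ⊗_A ⋯ ⊗_A X`. -/
def TensorPow.mkLin (m : ℕ) :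
    (PiTensorProduct k fun _ : Fin (m + 1) => X) →ₗ[k] TensorPow k A X m :=
  (powRel k A X m).mkQ

variable {X} in
/-- The class of `x₀ ⊗ ⋯ ⊗ xₘ`. -/
def TensorPow.mk {m : ℕ} (x : Fin (m + 1) → X) : TensorPow k A X m :=
  TensorPow.mkLin k A X m (PiTensorProduct.tprod k x)

variable {k A X} {m : ℕ}

theorem TensorPow.mk_smul (x : Fin (m + 1) → X) (i : Fin m) (a : A) :
    TensorPow.mk k A (Function.update x i.castSucc (op a • x i.castSucc))
      = TensorPow.mk k A (Function.update x i.succ (a • x i.succ)) :=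
  (Submodule.Quotient.eq _).2 (Submodule.subset_span ⟨x, i, a, rfl⟩)

theorem TensorPow.mk_update_zero (x : Fin (m + 1) → X) (p : Fin (m + 1)) :
    TensorPow.mk k A (Function.update x p 0) = 0 := by
  rw [TensorPow.mk, MultilinearMap.map_update_zero, map_zero]

theorem TensorPow.mk_update_add (x : Fin (m + 1) → X) (p : Fin (m + 1)) (y z : X) :
    TensorPow.mk k A (Function.update x p (y + z))
      = TensorPow.mk k A (Function.update x p y) + TensorPow.mk k A (Function.update x p z) := by
  rw [TensorPow.mk, MultilinearMap.map_update_add, map_add]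
  rfl

theorem TensorPow.hom_ext {V : Type u} [AddCommGroup V] [Module k V]
    {f g : TensorPow k A X m →ₗ[k] V}
    (h : ∀ x, f (TensorPow.mk k A x) = g (TensorPow.mk k A x)) : f = g :=
  Submodule.linearMap_qext _ (PiTensorProduct.ext (MultilinearMap.ext h))

/-- The linear map `X ⊗_A ⋯ ⊗_A X → V` induced by an `A`-balanced linear map. -/
def TensorPow.lift {V : Type u} [AddCommGroup V] [Module k V]
    (f : (PiTensorProduct k fun _ : Fin (m + 1) => X) →ₗ[k] V)
    (h : ∀ (x : Fin (m + 1) → X) (i : Fin m) (a : A),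
      f (PiTensorProduct.tprod k (Function.update x i.castSucc (op a • x i.castSucc)))
        = f (PiTensorProduct.tprod k (Function.update x i.succ (a • x i.succ)))) :
    TensorPow k A X m →ₗ[k] V :=
  Submodule.liftQ _ f <| Submodule.span_le.2 <| by
    rintro _ ⟨x, i, a, rfl⟩
    simp [h]

theorem TensorPow.lift_mk {V : Type u} [AddCommGroup V] [Module k V]
    (f : (PiTensorProduct k fun _ : Fin (m + 1) => X) →ₗ[k] V)
    (h : ∀ (x : Fin (m + 1) → X) (i : Fin m) (a : A),
      f (PiTensorProduct.tprod k (Function.update x i.castSucc (op a • x i.castSucc)))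
        = f (PiTensorProduct.tprod k (Function.update x i.succ (a • x i.succ))))
    (x : Fin (m + 1) → X) :
    TensorPow.lift f h (TensorPow.mk k A x) = f (PiTensorProduct.tprod k x) := rfl

variable (k) in
/-- Apply the endomorphism `φ` to the factor with index `p`. -/
def actAt (p : Fin (m + 1)) (φ : X →ₗ[k] X) :
    (PiTensorProduct k fun _ : Fin (m + 1) => X) →ₗ[k]
      PiTensorProduct k fun _ : Fin (m + 1) => X :=
  PiTensorProduct.map (Function.update (fun _ => LinearMap.id) p φ)

theorem actAt_tprod (p : Fin (m + 1)) (φ : X →ₗ[k] X) (x : Fin (m + 1) → X) :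
    actAt k p φ (PiTensorProduct.tprod k x)
      = PiTensorProduct.tprod k (Function.update x p (φ (x p))) := by
  rw [actAt, PiTensorProduct.map_tprod]
  congr 1
  funext i
  by_cases h : i = p
  · subst h; simp
  · simp [h]

theorem update_update_comm {ι : Type*} [DecidableEq ι] (x : ι → X) (p q : ι) (φ ψ : X → X)
    (h : p = q → ∀ z, φ (ψ z) = ψ (φ z)) :
    Function.update (Function.update x p (ψ (x p))) q
        (φ (Function.update x p (ψ (x p)) q))
      = Function.update (Function.update x q (φ (x q))) p
        (ψ (Function.update x q (φ (x q)) p)) := by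
  by_cases hpq : p = q
  · subst hpq
    simp [h rfl]
  · rw [Function.update_of_ne (Ne.symm hpq), Function.update_of_ne hpq,
      Function.update_comm hpq]

section Act

variable [IsScalarTower k A X] [IsScalarTower k Aᵐᵒᵖ X] [SMulCommClass A Aᵐᵒᵖ X]

variable (k A X m) in
/-- The map `x₀ ⊗ ⋯ ⊗ xₘ ↦ a x₀ ⊗ ⋯ ⊗ xₘ`. -/
def TensorPow.leftMul (a : A) : Module.End k (TensorPow k A X m) :=
  TensorPow.lift (TensorPow.mkLin k A X m ∘ₗ actAt k 0 (Algebra.lsmul k k X a)) <| by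
    intro x i b
    rw [LinearMap.comp_apply, LinearMap.comp_apply, actAt_tprod, actAt_tprod]
    refine (congrArg (TensorPow.mk k A) (update_update_comm x i.castSucc 0
      (fun z => a • z) (fun z => op b • z) fun _ z => smul_comm a (op b) z)).trans ?_
    refine (TensorPow.mk_smul _ i b).trans ?_
    exact (congrArg (TensorPow.mk k A) (update_update_comm x i.succ 0
      (fun z => a • z) (fun z => b • z) fun h => absurd h (Fin.succ_ne_zero i))).symm

theorem TensorPow.leftMul_mk (a : A) (x : Fin (m + 1) → X) :
    TensorPow.leftMul k A X m a (TensorPow.mk k A x)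
      = TensorPow.mk k A (Function.update x 0 (a • x 0)) := by
  rw [TensorPow.leftMul, TensorPow.lift_mk, LinearMap.comp_apply, actAt_tprod]
  rfl

variable (k A X m) in
/-- The left `A`-action on `X ⊗_A ⋯ ⊗_A X`, through the first factor. -/
def TensorPow.leftAct : A →+* Module.End k (TensorPow k A X m) where
  toFun a := TensorPow.leftMul k A X m a
  map_one' := TensorPow.hom_ext fun x => by simp [TensorPow.leftMul_mk]
  map_mul' a b := TensorPow.hom_ext fun x => by simp [TensorPow.leftMul_mk, mul_smul]
  map_zero' := TensorPow.hom_ext fun x => by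
    rw [TensorPow.leftMul_mk, zero_smul]
    exact TensorPow.mk_update_zero x 0
  map_add' a b := TensorPow.hom_ext fun x => by
    simp only [TensorPow.leftMul_mk, LinearMap.add_apply, add_smul, TensorPow.mk_update_add]

variable (k A X m) in
/-- The map `x₀ ⊗ ⋯ ⊗ xₘ ↦ x₀ ⊗ ⋯ ⊗ xₘ a`. -/
def TensorPow.rightMul (a : Aᵐᵒᵖ) : Module.End k (TensorPow k A X m) :=
  TensorPow.lift
    (TensorPow.mkLin k A X m ∘ₗ actAt k (Fin.last m) (Algebra.lsmul k k X a)) <| by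
      intro x i b
      rw [LinearMap.comp_apply, LinearMap.comp_apply, actAt_tprod, actAt_tprod]
      refine (congrArg (TensorPow.mk k A) (update_update_comm x i.castSucc (Fin.last m)
        (fun z => a • z) (fun z => op b • z)
        fun h => absurd h (Fin.castSucc_lt_last i).ne)).trans ?_
      refine (TensorPow.mk_smul _ i b).trans ?_
      exact (congrArg (TensorPow.mk k A) (update_update_comm x i.succ (Fin.last m)
        (fun z => a • z) (fun z => b • z) fun _ z => (smul_comm b a z).symm)).symm

theorem TensorPow.rightMul_mk (a : Aᵐᵒᵖ) (x : Fin (m + 1) → X) :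
    TensorPow.rightMul k A X m a (TensorPow.mk k A x)
      = TensorPow.mk k A (Function.update x (Fin.last m) (a • x (Fin.last m))) := by
  rw [TensorPow.rightMul, TensorPow.lift_mk, LinearMap.comp_apply, actAt_tprod]
  rfl

variable (k A X m) in
/-- The right `A`-action on `X ⊗_A ⋯ ⊗_A X`, through the last factor. -/
def TensorPow.rightAct : Aᵐᵒᵖ →+* Module.End k (TensorPow k A X m) where
  toFun a := TensorPow.rightMul k A X m a
  map_one' := TensorPow.hom_ext fun x => by simp [TensorPow.rightMul_mk]
  map_mul' a b := TensorPow.hom_ext fun x => by simp [TensorPow.rightMul_mk, mul_smul]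
  map_zero' := TensorPow.hom_ext fun x => by
    rw [TensorPow.rightMul_mk, zero_smul]
    exact TensorPow.mk_update_zero x _
  map_add' a b := TensorPow.hom_ext fun x => by
    simp only [TensorPow.rightMul_mk, LinearMap.add_apply, add_smul, TensorPow.mk_update_add]

instance TensorPow.leftModule : Module A (TensorPow k A X m) :=
  Module.compHom _ (TensorPow.leftAct k A X m)

instance TensorPow.rightModule : Module Aᵐᵒᵖ (TensorPow k A X m) :=
  Module.compHom _ (TensorPow.rightAct k A X m)

theorem TensorPow.smul_mk (a : A) (x : Fin (m + 1) → X) :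
    a • TensorPow.mk k A x = TensorPow.mk k A (Function.update x 0 (a • x 0)) :=
  TensorPow.leftMul_mk a x

theorem TensorPow.op_smul_mk (a : Aᵐᵒᵖ) (x : Fin (m + 1) → X) :
    a • TensorPow.mk k A x
      = TensorPow.mk k A (Function.update x (Fin.last m) (a • x (Fin.last m))) :=
  TensorPow.rightMul_mk a x

end Act

/-- The subspace of an `A`-bimodule `Z` spanned by the elements `a z - z a`. -/
def commRel (k A Z : Type u) [Field k] [Ring A] [Algebra k A] [AddCommGroup Z] [Module k Z]
    [Module A Z] [Module Aᵐᵒᵖ Z] : Submodule k Z :=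
  Submodule.span k {w | ∃ (a : A) (z : Z), w = a • z - op a • z}

/-- `H₀(A, Z) = Z / ⟨a z - z a⟩` for an `A`-bimodule `Z`. -/
abbrev H0 (k A Z : Type u) [Field k] [Ring A] [Algebra k A] [AddCommGroup Z] [Module k Z]
    [Module A Z] [Module Aᵐᵒᵖ Z] : Type u :=
  Z ⧸ commRel k A Z

section Cyclic

variable [IsScalarTower k A X] [IsScalarTower k Aᵐᵒᵖ X] [SMulCommClass A Aᵐᵒᵖ X]

variable (k A) in
/-- The class of `x₀ ⊗ ⋯ ⊗ xₘ` in `H₀(A, X ⊗_A ⋯ ⊗_A X)`. -/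
def cyc (x : Fin (m + 1) → X) : H0 k A (TensorPow k A X m) :=
  (commRel k A (TensorPow k A X m)).mkQ (TensorPow.mk k A x)

theorem cyc_smul (x : Fin (m + 1) → X) (p : Fin (m + 1)) (a : A) :
    cyc k A (Function.update x p (op a • x p))
      = cyc k A (Function.update x (p + 1) (a • x (p + 1))) := by
  induction p using Fin.lastCases with
  | last =>
    rw [Fin.last_add_one]
    have h : a • TensorPow.mk k A x - op a • TensorPow.mk k A x
        ∈ commRel k A (TensorPow k A X m) := Submodule.subset_span ⟨a, _, rfl⟩
    rw [TensorPow.smul_mk, TensorPow.op_smul_mk] at h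
    exact ((Submodule.Quotient.eq _).2 h).symm
  | cast i =>
    rw [Fin.coeSucc_eq_succ]
    exact congrArg (commRel k A (TensorPow k A X m)).mkQ (TensorPow.mk_smul x i a)

variable (k A X m) in
/-- The map `x₀ ⊗ ⋯ ⊗ xₘ ↦ xₘ ⊗ x₀ ⊗ ⋯ ⊗ xₘ₋₁` on the tensor power of `X` over `k`. -/
def rotateLin : (PiTensorProduct k fun _ : Fin (m + 1) => X) →ₗ[k]
    PiTensorProduct k fun _ : Fin (m + 1) => X :=
  (PiTensorProduct.reindex k (fun _ : Fin (m + 1) => X) (finRotate (m + 1))).toLinearMap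

theorem rotateLin_tprod (x : Fin (m + 1) → X) :
    rotateLin k X m (PiTensorProduct.tprod k x)
      = PiTensorProduct.tprod k fun i => x ((finRotate (m + 1)).symm i) :=
  PiTensorProduct.reindex_tprod _ _

theorem cyc_rotate_smul (x : Fin (m + 1) → X) (p : Fin (m + 1)) (a : A) :
    cyc k A (fun i => Function.update x p (op a • x p) ((finRotate (m + 1)).symm i))
      = cyc k A (fun i =>
        Function.update x (p + 1) (a • x (p + 1)) ((finRotate (m + 1)).symm i)) := by
  have h := cyc_smul (k := k) (A := A) (fun i => x ((finRotate (m + 1)).symm i))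
    (finRotate (m + 1) p) a
  have e : finRotate (m + 1) p + 1 = finRotate (m + 1) (p + 1) := by
    simp only [finRotate_apply]
  rw [e] at h
  simp only [Equiv.symm_apply_apply] at h
  refine (congrArg (cyc k A) ?_).trans (h.trans (congrArg (cyc k A) ?_))
  · exact Function.update_comp_equiv x (finRotate (m + 1)).symm p _
  · exact (Function.update_comp_equiv x (finRotate (m + 1)).symm (p + 1) _).symm

variable (k A X m) in
/-- The map `x₀ ⊗ ⋯ ⊗ xₘ ↦ xₘ ⊗ x₀ ⊗ ⋯ ⊗ xₘ₋₁` from `X ⊗_A ⋯ ⊗_A X` to its zeroth homology. -/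
def preRotate : TensorPow k A X m →ₗ[k] H0 k A (TensorPow k A X m) :=
  TensorPow.lift ((commRel k A (TensorPow k A X m)).mkQ ∘ₗ TensorPow.mkLin k A X m ∘ₗ
    rotateLin k X m) <| by
      intro x i a
      simp only [LinearMap.comp_apply, rotateLin_tprod]
      have h := cyc_rotate_smul (k := k) x i.castSucc a
      rw [Fin.coeSucc_eq_succ] at h
      exact h

theorem preRotate_mk (x : Fin (m + 1) → X) :
    preRotate k A X m (TensorPow.mk k A x)
      = cyc k A fun i => x ((finRotate (m + 1)).symm i) := by
  rw [preRotate, TensorPow.lift_mk, LinearMap.comp_apply, LinearMap.comp_apply, rotateLin_tprod]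
  rfl

variable (k A X m) in
/-- The cyclic permutation `t : x₀ ⊗ ⋯ ⊗ xₘ ↦ xₘ ⊗ x₀ ⊗ ⋯ ⊗ xₘ₋₁` of
`H₀(A, X ⊗_A ⋯ ⊗_A X)`. -/
def rotate : Module.End k (H0 k A (TensorPow k A X m)) :=
  Submodule.liftQ _ (preRotate k A X m) <| Submodule.span_le.2 <| by
    rintro _ ⟨a, z, rfl⟩
    have h : preRotate k A X m ∘ₗ TensorPow.leftMul k A X m a
        = preRotate k A X m ∘ₗ TensorPow.rightMul k A X m (op a) :=
      TensorPow.hom_ext fun x => by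
        rw [LinearMap.comp_apply, LinearMap.comp_apply, TensorPow.leftMul_mk,
          TensorPow.rightMul_mk, preRotate_mk, preRotate_mk]
        have h := cyc_rotate_smul (k := k) x (Fin.last m) a
        rw [Fin.last_add_one] at h
        exact h.symm
    have h' : preRotate k A X m (a • z) = preRotate k A X m (op a • z) :=
      LinearMap.congr_fun h z
    simp [h']

theorem rotate_cyc (x : Fin (m + 1) → X) :
    rotate k A X m (cyc k A x) = cyc k A fun i => x ((finRotate (m + 1)).symm i) :=
  preRotate_mk x

theorem rotate_pow_cyc (n : ℕ) (x : Fin (m + 1) → X) :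
    (rotate k A X m ^ n) (cyc k A x) = cyc k A fun i => x (i - n • (1 : Fin (m + 1))) := by
  induction n generalizing x with
  | zero => simp
  | succ n ih =>
    rw [pow_succ, Module.End.mul_apply, rotate_cyc, ih]
    congr 1
    funext i
    congr 1
    rw [Equiv.symm_apply_eq, finRotate_apply, succ_nsmul]
    abel

theorem rotate_pow_card : rotate k A X m ^ (m + 1) = 1 := by
  refine Submodule.linearMap_qext _ (TensorPow.hom_ext fun x => ?_)
  have h := rotate_pow_cyc (k := k) (A := A) (m + 1) x
  have e : (m + 1) • (1 : Fin (m + 1)) = 0 := by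
    simpa using card_nsmul_eq_zero (x := (1 : Fin (m + 1)))
  rw [e] at h
  simp only [sub_zero] at h
  exact h

variable (k A X m) in
/-- The action of the cyclic group of order `m + 1` on `H₀(A, X ⊗_A ⋯ ⊗_A X)` (with `m + 1`
factors) whose generator acts by cyclic permutation. -/
def cyclicRep : Representation k (Multiplicative (ZMod (m + 1)))
    (H0 k A (TensorPow k A X m)) where
  toFun g := rotate k A X m ^ (ZMod.val g.toAdd)
  map_one' := by simp
  map_mul' g h := by
    rw [toAdd_mul, ZMod.val_add, ← pow_add,
      ← pow_eq_pow_mod _ rotate_pow_card]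

end Cyclic
end Power

/-! ### Tor over the enveloping algebra, and Hochschild homology -/

section Tor

variable (k R : Type u) [Field k] [Ring R] [Algebra k R]

/-- The category of `R`-bimodules (with central action of `k`), that is, of left modules over
`R ⊗ₖ Rᵒᵖ`; the element `r ⊗ s` acts by `x ↦ r x s`. -/
abbrev BimodCat : Type (u + 1) := ModuleCat.{u} (R ⊗[k] Rᵐᵒᵖ)

instance (X : BimodCat k R) : Module k X := ModuleCat.moduleOfAlgebraModule X

instance (X : BimodCat k R) : IsScalarTower k (R ⊗[k] Rᵐᵒᵖ) X :=
  ModuleCat.isScalarTower_of_algebra_moduleCat X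

/-- The bimodule given by commuting left and right actions of `R` that are compatible with `k`. -/
def bimod (X : Type u) [AddCommGroup X] [Module k X] [Module R X] [Module Rᵐᵒᵖ X]
    [IsScalarTower k R X] [IsScalarTower k Rᵐᵒᵖ X] [SMulCommClass R Rᵐᵒᵖ X] : BimodCat k R :=
  letI : Module (R ⊗[k] Rᵐᵒᵖ) X := TensorProduct.Algebra.module
  ModuleCat.of (R ⊗[k] Rᵐᵒᵖ) X

variable {k R} in
/-- The bimodule morphism given by a `k`-linear map that commutes with the actions of `R`. -/
def bimodHom {X Y : Type u} [AddCommGroup X] [Module k X] [Module R X] [Module Rᵐᵒᵖ X]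
    [IsScalarTower k R X] [IsScalarTower k Rᵐᵒᵖ X] [SMulCommClass R Rᵐᵒᵖ X]
    [AddCommGroup Y] [Module k Y] [Module R Y] [Module Rᵐᵒᵖ Y]
    [IsScalarTower k R Y] [IsScalarTower k Rᵐᵒᵖ Y] [SMulCommClass R Rᵐᵒᵖ Y]
    (f : X →ₗ[k] Y) (hl : ∀ (r : R) (x : X), f (r • x) = r • f x)
    (hr : ∀ (r : Rᵐᵒᵖ) (x : X), f (r • x) = r • f x) : bimod k R X ⟶ bimod k R Y :=
  letI : Module (R ⊗[k] Rᵐᵒᵖ) X := TensorProduct.Algebra.module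
  letI : Module (R ⊗[k] Rᵐᵒᵖ) Y := TensorProduct.Algebra.module
  ModuleCat.ofHom
    { toFun := f
      map_add' := map_add f
      map_smul' := fun e x => by
        induction e using TensorProduct.induction_on with
        | zero =>
          exact (congrArg f (zero_smul (R ⊗[k] Rᵐᵒᵖ) x)).trans
            ((map_zero f).trans (zero_smul (R ⊗[k] Rᵐᵒᵖ) (f x)).symm)
        | tmul r s => simp [TensorProduct.Algebra.smul_def, hl, hr]
        | add e e' h h' => simp only [add_smul, map_add, h, h', RingHom.id_apply] at * }

variable {k R}

/-- The subspace of `X ⊗ₖ Y` spanned by the elements `s x r ⊗ y - x ⊗ r y s`. -/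
def bimodRel (X Y : BimodCat k R) : Submodule k (X ⊗[k] Y) :=
  Submodule.span k {z | ∃ (r s : R) (x : X) (y : Y),
    z = ((s ⊗ₜ[k] op r : R ⊗[k] Rᵐᵒᵖ) • x) ⊗ₜ[k] y
      - x ⊗ₜ[k] ((r ⊗ₜ[k] op s : R ⊗[k] Rᵐᵒᵖ) • y)}

/-- The tensor product `X ⊗_{R-R} Y` of bimodules, that is, their tensor product
over `R ⊗ₖ Rᵒᵖ`. -/
abbrev BimodTensor (X Y : BimodCat k R) : Type u := (X ⊗[k] Y) ⧸ bimodRel X Y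

/-- The map `X ⊗_{R-R} Y → X' ⊗_{R-R} Y'` induced by bimodule morphisms. -/
def bimodTensorMap {X X' Y Y' : BimodCat k R} (f : X ⟶ X') (g : Y ⟶ Y') :
    BimodTensor X Y →ₗ[k] BimodTensor X' Y' :=
  Submodule.mapQ _ _
    (TensorProduct.map (f.hom.restrictScalars k) (g.hom.restrictScalars k)) <|
      Submodule.span_le.2 <| by
        rintro _ ⟨r, s, x, y, rfl⟩
        refine Submodule.subset_span ⟨r, s, f x, g y, ?_⟩
        simp

theorem bimodTensor_hom_ext {X Y : BimodCat k R} {V : Type u} [AddCommGroup V] [Module k V]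
    {f g : BimodTensor X Y →ₗ[k] V}
    (h : ∀ x y, f (Submodule.Quotient.mk (x ⊗ₜ y)) = g (Submodule.Quotient.mk (x ⊗ₜ y))) :
    f = g :=
  Submodule.linearMap_qext _ (TensorProduct.ext' h)

theorem bimodTensorMap_mk {X X' Y Y' : BimodCat k R} (f : X ⟶ X') (g : Y ⟶ Y') (x : X) (y : Y) :
    bimodTensorMap f g (Submodule.Quotient.mk (x ⊗ₜ y)) = Submodule.Quotient.mk (f x ⊗ₜ g y) :=
  rfl

variable (k R) in
/-- The bifunctor `(X, Y) ↦ X ⊗_{R-R} Y`. -/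
def bimodTensor : BimodCat k R ⥤ BimodCat k R ⥤ ModuleCat.{u} k where
  obj X :=
    { obj := fun Y => ModuleCat.of k (BimodTensor X Y)
      map := fun g => ModuleCat.ofHom (bimodTensorMap (𝟙 X) g)
      map_id := fun Y => ModuleCat.hom_ext <| bimodTensor_hom_ext fun x y => rfl
      map_comp := fun f g => ModuleCat.hom_ext <| bimodTensor_hom_ext fun x y => rfl }
  map f :=
    { app := fun Y => ModuleCat.ofHom (bimodTensorMap f (𝟙 Y))
      naturality := fun Y Y' g => ModuleCat.hom_ext <| bimodTensor_hom_ext fun x y => rfl }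
  map_id X := by
    ext Y : 2
    exact ModuleCat.hom_ext <| bimodTensor_hom_ext fun x y => rfl
  map_comp f g := by
    ext Y : 2
    exact ModuleCat.hom_ext <| bimodTensor_hom_ext fun x y => rfl

instance (X : BimodCat k R) : ((bimodTensor k R).obj X).Additive where
  map_add {Y Y' f g} := ModuleCat.hom_ext <| bimodTensor_hom_ext fun x y => by
    change Submodule.Quotient.mk (x ⊗ₜ (f y + g y)) = _
    rw [TensorProduct.tmul_add]
    rfl

instance : (bimodTensor k R).Additive where
  map_add {X X' f g} := by
    ext Y : 2
    refine ModuleCat.hom_ext <| bimodTensor_hom_ext fun x y => ?_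
    change Submodule.Quotient.mk ((f x + g x) ⊗ₜ y) = _
    rw [TensorProduct.add_tmul]
    rfl

variable (k R) in
/-- `Tor^{R-R}_n(X, Y)`, the `n`-th left derived functor of `X ⊗_{R-R} -` evaluated at `Y`. -/
def tor (n : ℕ) : BimodCat k R ⥤ BimodCat k R ⥤ ModuleCat.{u} k where
  obj X := ((bimodTensor k R).obj X).leftDerived n
  map f := NatTrans.leftDerived ((bimodTensor k R).map f) n

/-- For a complex `P` of bimodules, the functor sending a bimodule `X` to the
complex `X ⊗_{R-R} P`. -/
def tensorComplex (P : ChainComplex (BimodCat k R) ℕ) :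
    BimodCat k R ⥤ ChainComplex (ModuleCat.{u} k) ℕ where
  obj X := (((bimodTensor k R).obj X).mapHomologicalComplex _).obj P
  map f := (NatTrans.mapHomologicalComplex ((bimodTensor k R).map f) _).app P
  map_id X := by simp
  map_comp f g := by simp

instance (P : ChainComplex (BimodCat k R) ℕ) : (tensorComplex P).PreservesZeroMorphisms where
  map_zero X X' := by
    ext n : 1
    simp [tensorComplex]
    rfl

/-- `δ : Tor_{n+1}(X₃, Y) → Tor_n(X₁, Y)` is the connecting homomorphism of the long exact
sequence associated with the short exact sequence `S : 0 → X₁ → X₂ → X₃ → 0`: tensoring `S` with a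
projective resolution `P` of `Y` gives a short exact sequence of complexes
`0 → X₁ ⊗ P → X₂ ⊗ P → X₃ ⊗ P → 0`, whose connecting homomorphism on homology is `δ`. -/
def IsTorConnecting (S : ShortComplex (BimodCat k R)) (Y : BimodCat k R) (n : ℕ)
    (δ : ((tor k R (n + 1)).obj S.X₃).obj Y ⟶ ((tor k R n).obj S.X₁).obj Y) : Prop :=
  ∃ (P : ProjectiveResolution Y) (hS : (S.map (tensorComplex P.complex)).ShortExact),
    δ = (P.isoLeftDerivedObj ((bimodTensor k R).obj S.X₃) (n + 1)).hom ≫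
      hS.δ (n + 1) n rfl ≫ (P.isoLeftDerivedObj ((bimodTensor k R).obj S.X₁) n).inv

variable (k R) in
/-- The Hochschild homology `HH_n(R) = Tor^{R-R}_n(R, R)`. -/
abbrev HH (n : ℕ) : ModuleCat.{u} k := ((tor k R n).obj (bimod k R R)).obj (bimod k R R)

end Tor

/-! ### Null-square algebras -/

/-- Matrices with diagonal entries in `A` and `B` and off-diagonal entries in `N` and `M`. -/
@[ext]
structure NullSquare (A B M N : Type u) where
  /-- The upper left entry. -/
  a : A
  /-- The upper right entry. -/
  n : N
  /-- The lower left entry. -/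
  m : M
  /-- The lower right entry. -/
  b : B

namespace NullSquare

variable {A B M N : Type u} [Ring A] [Ring B]
  [AddCommGroup M] [Module B M] [Module Aᵐᵒᵖ M]
  [AddCommGroup N] [Module A N] [Module Bᵐᵒᵖ N]

instance : Zero (NullSquare A B M N) := ⟨⟨0, 0, 0, 0⟩⟩
instance : One (NullSquare A B M N) := ⟨⟨1, 0, 0, 1⟩⟩
instance : Add (NullSquare A B M N) := ⟨fun x y => ⟨x.a + y.a, x.n + y.n, x.m + y.m, x.b + y.b⟩⟩
instance : Neg (NullSquare A B M N) := ⟨fun x => ⟨-x.a, -x.n, -x.m, -x.b⟩⟩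

/-- Matrix multiplication, in which the products of `M` with `N` and of `N` with `M` are zero. -/
instance : Mul (NullSquare A B M N) :=
  ⟨fun x y => ⟨x.a * y.a, x.a • y.n + op y.b • x.n, op y.a • x.m + x.b • y.m, x.b * y.b⟩⟩

@[simp] theorem zero_a : (0 : NullSquare A B M N).a = 0 := rfl
@[simp] theorem zero_n : (0 : NullSquare A B M N).n = 0 := rfl
@[simp] theorem zero_m : (0 : NullSquare A B M N).m = 0 := rfl
@[simp] theorem zero_b : (0 : NullSquare A B M N).b = 0 := rfl
@[simp] theorem one_a : (1 : NullSquare A B M N).a = 1 := rfl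
@[simp] theorem one_n : (1 : NullSquare A B M N).n = 0 := rfl
@[simp] theorem one_m : (1 : NullSquare A B M N).m = 0 := rfl
@[simp] theorem one_b : (1 : NullSquare A B M N).b = 1 := rfl
@[simp] theorem add_a (x y : NullSquare A B M N) : (x + y).a = x.a + y.a := rfl
@[simp] theorem add_n (x y : NullSquare A B M N) : (x + y).n = x.n + y.n := rfl
@[simp] theorem add_m (x y : NullSquare A B M N) : (x + y).m = x.m + y.m := rfl
@[simp] theorem add_b (x y : NullSquare A B M N) : (x + y).b = x.b + y.b := rfl
@[simp] theorem neg_a (x : NullSquare A B M N) : (-x).a = -x.a := rfl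
@[simp] theorem neg_n (x : NullSquare A B M N) : (-x).n = -x.n := rfl
@[simp] theorem neg_m (x : NullSquare A B M N) : (-x).m = -x.m := rfl
@[simp] theorem neg_b (x : NullSquare A B M N) : (-x).b = -x.b := rfl
@[simp] theorem mul_a (x y : NullSquare A B M N) : (x * y).a = x.a * y.a := rfl
@[simp] theorem mul_n (x y : NullSquare A B M N) : (x * y).n = x.a • y.n + op y.b • x.n := rfl
@[simp] theorem mul_m (x y : NullSquare A B M N) : (x * y).m = op y.a • x.m + x.b • y.m := rfl
@[simp] theorem mul_b (x y : NullSquare A B M N) : (x * y).b = x.b * y.b := rfl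

variable [SMulCommClass B Aᵐᵒᵖ M] [SMulCommClass A Bᵐᵒᵖ N]

instance : Ring (NullSquare A B M N) where
  add_assoc _ _ _ := by ext <;> simp [add_assoc]
  zero_add _ := by ext <;> simp
  add_zero _ := by ext <;> simp
  add_comm _ _ := by ext <;> simp [add_comm]
  neg_add_cancel _ := by ext <;> simp
  zero_mul _ := by ext <;> simp
  mul_zero _ := by ext <;> simp
  one_mul _ := by ext <;> simp
  mul_one _ := by ext <;> simp
  left_distrib _ _ _ := by ext <;> simp [mul_add, add_smul, add_add_add_comm]
  right_distrib _ _ _ := by ext <;> simp [add_mul, add_smul, add_add_add_comm]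
  mul_assoc x y z := by
    ext <;> simp [mul_assoc, mul_smul, add_assoc, smul_comm]
  nsmul := nsmulRec
  zsmul := zsmulRec

/-- The inclusion of the diagonal subalgebra `C = A × B`. -/
def diag : A × B →+* NullSquare A B M N where
  toFun c := ⟨c.1, 0, 0, c.2⟩
  map_one' := rfl
  map_mul' _ _ := by ext <;> simp
  map_zero' := rfl
  map_add' _ _ := by ext <;> simp

instance : Module (A × B) (NullSquare A B M N) := Module.compHom _ (diag (M := M) (N := N))

instance : Module (A × B)ᵐᵒᵖ (NullSquare A B M N) :=
  Module.compHom _ (RingHom.op (diag (A := A) (B := B) (M := M) (N := N)))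

theorem diag_smul (c : A × B) (x : NullSquare A B M N) : c • x = diag c * x := rfl

theorem op_diag_smul (c : (A × B)ᵐᵒᵖ) (x : NullSquare A B M N) : c • x = x * diag c.unop := rfl

instance : SMulCommClass (NullSquare A B M N) (A × B)ᵐᵒᵖ (NullSquare A B M N) where
  smul_comm x c y := by simp only [op_diag_smul, smul_eq_mul, mul_assoc]

instance : SMulCommClass (A × B) (NullSquare A B M N)ᵐᵒᵖ (NullSquare A B M N) where
  smul_comm c x y := by simp only [diag_smul, smul_eq_mul_unop, mul_assoc]

section Algebra

variable {k : Type u} [Field k] [Algebra k A] [Algebra k B] [Module k M] [Module k N]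

instance : SMul k (NullSquare A B M N) := ⟨fun c x => ⟨c • x.a, c • x.n, c • x.m, c • x.b⟩⟩

@[simp] theorem smul_a (c : k) (x : NullSquare A B M N) : (c • x).a = c • x.a := rfl
@[simp] theorem smul_n (c : k) (x : NullSquare A B M N) : (c • x).n = c • x.n := rfl
@[simp] theorem smul_m (c : k) (x : NullSquare A B M N) : (c • x).m = c • x.m := rfl
@[simp] theorem smul_b (c : k) (x : NullSquare A B M N) : (c • x).b = c • x.b := rfl

instance : Module k (NullSquare A B M N) where
  one_smul _ := by ext <;> simp
  mul_smul _ _ _ := by ext <;> simp [mul_smul]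
  smul_zero _ := by ext <;> simp
  smul_add _ _ _ := by ext <;> simp
  add_smul _ _ _ := by ext <;> simp [add_smul]
  zero_smul _ := by ext <;> simp

variable [IsScalarTower k B M] [IsScalarTower k Aᵐᵒᵖ M] [IsScalarTower k A N]
  [IsScalarTower k Bᵐᵒᵖ N]

instance : Algebra k (NullSquare A B M N) :=
  Algebra.ofModule
    (fun c x y => by ext <;> simp [smul_comm c])
    (fun c x y => by ext <;> simp [smul_comm c])

end Algebra

end NullSquare

section RelativeTensor

variable (k A B M N : Type u) [Field k] [Ring A] [Algebra k A] [Ring B] [Algebra k B]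
  [AddCommGroup M] [Module k M] [Module B M] [Module Aᵐᵒᵖ M]
  [IsScalarTower k B M] [IsScalarTower k Aᵐᵒᵖ M] [SMulCommClass B Aᵐᵒᵖ M]
  [AddCommGroup N] [Module k N] [Module A N] [Module Bᵐᵒᵖ N]
  [IsScalarTower k A N] [IsScalarTower k Bᵐᵒᵖ N] [SMulCommClass A Bᵐᵒᵖ N]

/-- The `Λ`-bimodule `Λ ⊗_C Λ`, where `Λ` is the null-square algebra and `C = A × B`. -/
abbrev relTensor : BimodCat k (NullSquare A B M N) :=
  bimod k (NullSquare A B M N)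
    (BalTensor k (A × B) (NullSquare A B M N) (NullSquare A B M N))

/-- The product map `x ⊗ y ↦ x y` as a linear map `Λ ⊗_C Λ → Λ`. -/
def relMulLin : BalTensor k (A × B) (NullSquare A B M N) (NullSquare A B M N) →ₗ[k]
    NullSquare A B M N :=
  BalTensor.lift (LinearMap.mul' k (NullSquare A B M N)) fun x c y => by
    simp [NullSquare.diag_smul, NullSquare.op_diag_smul, mul_assoc]

theorem relMulLin_mk (x y : NullSquare A B M N) :
    relMulLin k A B M N (BalTensor.mk k (A × B) _ _ (x ⊗ₜ y)) = x * y := rfl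

theorem relMulLin_smul (r : NullSquare A B M N)
    (z : BalTensor k (A × B) (NullSquare A B M N) (NullSquare A B M N)) :
    relMulLin k A B M N (r • z) = r • relMulLin k A B M N z :=
  LinearMap.congr_fun
    (f := relMulLin k A B M N ∘ₗ BalTensor.leftMul k (A × B) _ _ (NullSquare A B M N) r)
    (g := LinearMap.mulLeft k r ∘ₗ relMulLin k A B M N)
    (BalTensor.hom_ext fun x y => by
      simp [BalTensor.leftMul_mk, relMulLin_mk, mul_assoc]) z

theorem relMulLin_op_smul (r : (NullSquare A B M N)ᵐᵒᵖ)
    (z : BalTensor k (A × B) (NullSquare A B M N) (NullSquare A B M N)) :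
    relMulLin k A B M N (r • z) = r • relMulLin k A B M N z :=
  LinearMap.congr_fun
    (f := relMulLin k A B M N ∘ₗ BalTensor.rightMul k (A × B) _ _ (NullSquare A B M N) r)
    (g := LinearMap.mulRight k r.unop ∘ₗ relMulLin k A B M N)
    (BalTensor.hom_ext fun x y => by
      simp [BalTensor.rightMul_mk, relMulLin_mk, mul_assoc]) z

/-- The morphism of `Λ`-bimodules `Λ ⊗_C Λ → Λ` given by the product of `Λ`. -/
def relMul : relTensor k A B M N ⟶ bimod k (NullSquare A B M N) (NullSquare A B M N) :=
  bimodHom (relMulLin k A B M N) (relMulLin_smul k A B M N) (relMulLin_op_smul k A B M N)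

/-- The sequence of `Λ`-bimodules `0 → K → Λ ⊗_C Λ → Λ → 0`, where `K` is the kernel of
the product map. -/
abbrev relSeq : ShortComplex (BimodCat k (NullSquare A B M N)) :=
  ShortComplex.mk (ModuleCat.ofHom (LinearMap.ker (relMul k A B M N).hom).subtype)
    (relMul k A B M N) (by ext x; exact x.2)

end RelativeTensor

/-- A `B`-`A`-bimodule is projective if it is projective as a module over `B ⊗ₖ Aᵒᵖ`. -/
def IsProjectiveBimod (k B A M : Type u) [Field k] [Ring A] [Algebra k A] [Ring B] [Algebra k B]
    [AddCommGroup M] [Module k M] [Module B M] [Module Aᵐᵒᵖ M]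
    [IsScalarTower k B M] [IsScalarTower k Aᵐᵒᵖ M] [SMulCommClass B Aᵐᵒᵖ M] : Prop :=
  letI : Module (B ⊗[k] Aᵐᵒᵖ) M := TensorProduct.Algebra.module
  Module.Projective (B ⊗[k] Aᵐᵒᵖ) M

/-- The action of the cyclic group of order `m + 1` on `H₀(A, (N ⊗_B M) ⊗_A ⋯ ⊗_A (N ⊗_B M))`
(with `m + 1` factors) by cyclic permutation of the factors. -/
abbrev cyclicNM (k A B M N : Type u) [Field k] [Ring A] [Algebra k A] [Ring B] [Algebra k B]
    [AddCommGroup M] [Module k M] [Module B M] [Module Aᵐᵒᵖ M]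
    [IsScalarTower k B M] [IsScalarTower k Aᵐᵒᵖ M] [SMulCommClass B Aᵐᵒᵖ M]
    [AddCommGroup N] [Module k N] [Module A N] [Module Bᵐᵒᵖ N]
    [IsScalarTower k A N] [IsScalarTower k Bᵐᵒᵖ N] [SMulCommClass A Bᵐᵒᵖ N] (m : ℕ) :
    Representation k (Multiplicative (ZMod (m + 1)))
      (H0 k A (TensorPow k A (BalTensor k B N M) m)) :=
  cyclicRep k A (BalTensor k B N M) m

end
end NullSquareHH

open NullSquareHH

namespace NullSquareHH

noncomputable section

section BimodTensor

variable {k R : Type u} [Field k] [Ring R] [Algebra k R]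

/-- The class of `x ⊗ y` in `X ⊗_{R-R} Y`. -/
def bimk {X Y : BimodCat k R} (x : X) (y : Y) : BimodTensor X Y :=
  Submodule.Quotient.mk (x ⊗ₜ[k] y)

theorem bimodTensorMap_bimk {X X' Y Y' : BimodCat k R} (f : X ⟶ X') (g : Y ⟶ Y') (x : X) (y : Y) :
    bimodTensorMap f g (bimk x y) = bimk (f x) (g y) := rfl

theorem bimk_add_left {X Y : BimodCat k R} (x x' : X) (y : Y) :
    bimk (x + x') y = bimk x y + bimk x' y := by
  simp only [bimk, TensorProduct.add_tmul, Submodule.Quotient.mk_add]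

theorem bimk_add_right {X Y : BimodCat k R} (x : X) (y y' : Y) :
    bimk x (y + y') = bimk x y + bimk x y' := by
  simp only [bimk, TensorProduct.tmul_add, Submodule.Quotient.mk_add]

theorem bimk_smul_left {X Y : BimodCat k R} (c : k) (x : X) (y : Y) :
    bimk (c • x) y = c • bimk x y := by
  simp only [bimk, ← TensorProduct.smul_tmul', Submodule.Quotient.mk_smul]

theorem bimk_smul_right {X Y : BimodCat k R} (c : k) (x : X) (y : Y) :
    bimk x (c • y) = c • bimk x y := by
  simp only [bimk, TensorProduct.tmul_smul, Submodule.Quotient.mk_smul]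

/-- The bilinear map `(x, y) ↦ x ⊗ y`. -/
def bimkLin (X Y : BimodCat k R) : X →ₗ[k] Y →ₗ[k] BimodTensor X Y :=
  LinearMap.mk₂ k bimk bimk_add_left bimk_smul_left bimk_add_right bimk_smul_right

theorem bimk_balanced {X Y : BimodCat k R} (r s : R) (x : X) (y : Y) :
    bimk ((s ⊗ₜ[k] op r : R ⊗[k] Rᵐᵒᵖ) • x) y = bimk x ((r ⊗ₜ[k] op s : R ⊗[k] Rᵐᵒᵖ) • y) :=
  (Submodule.Quotient.eq _).2 (Submodule.subset_span ⟨r, s, x, y, rfl⟩)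

/-- The linear map on `X ⊗_{R-R} Y` induced by a balanced bilinear map. -/
def bimodLift {X Y : BimodCat k R} {V : Type u} [AddCommGroup V] [Module k V]
    (f : X →ₗ[k] Y →ₗ[k] V)
    (h : ∀ (r s : R) (x : X) (y : Y), f ((s ⊗ₜ[k] op r : R ⊗[k] Rᵐᵒᵖ) • x) y
      = f x ((r ⊗ₜ[k] op s : R ⊗[k] Rᵐᵒᵖ) • y)) : BimodTensor X Y →ₗ[k] V :=
  Submodule.liftQ _ (TensorProduct.lift f) <| Submodule.span_le.2 <| by
    rintro _ ⟨r, s, x, y, rfl⟩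
    simp [h]

theorem bimodLift_bimk {X Y : BimodCat k R} {V : Type u} [AddCommGroup V] [Module k V]
    (f : X →ₗ[k] Y →ₗ[k] V)
    (h : ∀ (r s : R) (x : X) (y : Y), f ((s ⊗ₜ[k] op r : R ⊗[k] Rᵐᵒᵖ) • x) y
      = f x ((r ⊗ₜ[k] op s : R ⊗[k] Rᵐᵒᵖ) • y)) (x : X) (y : Y) :
    bimodLift f h (bimk x y) = f x y := rfl

theorem bimodTensor_ext {X Y : BimodCat k R} {V : Type u} [AddCommGroup V] [Module k V]
    {f g : BimodTensor X Y →ₗ[k] V} (h : ∀ x y, f (bimk x y) = g (bimk x y)) : f = g :=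
  bimodTensor_hom_ext h

/-- The symmetry `X ⊗_{R-R} Y → Y ⊗_{R-R} X`. -/
def bimodSwap (X Y : BimodCat k R) : BimodTensor X Y →ₗ[k] BimodTensor Y X :=
  bimodLift (bimkLin Y X).flip fun r s x y => (bimk_balanced s r y x).symm

theorem bimodSwap_swap (X Y : BimodCat k R) (z : BimodTensor X Y) :
    bimodSwap Y X (bimodSwap X Y z) = z :=
  LinearMap.congr_fun (f := bimodSwap Y X ∘ₗ bimodSwap X Y) (g := LinearMap.id)
    (bimodTensor_ext fun _ _ => rfl) z

theorem bimodSwap_map {X X' Y Y' : BimodCat k R} (f : X ⟶ X') (g : Y ⟶ Y')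
    (z : BimodTensor X Y) :
    bimodSwap X' Y' (bimodTensorMap f g z) = bimodTensorMap g f (bimodSwap X Y z) :=
  LinearMap.congr_fun (f := bimodSwap X' Y' ∘ₗ bimodTensorMap f g)
    (g := bimodTensorMap g f ∘ₗ bimodSwap X Y) (bimodTensor_ext fun _ _ => rfl) z

variable (k R) in
/-- The anti-automorphism `r ⊗ s ↦ s ⊗ r` of the enveloping algebra. -/
def envFlip : R ⊗[k] Rᵐᵒᵖ →ₗ[k] R ⊗[k] Rᵐᵒᵖ :=
  (TensorProduct.comm k Rᵐᵒᵖ R).toLinearMap ∘ₗ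
    TensorProduct.map (opLinearEquiv k).toLinearMap (opLinearEquiv k).symm.toLinearMap

theorem envFlip_tmul (r : R) (s : Rᵐᵒᵖ) :
    envFlip k R (r ⊗ₜ s) = s.unop ⊗ₜ op r := rfl

theorem envFlip_mul (e e' : R ⊗[k] Rᵐᵒᵖ) :
    envFlip k R (e * e') = envFlip k R e' * envFlip k R e := by
  induction e using TensorProduct.induction_on with
  | zero => simp
  | add x y hx hy => simp [add_mul, mul_add, hx, hy]
  | tmul r s =>
    induction e' using TensorProduct.induction_on with
    | zero => simp
    | add x y hx hy => simp [add_mul, mul_add, hx, hy]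
    | tmul r' s' => simp [envFlip_tmul, Algebra.TensorProduct.tmul_mul_tmul]

theorem bimk_envFlip {X Y : BimodCat k R} (e : R ⊗[k] Rᵐᵒᵖ) (x : X) (y : Y) :
    bimk (envFlip k R e • x) y = bimk x (e • y) := by
  induction e using TensorProduct.induction_on with
  | zero =>
    have h0 : (0 : R ⊗[k] Rᵐᵒᵖ) • x = 0 := zero_smul (R ⊗[k] Rᵐᵒᵖ) x
    have h0' : (0 : R ⊗[k] Rᵐᵒᵖ) • y = 0 := zero_smul (R ⊗[k] Rᵐᵒᵖ) y
    rw [map_zero, h0, h0']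
    exact ((bimkLin X Y).map_zero₂ y).trans ((bimkLin X Y) x).map_zero.symm
  | add a b ha hb => simp only [map_add, add_smul, bimk_add_left, bimk_add_right, ha, hb]
  | tmul r s => exact bimk_balanced r s.unop x y

/-- The map `e ↦ x e` for an element `x` of a bimodule. -/
def flipAct (X : BimodCat k R) : X →ₗ[k] (R ⊗[k] Rᵐᵒᵖ) →ₗ[k] X :=
  LinearMap.mk₂ k (fun x e => envFlip k R e • x) (fun _ _ _ => smul_add _ _ _)
    (fun c x e => (smul_comm c (envFlip k R e) x).symm)
    (fun x e e' => by simp only [map_add, add_smul])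
    (fun c x e => by simp only [map_smul, smul_assoc])

theorem flipAct_apply (X : BimodCat k R) (x : X) (e : R ⊗[k] Rᵐᵒᵖ) :
    flipAct X x e = envFlip k R e • x := rfl

/-- The coordinates of `x ⊗ p` with respect to a map from `P` to a free module. -/
def tensorCoord (X P : BimodCat k R) (s : P →ₗ[R ⊗[k] Rᵐᵒᵖ] (P →₀ R ⊗[k] Rᵐᵒᵖ)) :
    BimodTensor X P →ₗ[k] (P →₀ X) :=
  bimodLift
    (LinearMap.mk₂ k (fun x p => Finsupp.mapRange.linearMap (flipAct X x) (s p))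
      (fun x x' p => by ext q; simp)
      (fun c x p => by ext q; simp)
      (fun x p p' => by rw [map_add, map_add])
      (fun c x p => by
        rw [← LinearMap.map_smul]
        congr 1
        exact (s.restrictScalars k).map_smul c p)) <| by
    intro r t x p
    ext q
    simp only [LinearMap.mk₂_apply, Finsupp.mapRange.linearMap_apply, Finsupp.mapRange_apply,
      map_smul, Finsupp.smul_apply, flipAct_apply, smul_eq_mul, envFlip_mul, mul_smul]
    rfl

theorem tensorCoord_bimk (X P : BimodCat k R) (s : P →ₗ[R ⊗[k] Rᵐᵒᵖ] (P →₀ R ⊗[k] Rᵐᵒᵖ))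
    (x : X) (p : P) :
    tensorCoord X P s (bimk x p) = Finsupp.mapRange.linearMap (flipAct X x) (s p) := rfl

theorem tensorCoord_map {X X' : BimodCat k R} (f : X ⟶ X') (P : BimodCat k R)
    (s : P →ₗ[R ⊗[k] Rᵐᵒᵖ] (P →₀ R ⊗[k] Rᵐᵒᵖ)) (z : BimodTensor X P) :
    tensorCoord X' P s (bimodTensorMap f (𝟙 P) z)
      = Finsupp.mapRange.linearMap (f.hom.restrictScalars k) (tensorCoord X P s z) :=
  LinearMap.congr_fun (f := tensorCoord X' P s ∘ₗ bimodTensorMap f (𝟙 P))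
    (g := Finsupp.mapRange.linearMap (f.hom.restrictScalars k) ∘ₗ tensorCoord X P s)
    (bimodTensor_ext fun x p => by
      simp only [LinearMap.comp_apply, bimodTensorMap_bimk, tensorCoord_bimk]
      ext q
      simp [flipAct_apply]) z

theorem tensorCoord_injective (X P : BimodCat k R)
    (s : P →ₗ[R ⊗[k] Rᵐᵒᵖ] (P →₀ R ⊗[k] Rᵐᵒᵖ))
    (hs : Function.LeftInverse (Finsupp.linearCombination (R ⊗[k] Rᵐᵒᵖ) id) s) :
    Function.Injective (tensorCoord X P s) := by
  refine Function.LeftInverse.injective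
    (g := Finsupp.lsum k fun p : P => (bimkLin X P).flip p) fun z => ?_
  refine LinearMap.congr_fun (f := (Finsupp.lsum k fun p : P => (bimkLin X P).flip p) ∘ₗ
    tensorCoord X P s) (g := LinearMap.id) (bimodTensor_ext fun x p => ?_) z
  have hp : Finsupp.linearCombination (R ⊗[k] Rᵐᵒᵖ) id (s p) = p := hs p
  rw [LinearMap.comp_apply, tensorCoord_bimk, LinearMap.id_apply]
  conv_rhs => rw [← hp]
  generalize s p = v
  induction v using Finsupp.induction_linear with
  | zero => simp only [map_zero]; exact ((bimkLin X P) x).map_zero.symm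
  | add v w hv hw => rw [map_add, map_add, map_add, bimk_add_right, hv, hw]
  | single q e =>
    simp only [Finsupp.mapRange.linearMap_apply, Finsupp.mapRange_single,
      Finsupp.linearCombination_single, id]
    rw [Finsupp.lsum_single]
    exact bimk_envFlip e x q

theorem bimodTensorMap_injective {X X' P : BimodCat k R} (f : X ⟶ X')
    (hf : Function.Injective f) (hP : Projective P) :
    Function.Injective (bimodTensorMap f (𝟙 P)) := by
  have : Module.Projective (R ⊗[k] Rᵐᵒᵖ) P := inferInstance
  obtain ⟨s, hs⟩ := this.out
  intro z w h
  apply tensorCoord_injective X P s hs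
  have h' := congrArg (tensorCoord X' P s) h
  rw [tensorCoord_map, tensorCoord_map] at h'
  exact Finsupp.mapRange_injective _ (map_zero _) hf h'

theorem bimodTensorMap_surjective {X X' : BimodCat k R} (f : X ⟶ X')
    (hf : Function.Surjective f) (P : BimodCat k R) :
    Function.Surjective (bimodTensorMap f (𝟙 P)) := by
  rintro ⟨z⟩
  obtain ⟨w, rfl⟩ := TensorProduct.map_surjective (g := f.hom.restrictScalars k)
    (g' := (𝟙 P : P ⟶ P).hom.restrictScalars k) hf Function.surjective_id z
  exact ⟨Submodule.Quotient.mk w, rfl⟩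

theorem bimodTensorMap_exact {X₁ X₂ X₃ : BimodCat k R} (f : X₁ ⟶ X₂) (g : X₂ ⟶ X₃)
    (hfg : Function.Exact f g) (hg : Function.Surjective g) (P : BimodCat k R) :
    Function.Exact (bimodTensorMap f (𝟙 P)) (bimodTensorMap g (𝟙 P)) := by
  have hk : Function.Exact ((f.hom.restrictScalars k).rTensor P)
      ((g.hom.restrictScalars k).rTensor P) := rTensor_exact P hfg hg
  intro z
  constructor
  · obtain ⟨z, rfl⟩ := Submodule.Quotient.mk_surjective _ z
    intro h
    have h1 : (g.hom.restrictScalars k).rTensor P z ∈ bimodRel X₃ P :=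
      (Submodule.Quotient.mk_eq_zero _).1 h
    have h2 : bimodRel X₃ P ≤ (bimodRel X₂ P).map ((g.hom.restrictScalars k).rTensor P) := by
      refine Submodule.span_le.2 ?_
      rintro _ ⟨r, s, x, y, rfl⟩
      obtain ⟨x, rfl⟩ := hg x
      refine ⟨_, Submodule.subset_span ⟨r, s, x, y, rfl⟩, ?_⟩
      simp
    obtain ⟨w, hw, e⟩ := h2 h1
    obtain ⟨v, hv⟩ := (hk (z - w)).1 (by rw [map_sub, e, sub_self])
    refine ⟨Submodule.Quotient.mk v, ?_⟩
    refine (Submodule.Quotient.eq _).2 ?_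
    change (f.hom.restrictScalars k).rTensor P v - z ∈ _
    rw [hv]
    simpa using hw
  · rintro ⟨w, rfl⟩
    refine LinearMap.congr_fun (f := bimodTensorMap g (𝟙 P) ∘ₗ bimodTensorMap f (𝟙 P))
      (g := 0) (bimodTensor_ext fun x p => ?_) w
    change bimk (g (f x)) p = 0
    rw [(hfg (f x)).2 ⟨x, rfl⟩]
    exact (bimkLin X₃ P).map_zero₂ p

theorem bimodTensorMap_injective' {X X' P : BimodCat k R} (f : X ⟶ X')
    (hf : Function.Injective f) (hP : Projective P) :
    Function.Injective (bimodTensorMap (𝟙 P) f) := by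
  intro z w h
  have := congrArg (bimodSwap P X') h
  rw [bimodSwap_map, bimodSwap_map] at this
  simpa [bimodSwap_swap] using congrArg (bimodSwap X P) (bimodTensorMap_injective f hf hP this)

theorem bimodTensorMap_surjective' {X X' : BimodCat k R} (f : X ⟶ X')
    (hf : Function.Surjective f) (P : BimodCat k R) :
    Function.Surjective (bimodTensorMap (𝟙 P) f) := by
  intro z
  obtain ⟨w, hw⟩ := bimodTensorMap_surjective f hf P (bimodSwap P X' z)
  refine ⟨bimodSwap X P w, ?_⟩
  rw [← bimodSwap_map, hw, bimodSwap_swap]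

theorem bimodTensorMap_exact' {X₁ X₂ X₃ : BimodCat k R} (f : X₁ ⟶ X₂) (g : X₂ ⟶ X₃)
    (hfg : Function.Exact f g) (hg : Function.Surjective g) (P : BimodCat k R) :
    Function.Exact (bimodTensorMap (𝟙 P) f) (bimodTensorMap (𝟙 P) g) := by
  intro z
  have h := bimodTensorMap_exact f g hfg hg P (bimodSwap P X₂ z)
  rw [← bimodSwap_map] at h
  constructor
  · intro hz
    obtain ⟨w, hw⟩ := h.1 (by rw [hz, map_zero])
    refine ⟨bimodSwap X₁ P w, ?_⟩
    rw [← bimodSwap_map, hw, bimodSwap_swap]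
  · rintro ⟨w, rfl⟩
    have := h.2 ⟨bimodSwap P X₁ w, (bimodSwap_map _ _ _).symm⟩
    rw [← bimodSwap_swap P X₃ (bimodTensorMap (𝟙 P) g _), this, map_zero]

end BimodTensor

section TorSequence

open Limits

variable {k R : Type u} [Field k] [Ring R] [Algebra k R]

theorem shortExact_functionExact {A : Type u} [Ring A] {S : ShortComplex (ModuleCat.{u} A)}
    (hS : S.ShortExact) : Function.Exact S.f S.g :=
  (ShortComplex.ShortExact.moduleCat_exact_iff_function_exact S).1 hS.exact

instance (X : BimodCat k R) : PreservesFiniteColimits ((bimodTensor k R).obj X) := by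
  refine (Functor.preservesFiniteColimits_iff_forall_exact_map_and_epi _).2
    fun S hS => ⟨?_, ?_⟩
  · exact ModuleCat.shortComplex_exact _
      (bimodTensorMap_exact' S.f S.g (shortExact_functionExact hS) hS.moduleCat_surjective_g X)
  · exact (ModuleCat.epi_iff_surjective _).2
      (bimodTensorMap_surjective' S.g hS.moduleCat_surjective_g X)

theorem bimodTensor_preservesHomology (X : BimodCat k R) (hX : Projective X) :
    ((bimodTensor k R).obj X).PreservesHomology := by
  refine ((Functor.exact_tfae ((bimodTensor k R).obj X)).out 0 2).1 fun S hS => ?_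
  exact ModuleCat.shortComplex_shortExact _
    (bimodTensorMap_exact' S.f S.g (shortExact_functionExact hS) hS.moduleCat_surjective_g X)
    (bimodTensorMap_injective' S.f hS.moduleCat_injective_f hX)
    (bimodTensorMap_surjective' S.g hS.moduleCat_surjective_g X)

theorem tensorComplex_shortExact {S : ShortComplex (BimodCat k R)} (hS : S.ShortExact)
    {Y : BimodCat k R} (P : ProjectiveResolution Y) :
    (S.map (tensorComplex P.complex)).ShortExact := by
  refine HomologicalComplex.shortExact_of_degreewise_shortExact _ fun i => ?_
  exact ModuleCat.shortComplex_shortExact _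
    (bimodTensorMap_exact S.f S.g (shortExact_functionExact hS) hS.moduleCat_surjective_g _)
    (bimodTensorMap_injective S.f hS.moduleCat_injective_f (P.projective i))
    (bimodTensorMap_surjective S.g hS.moduleCat_surjective_g _)

/-- The vector space `Tor^{R-R}_n(X, Y)`. -/
abbrev TorObj (n : ℕ) (X Y : BimodCat k R) : ModuleCat.{u} k := ((tor k R n).obj X).obj Y

/-- The map `Tor^{R-R}_n(X, Y) → Tor^{R-R}_n(X', Y)` induced by `X → X'`. -/
abbrev torMap (n : ℕ) {X X' : BimodCat k R} (f : X ⟶ X') (Y : BimodCat k R) :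
    TorObj n X Y ⟶ TorObj n X' Y :=
  ((tor k R n).map f).app Y

theorem torMap_eq (n : ℕ) {X X' : BimodCat k R} (f : X ⟶ X') {Y : BimodCat k R}
    (P : ProjectiveResolution Y) :
    torMap n f Y = (P.isoLeftDerivedObj ((bimodTensor k R).obj X) n).hom ≫
      HomologicalComplex.homologyMap ((tensorComplex P.complex).map f) n ≫
      (P.isoLeftDerivedObj ((bimodTensor k R).obj X') n).inv :=
  P.leftDerived_app_eq ((bimodTensor k R).map f) n

/-- The connecting homomorphism of the long exact sequence of `Tor(-, Y)`. -/
def torδ {S : ShortComplex (BimodCat k R)} (hS : S.ShortExact) (Y : BimodCat k R) (n : ℕ) :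
    TorObj (n + 1) S.X₃ Y ⟶ TorObj n S.X₁ Y :=
  ((projectiveResolution Y).isoLeftDerivedObj ((bimodTensor k R).obj S.X₃) (n + 1)).hom ≫
    (tensorComplex_shortExact hS (projectiveResolution Y)).δ (n + 1) n rfl ≫
    ((projectiveResolution Y).isoLeftDerivedObj ((bimodTensor k R).obj S.X₁) n).inv

theorem isTorConnecting_torδ {S : ShortComplex (BimodCat k R)} (hS : S.ShortExact)
    (Y : BimodCat k R) (n : ℕ) : IsTorConnecting S Y n (torδ hS Y n) :=
  ⟨projectiveResolution Y, tensorComplex_shortExact hS _, rfl⟩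

theorem exact_conj_iso {A : Type u} [Ring A] {X₁ X₂ X₃ Y₁ Y₂ Y₃ : ModuleCat.{u} A}
    (e₁ : X₁ ≅ Y₁) (e₂ : X₂ ≅ Y₂) (e₃ : X₃ ≅ Y₃) {f : Y₁ ⟶ Y₂} {g : Y₂ ⟶ Y₃}
    (h : Function.Exact f g) :
    Function.Exact (e₁.hom ≫ f ≫ e₂.inv) (e₂.hom ≫ g ≫ e₃.inv) := by
  intro x
  have hinj : Function.Injective e₃.inv := (ModuleCat.mono_iff_injective _).1 inferInstance
  have h1 : (e₂.hom ≫ g ≫ e₃.inv) x = e₃.inv (g (e₂.hom x)) := by simp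
  rw [h1, map_eq_zero_iff _ hinj, h]
  constructor
  · rintro ⟨y, hy⟩
    exact ⟨e₁.inv y, by simp [hy]⟩
  · rintro ⟨y, rfl⟩
    exact ⟨e₁.hom y, by simp⟩

theorem tor_exact₂ {S : ShortComplex (BimodCat k R)} (hS : S.ShortExact) (Y : BimodCat k R)
    (n : ℕ) : Function.Exact (torMap n S.f Y) (torMap n S.g Y) := by
  rw [torMap_eq n S.f (projectiveResolution Y), torMap_eq n S.g (projectiveResolution Y)]
  exact exact_conj_iso _ _ _ <| (ShortComplex.ShortExact.moduleCat_exact_iff_function_exact _).1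
    ((tensorComplex_shortExact hS (projectiveResolution Y)).homology_exact₂ n)

theorem tor_exact₃ {S : ShortComplex (BimodCat k R)} (hS : S.ShortExact) (Y : BimodCat k R)
    (n : ℕ) : Function.Exact (torMap (n + 1) S.g Y) (torδ hS Y n) := by
  rw [torMap_eq (n + 1) S.g (projectiveResolution Y)]
  exact exact_conj_iso _ _ _ <| (ShortComplex.ShortExact.moduleCat_exact_iff_function_exact _).1
    ((tensorComplex_shortExact hS (projectiveResolution Y)).homology_exact₃ (n + 1) n rfl)

theorem tor_exact₁ {S : ShortComplex (BimodCat k R)} (hS : S.ShortExact) (Y : BimodCat k R)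
    (n : ℕ) : Function.Exact (torδ hS Y n) (torMap n S.f Y) := by
  rw [torMap_eq n S.f (projectiveResolution Y)]
  exact exact_conj_iso _ _ _ <| (ShortComplex.ShortExact.moduleCat_exact_iff_function_exact _).1
    ((tensorComplex_shortExact hS (projectiveResolution Y)).homology_exact₁ (n + 1) n rfl)

theorem torObj_isZero {X : BimodCat k R} (hX : Projective X) (Y : BimodCat k R) (n : ℕ) :
    IsZero (TorObj (n + 1) X Y) := by
  refine IsZero.of_iso ?_
    ((projectiveResolution Y).isoLeftDerivedObj ((bimodTensor k R).obj X) (n + 1))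
  have := bimodTensor_preservesHomology X hX
  refine (HomologicalComplex.exactAt_iff_isZero_homology _ _).1 ?_
  exact ((projectiveResolution Y).complex_exactAt_succ n).map ((bimodTensor k R).obj X)

theorem fromLeftDerivedZero_naturality {C D : Type*} [Category C] [Category D] [Abelian C]
    [HasProjectiveResolutions C] [Abelian D] {F G : C ⥤ D} [F.Additive] [G.Additive] (α : F ⟶ G)
    (Y : C) : (NatTrans.leftDerived α 0).app Y ≫ G.fromLeftDerivedZero.app Y =
      F.fromLeftDerivedZero.app Y ≫ α.app Y := by
  have P := projectiveResolution Y
  have h : HomologicalComplex.opcyclesMap ((NatTrans.mapHomologicalComplex α _).app P.complex) 0 ≫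
      P.fromLeftDerivedZero' G = P.fromLeftDerivedZero' F ≫ α.app Y := by
    rw [← cancel_epi (HomologicalComplex.pOpcycles _ _)]
    rw [HomologicalComplex.p_opcyclesMap_assoc,
      ProjectiveResolution.pOpcycles_comp_fromLeftDerivedZero',
      ProjectiveResolution.pOpcycles_comp_fromLeftDerivedZero'_assoc]
    exact (α.naturality _).symm
  rw [P.fromLeftDerivedZero_eq, P.fromLeftDerivedZero_eq, P.leftDerived_app_eq α 0]
  simp only [Category.assoc, Iso.inv_hom_id_assoc]
  refine congrArg (fun x => (P.isoLeftDerivedObj F 0).hom ≫ x) ?_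
  refine (HomologicalComplex.homologyι_naturality_assoc _ _ _).trans ?_
  rw [h]
  exact (Category.assoc _ _ _).symm

/-- `Tor_0(X, Y)` is `X ⊗_{R-R} Y`. -/
def torZeroEquiv (X Y : BimodCat k R) : TorObj 0 X Y ≃ₗ[k] BimodTensor X Y :=
  (asIso (((bimodTensor k R).obj X).fromLeftDerivedZero.app Y)).toLinearEquiv

theorem torZeroEquiv_natural {X X' : BimodCat k R} (f : X ⟶ X') (Y : BimodCat k R)
    (z : TorObj 0 X Y) :
    torZeroEquiv X' Y (torMap 0 f Y z) = bimodTensorMap f (𝟙 Y) (torZeroEquiv X Y z) :=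
  LinearMap.congr_fun (congrArg ModuleCat.Hom.hom (fromLeftDerivedZero_naturality
    ((bimodTensor k R).map f) Y)) z

theorem tor_zero_surjective {S : ShortComplex (BimodCat k R)} (hS : S.ShortExact)
    (Y : BimodCat k R) : Function.Surjective (torMap 0 S.g Y) := by
  intro z
  obtain ⟨w, hw⟩ := bimodTensorMap_surjective S.g hS.moduleCat_surjective_g Y
    (torZeroEquiv _ _ z)
  refine ⟨(torZeroEquiv _ _).symm w, (torZeroEquiv _ _).injective ?_⟩
  rw [torZeroEquiv_natural, LinearEquiv.apply_symm_apply, hw]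

/-- Dimension shift in positive degrees along `0 → X₁ → X₂ → X₃ → 0` with `X₂` projective. -/
theorem torShift {S : ShortComplex (BimodCat k R)} (hS : S.ShortExact) (h : Projective S.X₂)
    (Y : BimodCat k R) (n : ℕ) :
    Nonempty (TorObj (n + 2) S.X₃ Y ≃ₗ[k] TorObj (n + 1) S.X₁ Y) := by
  have h₂ := ModuleCat.subsingleton_of_isZero (torObj_isZero h Y n)
  have h₂' := ModuleCat.subsingleton_of_isZero (torObj_isZero h Y (n + 1))
  refine ⟨LinearEquiv.ofBijective (torδ hS Y (n + 1)).hom ⟨?_, fun x => ?_⟩⟩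
  · refine (injective_iff_map_eq_zero _).2 fun x hx => ?_
    obtain ⟨y, rfl⟩ := (tor_exact₃ hS Y (n + 1) x).1 hx
    rw [Subsingleton.elim y 0, map_zero]
  · exact (tor_exact₁ hS Y (n + 1) x).1 (Subsingleton.elim _ _)

theorem torShift_one {S : ShortComplex (BimodCat k R)} (hS : S.ShortExact) (h : Projective S.X₂)
    (Y : BimodCat k R) :
    Nonempty (TorObj 1 S.X₃ Y ≃ₗ[k] LinearMap.ker (bimodTensorMap S.f (𝟙 Y))) := by
  have h₂ := ModuleCat.subsingleton_of_isZero (torObj_isZero h Y 0)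
  have key : ∀ z : TorObj 0 S.X₁ Y, torMap 0 S.f Y z = 0 ↔
      torZeroEquiv _ _ z ∈ LinearMap.ker (bimodTensorMap S.f (𝟙 Y)) := fun z => by
    rw [LinearMap.mem_ker, ← torZeroEquiv_natural, LinearEquiv.map_eq_zero_iff]
  refine ⟨LinearEquiv.ofBijective (((torZeroEquiv S.X₁ Y).toLinearMap ∘ₗ
    (torδ hS Y 0).hom).codRestrict _ fun x => ?_) ⟨?_, ?_⟩⟩
  · exact (key _).1 ((tor_exact₁ hS Y 0 _).2 ⟨x, rfl⟩)
  · refine (injective_iff_map_eq_zero _).2 fun x hx => ?_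
    have hx' : torδ hS Y 0 x = 0 := (torZeroEquiv S.X₁ Y).map_eq_zero_iff.1
      (congrArg Subtype.val hx)
    obtain ⟨y, rfl⟩ := (tor_exact₃ hS Y 0 x).1 hx'
    rw [Subsingleton.elim y 0, map_zero]
  · rintro ⟨z, hz⟩
    obtain ⟨w, rfl⟩ := (torZeroEquiv S.X₁ Y).surjective z
    obtain ⟨x, rfl⟩ := (tor_exact₁ hS Y 0 w).1 ((key w).2 hz)
    exact ⟨x, rfl⟩

theorem tor_iterated_shift (S : ℕ → ShortComplex (BimodCat k R)) (hS : ∀ i, (S i).ShortExact)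
    (h : ∀ i, Projective (S i).X₂) (e : ∀ i, (S i).X₁ = (S (i + 1)).X₃) (Y : BimodCat k R)
    (n i : ℕ) : Nonempty (TorObj (n + 1) (S i).X₃ Y ≃ₗ[k]
      LinearMap.ker (bimodTensorMap (S (i + n)).f (𝟙 Y))) := by
  induction n generalizing i with
  | zero => exact torShift_one (hS i) (h i) Y
  | succ n ih =>
    obtain ⟨a⟩ := torShift (hS i) (h i) Y n
    obtain ⟨b⟩ := ih (i + 1)
    rw [← e i, show i + 1 + n = i + (n + 1) by omega] at b
    exact ⟨a.trans b⟩

end TorSequence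

section ProjectiveModules

theorem projective_finsupp (R ι P : Type*) [Ring R] [AddCommGroup P] [Module R P]
    [Module.Projective R P] : Module.Projective R (ι →₀ P) := by
  classical
  exact Module.Projective.of_equiv (finsuppLequivDFinsupp (ι := ι) (M := P) R).symm

theorem projective_trans (R S P : Type*) [Ring R] [Ring S] [Module R S] [IsScalarTower R S S]
    [AddCommGroup P] [Module S P] [Module R P] [IsScalarTower R S P]
    [Module.Projective R S] [h : Module.Projective S P] : Module.Projective R P := by
  obtain ⟨s, hs⟩ := h.out
  have := projective_finsupp R P S
  refine Module.Projective.of_split (M := P →₀ S)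
    { toFun := s
      map_add' := map_add s
      map_smul' := fun r x => by
        rw [← one_smul S x, ← smul_assoc, map_smul, map_smul, one_smul]
        ext q
        simp }
    { toFun := Finsupp.linearCombination S id
      map_add' := map_add _
      map_smul' := fun r x => by
        induction x using Finsupp.induction_linear with
        | zero => simp
        | add x y hx hy => simp only [smul_add, map_add, hx, hy, RingHom.id_apply]
        | single p a => simp } ?_
  ext x
  exact hs x

variable {k A B M : Type u} [Field k] [Ring A] [Algebra k A] [Ring B] [Algebra k B]
  [AddCommGroup M] [Module k M] [Module A M] [Module B M]
  [IsScalarTower k A M] [IsScalarTower k B M] [SMulCommClass A B M]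

/-- A `k`-linear map commuting with the actions of `A` and `B` is `A ⊗ B`-linear. -/
def tensorAlgebraHom {M' : Type u} [AddCommGroup M'] [Module k M'] [Module A M'] [Module B M']
    [IsScalarTower k A M'] [IsScalarTower k B M'] [SMulCommClass A B M']
    (f : M →ₗ[k] M') (ha : ∀ (a : A) (x : M), f (a • x) = a • f x)
    (hb : ∀ (b : B) (x : M), f (b • x) = b • f x) :
    letI : Module (A ⊗[k] B) M := TensorProduct.Algebra.module
    letI : Module (A ⊗[k] B) M' := TensorProduct.Algebra.module
    M →ₗ[A ⊗[k] B] M' :=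
  letI : Module (A ⊗[k] B) M := TensorProduct.Algebra.module
  letI : Module (A ⊗[k] B) M' := TensorProduct.Algebra.module
  { toFun := f
    map_add' := map_add f
    map_smul' := fun e x => by
      induction e using TensorProduct.induction_on with
      | zero =>
        exact (congrArg f (zero_smul (A ⊗[k] B) x)).trans
          ((map_zero f).trans (zero_smul (A ⊗[k] B) (f x)).symm)
      | tmul r s => simp [TensorProduct.Algebra.smul_def, ha, hb]
      | add e e' h h' => simp only [add_smul, map_add, h, h', RingHom.id_apply] at * }

variable (k A B M)

theorem projective_left
    (h : letI : Module (A ⊗[k] B) M := TensorProduct.Algebra.module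
      Module.Projective (A ⊗[k] B) M) : Module.Projective A M := by
  let : Module (A ⊗[k] B) M := TensorProduct.Algebra.module
  have : IsScalarTower A (A ⊗[k] B) M := ⟨fun a e m => by
    induction e using TensorProduct.induction_on with
    | zero =>
      exact (congrArg (· • m) (smul_zero a)).trans
        ((zero_smul (A ⊗[k] B) m).trans ((congrArg (a • ·) (zero_smul (A ⊗[k] B) m)).trans
          (smul_zero a)).symm)
    | tmul r s =>
      simp [TensorProduct.smul_tmul', TensorProduct.Algebra.smul_def, mul_smul]
    | add e e' h h' => simp only [add_smul, smul_add, h, h']⟩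
  exact projective_trans A (A ⊗[k] B) M

theorem projective_right
    (h : letI : Module (A ⊗[k] B) M := TensorProduct.Algebra.module
      Module.Projective (A ⊗[k] B) M) : Module.Projective B M := by
  let : Module (A ⊗[k] B) M := TensorProduct.Algebra.module
  have : SMulCommClass B A M := SMulCommClass.symm _ _ _
  refine projective_left k B A M ?_
  let : Module (B ⊗[k] A) M := TensorProduct.Algebra.module
  let e := (Algebra.TensorProduct.comm k A B).toRingEquiv
  let := RingHomInvPair.of_ringEquiv e
  let := RingHomInvPair.of_ringEquiv e.symm
  refine Module.Projective.of_equiv (R := A ⊗[k] B) (S := B ⊗[k] A) (M := M) (N := M)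
    (σ := (e : A ⊗[k] B →+* B ⊗[k] A)) (σ' := (e.symm : B ⊗[k] A →+* A ⊗[k] B))
    { AddEquiv.refl M with
      map_smul' := fun x m => ?_ }
  change x • m = e x • m
  induction x using TensorProduct.induction_on with
  | zero =>
    rw [map_zero]
    exact (zero_smul (A ⊗[k] B) m).trans (zero_smul (B ⊗[k] A) m).symm
  | tmul r s =>
    change _ = (s ⊗ₜ[k] r : B ⊗[k] A) • m
    rw [TensorProduct.Algebra.smul_def, TensorProduct.Algebra.smul_def, smul_comm]
  | add e e' h h' => rw [map_add, add_smul, add_smul, h, h']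

end ProjectiveModules

section Corner

variable {E E' : Type u} [Ring E] [Ring E'] (j : E' →ₙ+* E)

/-- The corner `ε Y` of an `E`-module `Y`, where `ε` is the idempotent `j 1`. -/
def Corner (Y : Type u) [AddCommGroup Y] [Module E Y] : Type u :=
  LinearMap.ker (Module.toAddMonoidEnd E Y (1 - j 1)).toIntLinearMap

variable (Y : Type u) [AddCommGroup Y] [Module E Y]

instance : AddCommGroup (Corner j Y) :=
  inferInstanceAs (AddCommGroup (LinearMap.ker _))

variable {j Y}

theorem mem_corner_iff {y : Y} :
    y ∈ LinearMap.ker (Module.toAddMonoidEnd E Y (1 - j 1)).toIntLinearMap ↔ j 1 • y = y := by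
  rw [LinearMap.mem_ker]
  change (1 - j 1) • y = 0 ↔ _
  rw [sub_smul, one_smul, sub_eq_zero, eq_comm]

/-- The element of the corner given by an element fixed by the idempotent. -/
def Corner.mk (y : Y) (h : j 1 • y = y) : Corner j Y := ⟨y, mem_corner_iff.2 h⟩

/-- The underlying element. -/
def Corner.val : Corner j Y →+ Y := (Submodule.subtype _).toAddMonoidHom

theorem Corner.val_mk (y : Y) (h : j 1 • y = y) : (Corner.mk y h).val = y := rfl

@[ext]
theorem Corner.ext {y z : Corner j Y} (h : y.val = z.val) : y = z := Subtype.ext h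

theorem Corner.one_smul_val (y : Corner j Y) : j 1 • y.val = y.val := mem_corner_iff.1 y.2

instance : Module E' (Corner j Y) where
  smul e y := Corner.mk (j e • y.val) (by rw [← mul_smul, ← map_mul, one_mul])
  one_smul y := Corner.ext y.one_smul_val
  mul_smul e e' y := Corner.ext <| by
    change j (e * e') • y.val = j e • j e' • y.val
    rw [map_mul, mul_smul]
  smul_zero e := Corner.ext <| by
    change j e • Corner.val (0 : Corner j Y) = Corner.val (0 : Corner j Y)
    rw [map_zero, smul_zero]
  zero_smul y := Corner.ext <| by
    change j 0 • y.val = Corner.val (0 : Corner j Y)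
    rw [map_zero, map_zero, zero_smul]
  smul_add e y z := Corner.ext <| by
    change j e • (y + z).val = (Corner.mk (j e • y.val) _ + Corner.mk (j e • z.val) _ :
      Corner j Y).val
    rw [map_add, map_add, smul_add]
    rfl
  add_smul e e' y := Corner.ext <| by
    change j (e + e') • y.val = (Corner.mk (j e • y.val) _ + Corner.mk (j e' • y.val) _ :
      Corner j Y).val
    rw [map_add, map_add, add_smul]
    rfl

theorem Corner.val_smul (e : E') (y : Corner j Y) : (e • y).val = j e • y.val := rfl

variable (j) in
/-- The projection `y ↦ ε y` to the corner. -/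
def Corner.proj : Y →+ Corner j Y where
  toFun y := Corner.mk (j 1 • y) (by rw [← mul_smul, ← map_mul, one_mul])
  map_zero' := Corner.ext (smul_zero _)
  map_add' _ _ := Corner.ext (smul_add _ _ _)

theorem Corner.val_proj (y : Y) : (Corner.proj j y).val = j 1 • y := rfl

variable {Y' : Type u} [AddCommGroup Y'] [Module E Y']

variable (j) in
/-- The map of corners induced by a linear map. -/
def Corner.map (f : Y →ₗ[E] Y') : Corner j Y →ₗ[E'] Corner j Y' where
  toFun y := Corner.mk (f y.val) (by rw [← map_smul, y.one_smul_val])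
  map_add' y z := Corner.ext <| by
    change f (y + z).val = _
    rw [map_add, map_add]
    rfl
  map_smul' e y := Corner.ext (map_smul f _ _)

/-- The map `a ↦ a q` from the corner of `E` to the corner of `Y`. -/
def Corner.toSMul (q : Y) : Corner j E →ₗ[E'] Corner j Y where
  toFun a := Corner.mk (a.val • q) (by rw [← smul_assoc, a.one_smul_val])
  map_add' a b := Corner.ext <| by
    change (a + b).val • q = a.val • q + b.val • q
    rw [map_add, add_smul]
  map_smul' e a := Corner.ext (mul_smul (j e) a.val q)

theorem Corner.projective [Module.Projective E' (Corner j E)] [h : Module.Projective E Y] :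
    Module.Projective E' (Corner j Y) := by
  obtain ⟨s, hs⟩ := h.out
  have := projective_finsupp E' Y (Corner j E)
  have hε : ∀ (e : E') (a : E), Corner.proj j (j e * a) = e • Corner.proj j a := fun e a =>
    Corner.ext <| by
      change j 1 * (j e * a) = j e * (j 1 * a)
      rw [← mul_assoc, ← mul_assoc, ← map_mul, ← map_mul, one_mul, mul_one]
  refine Module.Projective.of_split (M := Y →₀ Corner j E)
    { toFun := fun y => (s y.val).mapRange (Corner.proj j) (map_zero _)
      map_add' := fun y z => by
        ext q : 1
        simp
      map_smul' := fun e y => by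
        ext q : 1
        simp [Corner.val_smul, hε] }
    (Finsupp.lsum ℕ Corner.toSMul) ?_
  ext y
  have h1 : ∀ v : Y →₀ E, Corner.val (Finsupp.lsum ℕ (Corner.toSMul (j := j))
      (v.mapRange (Corner.proj j) (map_zero _)))
      = j 1 • Finsupp.linearCombination E id v := fun v => by
    induction v using Finsupp.induction_linear with
    | zero => simp
    | add v w hv hw =>
      rw [Finsupp.mapRange_add (fun a b => map_add _ a b), map_add, map_add, map_add, smul_add,
        hv, hw]
    | single q a =>
      rw [Finsupp.mapRange_single, Finsupp.lsum_single, Finsupp.linearCombination_single]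
      exact mul_smul (j 1) a q
  refine (h1 (s y.val)).trans ?_
  rw [hs, y.one_smul_val]
  rfl

variable (j) in
/-- The functor taking a module to its corner. -/
def cornerFunctor : ModuleCat.{u} E ⥤ ModuleCat.{u} E' where
  obj Y := ModuleCat.of E' (Corner j Y)
  map f := ModuleCat.ofHom (Corner.map j f.hom)

instance : (cornerFunctor j).Additive where

instance : (cornerFunctor j).PreservesHomology := by
  refine ((Functor.exact_tfae (cornerFunctor j)).out 0 2).1 fun S hS => ?_
  have hi := hS.moduleCat_injective_f
  refine ModuleCat.shortComplex_shortExact _ ?_ ?_ ?_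
  · intro (y : Corner j S.X₂)
    constructor
    · intro hy
      have hy' : S.g y.val = 0 := congrArg Corner.val hy
      obtain ⟨x, hx⟩ := (shortExact_functionExact hS y.val).1 hy'
      refine ⟨Corner.mk (j := j) x (hi ?_), Corner.ext hx⟩
      rw [map_smul, hx, y.one_smul_val]
    · rintro ⟨x, rfl⟩
      exact Corner.ext ((shortExact_functionExact hS _).2 ⟨_, rfl⟩)
  · intro (x : Corner j S.X₁) (y : Corner j S.X₁) h
    exact Corner.ext (hi (congrArg Corner.val h))
  · intro (z : Corner j S.X₃)
    obtain ⟨y, hy⟩ := hS.moduleCat_surjective_g z.val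
    refine ⟨Corner.proj j y, Corner.ext ?_⟩
    change S.g (j 1 • y) = z.val
    rw [map_smul, hy, z.one_smul_val]

theorem cornerFunctor_preservesProjective (h : Module.Projective E' (Corner j E)) :
    (cornerFunctor j).PreservesProjectiveObjects where
  projective_obj {Y} hY := by
    have : Module.Projective E Y := inferInstance
    have : Module.Projective E' (Corner j Y) := Corner.projective
    exact (IsProjective.iff_projective _).1 this

end Corner

section Enveloping

variable {k A L : Type u} [Field k] [Ring A] [Algebra k A] [Ring L] [Algebra k L]

/-- The map of enveloping algebras induced by a multiplicative linear map that need not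
preserve the unit. -/
def envMap (i : A →ₙₐ[k] L) : (A ⊗[k] Aᵐᵒᵖ) →ₙ+* (L ⊗[k] Lᵐᵒᵖ) :=
  let f := TensorProduct.map (i : A →ₗ[k] L)
    ((opLinearEquiv k).toLinearMap ∘ₗ (i : A →ₗ[k] L) ∘ₗ (opLinearEquiv k).symm.toLinearMap)
  { toFun := f
    map_zero' := map_zero f
    map_add' := map_add f
    map_mul' := fun x y => by
      induction x using TensorProduct.induction_on with
      | zero => simp
      | add a b ha hb => simp only [add_mul, map_add, ha, hb]
      | tmul r s =>
        induction y using TensorProduct.induction_on with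
        | zero => simp
        | add a b ha hb => simp only [mul_add, map_add, ha, hb]
        | tmul r' s' => simp [f, Algebra.TensorProduct.tmul_mul_tmul] }

theorem envMap_tmul (i : A →ₙₐ[k] L) (a : A) (b : Aᵐᵒᵖ) :
    envMap i (a ⊗ₜ b) = i a ⊗ₜ op (i b.unop) := rfl

theorem envMap_one (i : A →ₙₐ[k] L) : envMap i 1 = i 1 ⊗ₜ op (i 1) := rfl

/-- The corner of the enveloping algebra of `L` is projective over the enveloping algebra of `A`
if `L i(1)` and `i(1) L` are projective `A`-modules. -/
theorem projective_corner_env (i : A →ₙₐ[k] L) (X X' : Type u)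
    [AddCommGroup X] [Module k X] [Module A X] [IsScalarTower k A X] [hX : Module.Projective A X]
    [AddCommGroup X'] [Module k X'] [Module Aᵐᵒᵖ X'] [IsScalarTower k Aᵐᵒᵖ X']
    [hX' : Module.Projective Aᵐᵒᵖ X']
    (p : L →ₗ[k] X) (q : X →ₗ[k] L) (hp : ∀ a l, p (i a * l) = a • p l)
    (hq : ∀ a x, q (a • x) = i a * q x) (hqp : ∀ l, q (p l) = i 1 * l)
    (p' : L →ₗ[k] X') (q' : X' →ₗ[k] L) (hp' : ∀ a l, p' (l * i a) = op a • p' l)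
    (hq' : ∀ (a : Aᵐᵒᵖ) x, q' (a • x) = q' x * i a.unop) (hqp' : ∀ l, q' (p' l) = l * i 1) :
    Module.Projective (A ⊗[k] Aᵐᵒᵖ) (Corner (envMap i) (L ⊗[k] Lᵐᵒᵖ)) := by
  obtain ⟨s, hs⟩ := hX.out
  obtain ⟨s', hs'⟩ := hX'.out
  let T : L ⊗[k] Lᵐᵒᵖ →ₗ[k] (X × X' →₀ A ⊗[k] Aᵐᵒᵖ) :=
    (finsuppTensorFinsupp k k A Aᵐᵒᵖ X X').toLinearMap ∘ₗ
      TensorProduct.map (s.restrictScalars k ∘ₗ p)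
        (s'.restrictScalars k ∘ₗ p' ∘ₗ (opLinearEquiv k).symm.toLinearMap)
  have hT : ∀ l m, T (l ⊗ₜ m) = finsuppTensorFinsupp k k A Aᵐᵒᵖ X X'
      (s (p l) ⊗ₜ s' (p' m.unop)) := fun l m => rfl
  have hF : ∀ (a : A) (b : Aᵐᵒᵖ) (u : X →₀ A) (v : X' →₀ Aᵐᵒᵖ),
      finsuppTensorFinsupp k k A Aᵐᵒᵖ X X' ((a • u) ⊗ₜ (b • v)) =
        (a ⊗ₜ[k] b) • finsuppTensorFinsupp k k A Aᵐᵒᵖ X X' (u ⊗ₜ v) := fun a b u v => by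
    ext ⟨x, x'⟩
    simp [finsuppTensorFinsupp_apply, Algebra.TensorProduct.tmul_mul_tmul]
  have hTs : ∀ e z, T (envMap i e * z) = e • T z := fun e z => by
    induction e using TensorProduct.induction_on with
    | zero =>
      rw [map_zero, zero_mul, map_zero]
      exact (zero_smul (A ⊗[k] Aᵐᵒᵖ) (T z)).symm
    | add a b ha hb => rw [map_add, add_mul, map_add, ha, hb, add_smul]
    | tmul a b =>
      induction z using TensorProduct.induction_on with
      | zero => simp
      | add x y hx hy => rw [mul_add, map_add, hx, hy, map_add, smul_add]
      | tmul l m =>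
        rw [envMap_tmul, Algebra.TensorProduct.tmul_mul_tmul, hT, hT, hp, unop_mul, unop_op, hp',
          map_smul, map_smul, hF, op_unop]
  have hmem : ∀ x : X × X', envMap i 1 • (q x.1 ⊗ₜ[k] op (q' x.2)) = q x.1 ⊗ₜ[k] op (q' x.2) :=
    fun x => by
      rw [envMap_one, smul_eq_mul, Algebra.TensorProduct.tmul_mul_tmul, ← op_mul, ← hq,
        one_smul]
      have := hq' 1 x.2
      rw [one_smul, unop_one] at this
      rw [← this]
  have hback : ∀ (u : X →₀ A) (v : X' →₀ Aᵐᵒᵖ),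
      Corner.val (Finsupp.linearCombination (A ⊗[k] Aᵐᵒᵖ)
        (fun x : X × X' => Corner.mk (j := envMap i) _ (hmem x))
        (finsuppTensorFinsupp k k A Aᵐᵒᵖ X X' (u ⊗ₜ v))) =
        q (Finsupp.linearCombination A id u) ⊗ₜ
          op (q' (Finsupp.linearCombination Aᵐᵒᵖ id v)) := fun u v => by
    induction u using Finsupp.induction_linear with
    | zero => simp
    | add u w hu hw =>
      simp only [TensorProduct.add_tmul, map_add] at *
      rw [hu, hw]
    | single x a =>
      induction v using Finsupp.induction_linear with
      | zero => simp
      | add v w hv hw =>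
        simp only [TensorProduct.tmul_add, map_add, MulOpposite.op_add] at *
        rw [hv, hw]
      | single x' b =>
        rw [finsuppTensorFinsupp_single, Finsupp.linearCombination_single,
          Finsupp.linearCombination_single, Finsupp.linearCombination_single, id, id, hq, hq',
          Corner.val_smul, Corner.val_mk, envMap_tmul, smul_eq_mul,
          Algebra.TensorProduct.tmul_mul_tmul, op_mul]
  refine Module.Projective.of_split (M := X × X' →₀ A ⊗[k] Aᵐᵒᵖ)
    { toFun := fun z => T z.val
      map_add' := fun z w => by rw [map_add, map_add]
      map_smul' := fun e z => hTs e z.val }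
    (Finsupp.linearCombination (A ⊗[k] Aᵐᵒᵖ) fun x => Corner.mk _ (hmem x)) ?_
  ext z
  change Corner.val (Finsupp.linearCombination (A ⊗[k] Aᵐᵒᵖ)
        (fun x : X × X' => Corner.mk (j := envMap i) _ (hmem x)) (T z.val)) = z.val
  conv_rhs => rw [← z.one_smul_val]
  generalize z.val = w
  induction w using TensorProduct.induction_on with
  | zero => simp
  | add x y hx hy => rw [map_add, map_add, map_add, hx, hy, smul_add]
  | tmul l m =>
    rw [hT, hback, hs, hs', hqp, hqp', envMap_one, smul_eq_mul,
      Algebra.TensorProduct.tmul_mul_tmul, op_mul, op_unop]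

end Enveloping

section BimodCat

variable {k R : Type u} [Field k] [Ring R] [Algebra k R]

variable (k R) in
/-- The identity map from a bimodule to the corresponding object of `BimodCat`. -/
def bimodAdd (X : Type u) [AddCommGroup X] [Module k X] [Module R X] [Module Rᵐᵒᵖ X]
    [IsScalarTower k R X] [IsScalarTower k Rᵐᵒᵖ X] [SMulCommClass R Rᵐᵒᵖ X] :
    X ≃+ bimod k R X := AddEquiv.refl X

variable {X : Type u} [AddCommGroup X] [Module k X] [Module R X] [Module Rᵐᵒᵖ X]
  [IsScalarTower k R X] [IsScalarTower k Rᵐᵒᵖ X] [SMulCommClass R Rᵐᵒᵖ X]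

theorem bimodAdd_smul (r : R) (s : Rᵐᵒᵖ) (x : X) :
    (r ⊗ₜ[k] s : R ⊗[k] Rᵐᵒᵖ) • bimodAdd k R X x = bimodAdd k R X (r • s • x) :=
  TensorProduct.Algebra.smul_def r s x

variable (k R X) in
/-- The identity map from a bimodule to the corresponding object of `BimodCat`, as a linear
equivalence. -/
def bimodIn : X ≃ₗ[k] bimod k R X where
  __ := bimodAdd k R X
  map_smul' c x := by
    change bimodAdd k R X (c • x) = c • bimodAdd k R X x
    rw [← algebraMap_smul (R ⊗[k] Rᵐᵒᵖ) c (bimodAdd k R X x),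
      Algebra.TensorProduct.algebraMap_apply, bimodAdd_smul, one_smul, algebraMap_smul]

theorem bimodIn_smul (r : R) (s : Rᵐᵒᵖ) (x : X) :
    (r ⊗ₜ[k] s : R ⊗[k] Rᵐᵒᵖ) • bimodIn k R X x = bimodIn k R X (r • s • x) :=
  bimodAdd_smul r s x

end BimodCat

section RelativeTensorTor

variable {k A B M N : Type u} [Field k] [Ring A] [Algebra k A] [Ring B] [Algebra k B]
  [AddCommGroup M] [Module k M] [Module B M] [Module Aᵐᵒᵖ M]
  [IsScalarTower k B M] [IsScalarTower k Aᵐᵒᵖ M] [SMulCommClass B Aᵐᵒᵖ M]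
  [AddCommGroup N] [Module k N] [Module A N] [Module Bᵐᵒᵖ N]
  [IsScalarTower k A N] [IsScalarTower k Bᵐᵒᵖ N] [SMulCommClass A Bᵐᵒᵖ N]

local notation "Λ" => NullSquare A B M N

/-- The element `1 ⊗ 1` of `Λ ⊗_C Λ`. -/
def relOne : relTensor k A B M N := bimodIn k Λ _ (BalTensor.mk k (A × B) Λ Λ (1 ⊗ₜ 1))

theorem relTensor_smul (r : Λ) (s : Λᵐᵒᵖ) (x y : Λ) :
    (r ⊗ₜ[k] s : Λ ⊗[k] Λᵐᵒᵖ) • (bimodIn k Λ _ (BalTensor.mk k (A × B) Λ Λ (x ⊗ₜ y)))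
      = bimodIn k Λ _ (BalTensor.mk k (A × B) Λ Λ ((r * x) ⊗ₜ (y * s.unop))) :=
  bimodIn_smul r s _

theorem relOne_diag (c : A × B) :
    ((NullSquare.diag c ⊗ₜ[k] 1 : Λ ⊗[k] Λᵐᵒᵖ) • (relOne : relTensor k A B M N))
      = (1 ⊗ₜ[k] op (NullSquare.diag c) : Λ ⊗[k] Λᵐᵒᵖ) • relOne := by
  rw [relOne, relTensor_smul, relTensor_smul, unop_one, unop_op, one_mul, one_mul, mul_one]
  have := BalTensor.mk_smul (k := k) (1 : Λ) c (1 : Λ)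
  rw [NullSquare.op_diag_smul, NullSquare.diag_smul] at this
  simpa using this

theorem bimk_relOne_diag (Y : BimodCat k Λ) (c : A × B) (y : Y) :
    bimk (relOne : relTensor k A B M N) ((NullSquare.diag c ⊗ₜ[k] 1 : Λ ⊗[k] Λᵐᵒᵖ) • y)
      = bimk relOne ((1 ⊗ₜ[k] op (NullSquare.diag c) : Λ ⊗[k] Λᵐᵒᵖ) • y) := by
  have h1 := bimk_balanced (NullSquare.diag c) 1 (relOne : relTensor k A B M N) y
  have h2 := bimk_balanced 1 (NullSquare.diag c) (relOne : relTensor k A B M N) y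
  rw [op_one] at h1 h2
  rw [← h1, ← h2, relOne_diag]

variable (k A B M N) in
/-- A direct factor `D` of the diagonal subalgebra `A × B`. -/
structure DiagFactor (D : Type u) [Ring D] [Algebra k D] where
  /-- The inclusion into the null-square algebra. -/
  incl : D →ₙₐ[k] NullSquare A B M N
  /-- The inclusion into the diagonal subalgebra. -/
  lift : D → A × B
  /-- The projection from the diagonal subalgebra. -/
  ret : A × B → D
  incl_eq : ∀ d, incl d = NullSquare.diag (lift d)
  diag_mul : ∀ c, NullSquare.diag c * incl 1 = incl (ret c)
  mul_diag : ∀ c, incl 1 * NullSquare.diag c = incl (ret c)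

variable (k A B M N) in
/-- The factor `A` of the diagonal subalgebra. -/
def diagFactorA : DiagFactor k A B M N A where
  incl :=
    { toFun := fun a => ⟨a, 0, 0, 0⟩
      map_smul' := fun c a => by ext <;> simp
      map_zero' := rfl
      map_add' := fun a b => by ext <;> simp
      map_mul' := fun a b => by ext <;> simp }
  lift a := (a, 0)
  ret c := c.1
  incl_eq _ := rfl
  diag_mul c := by ext <;> simp [NullSquare.diag]
  mul_diag c := by ext <;> simp [NullSquare.diag]

variable (k A B M N) in
/-- The factor `B` of the diagonal subalgebra. -/
def diagFactorB : DiagFactor k A B M N B where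
  incl :=
    { toFun := fun b => ⟨0, 0, 0, b⟩
      map_smul' := fun c a => by ext <;> simp
      map_zero' := rfl
      map_add' := fun a b => by ext <;> simp
      map_mul' := fun a b => by ext <;> simp }
  lift b := (0, b)
  ret c := c.2
  incl_eq _ := rfl
  diag_mul c := by ext <;> simp [NullSquare.diag]
  mul_diag c := by ext <;> simp [NullSquare.diag]

namespace DiagFactor

variable {D : Type u} [Ring D] [Algebra k D] (φ : DiagFactor k A B M N D)

/-- The functor `Y ↦ e Y e` from `Λ`-bimodules to `D`-bimodules, where `e` is the unit of `D`. -/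
abbrev corner : BimodCat k Λ ⥤ BimodCat k D := cornerFunctor (envMap φ.incl)

/-- The projection `Y → e Y e` as a `k`-linear map. -/
def proj (Y : BimodCat k Λ) : Y →ₗ[k] φ.corner.obj Y where
  toFun y := Corner.proj (envMap φ.incl) y
  map_add' _ _ := map_add _ _ _
  map_smul' c y := Corner.ext <| by
    have h (z : φ.corner.obj Y) : c • z = (algebraMap k (D ⊗[k] Dᵐᵒᵖ) c) • z :=
      (algebraMap_smul _ c z).symm
    rw [RingHom.id_apply]
    refine Eq.trans ?_ (congrArg Corner.val (h _)).symm
    rw [Algebra.TensorProduct.algebraMap_apply, Algebra.algebraMap_eq_smul_one]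
    refine Eq.trans ?_ (Corner.val_smul (j := envMap φ.incl) _ _).symm
    rw [Corner.val_proj, Corner.val_proj, envMap_tmul, envMap_one, unop_one, map_smul,
      ← TensorProduct.smul_tmul', smul_assoc, ← mul_smul, Algebra.TensorProduct.tmul_mul_tmul,
      ← op_mul, ← map_mul, one_mul, smul_comm]

/-- The inclusion `e Y e → Y` as a `k`-linear map. -/
def val (Y : BimodCat k Λ) : φ.corner.obj Y →ₗ[k] Y where
  toFun y := Corner.val (j := envMap φ.incl) y
  map_add' _ _ := map_add _ _ _
  map_smul' c y := by
    have h : c • y = (algebraMap k (D ⊗[k] Dᵐᵒᵖ) c) • y := (algebraMap_smul _ c _).symm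
    rw [RingHom.id_apply, h, Algebra.TensorProduct.algebraMap_apply,
      Algebra.algebraMap_eq_smul_one]
    refine (Corner.val_smul (j := envMap φ.incl) _ _).trans ?_
    rw [envMap_tmul, map_smul, ← TensorProduct.smul_tmul', smul_assoc]
    exact congrArg (c • ·) (Corner.one_smul_val (j := envMap φ.incl) y)

theorem val_smul (Y : BimodCat k Λ) (e : D ⊗[k] Dᵐᵒᵖ) (y : φ.corner.obj Y) :
    φ.val Y (e • y) = envMap φ.incl e • φ.val Y y := rfl

theorem val_proj (Y : BimodCat k Λ) (y : Y) : φ.val Y (φ.proj Y y) = envMap φ.incl 1 • y := rfl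

theorem val_injective (Y : BimodCat k Λ) : Function.Injective (φ.val Y) :=
  fun _ _ h => Corner.ext h

theorem one_smul_val (Y : BimodCat k Λ) (y : φ.corner.obj Y) :
    envMap φ.incl 1 • φ.val Y y = φ.val Y y := Corner.one_smul_val (j := envMap φ.incl) y

theorem val_map {Y Y' : BimodCat k Λ} (f : Y ⟶ Y') (y : φ.corner.obj Y) :
    φ.val Y' (φ.corner.map f y) = f (φ.val Y y) := rfl

theorem proj_map {Y Y' : BimodCat k Λ} (f : Y ⟶ Y') (y : Y) :
    φ.proj Y' (f y) = φ.corner.map f (φ.proj Y y) := by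
  apply φ.val_injective
  rw [val_proj, val_map, val_proj, map_smul]

theorem proj_diag_left (Y : BimodCat k Λ) (c : A × B) (y : Y) :
    φ.proj Y ((NullSquare.diag c ⊗ₜ[k] 1 : Λ ⊗[k] Λᵐᵒᵖ) • y)
      = (φ.ret c ⊗ₜ[k] 1 : D ⊗[k] Dᵐᵒᵖ) • φ.proj Y y := by
  apply φ.val_injective
  rw [val_proj, val_smul, val_proj, envMap_one, envMap_tmul, ← mul_smul, ← mul_smul,
    Algebra.TensorProduct.tmul_mul_tmul, Algebra.TensorProduct.tmul_mul_tmul, φ.mul_diag,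
    unop_one, ← op_mul, ← map_mul, ← map_mul, mul_one, mul_one, mul_one]

theorem proj_diag_right (Y : BimodCat k Λ) (c : A × B) (y : Y) :
    φ.proj Y ((1 ⊗ₜ[k] op (NullSquare.diag c) : Λ ⊗[k] Λᵐᵒᵖ) • y)
      = (1 ⊗ₜ[k] op (φ.ret c) : D ⊗[k] Dᵐᵒᵖ) • φ.proj Y y := by
  apply φ.val_injective
  rw [val_proj, val_smul, val_proj, envMap_one, envMap_tmul, ← mul_smul, ← mul_smul,
    Algebra.TensorProduct.tmul_mul_tmul, Algebra.TensorProduct.tmul_mul_tmul, ← op_mul, ← op_mul,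
    φ.diag_mul, unop_op, ← map_mul, ← map_mul, mul_one, mul_one, one_mul]

/-- The element `1 ⊗ y` of `D ⊗_{D-D} Z`. -/
def oneTensor (Z : BimodCat k D) : Z →ₗ[k] BimodTensor (bimod k D D) Z :=
  bimkLin (bimod k D D) Z (bimodIn k D D 1)

theorem oneTensor_comm (Z : BimodCat k D) (d : D) (z : Z) :
    oneTensor Z ((d ⊗ₜ[k] 1 : D ⊗[k] Dᵐᵒᵖ) • z)
      = oneTensor Z ((1 ⊗ₜ[k] op d : D ⊗[k] Dᵐᵒᵖ) • z) := by
  have h1 := bimk_balanced d 1 (bimodIn k D D 1) z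
  have h2 := bimk_balanced 1 d (bimodIn k D D 1) z
  rw [op_one] at h1 h2
  change bimk _ _ = bimk _ _
  rw [← h1, ← h2, bimodIn_smul, bimodIn_smul]
  simp

theorem bimk_eq_oneTensor (Z : BimodCat k D) (d : D) (z : Z) :
    bimk (bimodIn k D D d) z = oneTensor Z ((d ⊗ₜ[k] 1 : D ⊗[k] Dᵐᵒᵖ) • z) := by
  have h1 := bimk_balanced d 1 (bimodIn k D D 1) z
  rw [op_one] at h1
  change _ = bimk _ _
  rw [← h1, bimodIn_smul]
  simp

/-- The map `e ↦ (y ↦ 1 ⊗ e y)`. -/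
def actProj (Y : BimodCat k Λ) :
    Λ ⊗[k] Λᵐᵒᵖ →ₗ[k] Y →ₗ[k] BimodTensor (bimod k D D) (φ.corner.obj Y) :=
  LinearMap.mk₂ k (fun e y => oneTensor _ (φ.proj Y (e • y)))
    (fun e e' y => by rw [add_smul, map_add, map_add])
    (fun c e y => by rw [smul_assoc, map_smul, map_smul])
    (fun e y y' => by rw [smul_add, map_add, map_add])
    (fun c e y => by rw [smul_comm, map_smul, map_smul])

theorem actProj_apply (Y : BimodCat k Λ) (e : Λ ⊗[k] Λᵐᵒᵖ) (y : Y) :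
    φ.actProj Y e y = oneTensor _ (φ.proj Y (e • y)) := rfl

variable (k A B M N) in
/-- The map `x ⊗ y ↦ y ⊗ x` from `Λ ⊗ Λ` to the enveloping algebra. -/
def relFlip : Λ ⊗[k] Λ →ₗ[k] Λ ⊗[k] Λᵐᵒᵖ :=
  (TensorProduct.comm k Λᵐᵒᵖ Λ).toLinearMap ∘ₗ
    TensorProduct.map (opLinearEquiv k).toLinearMap LinearMap.id

theorem relFlip_tmul (x y : Λ) : relFlip k A B M N (x ⊗ₜ y) = y ⊗ₜ op x := rfl

theorem oneTensor_proj_diag (Y : BimodCat k Λ) (c : A × B) (y : Y) :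
    oneTensor _ (φ.proj Y ((NullSquare.diag c ⊗ₜ[k] 1 : Λ ⊗[k] Λᵐᵒᵖ) • y))
      = oneTensor _ (φ.proj Y ((1 ⊗ₜ[k] op (NullSquare.diag c) : Λ ⊗[k] Λᵐᵒᵖ) • y)) := by
  rw [proj_diag_left, proj_diag_right, oneTensor_comm]

theorem actProj_relFlip_balanced (Y : BimodCat k Λ) (x : Λ) (c : A × B) (y : Λ) :
    φ.actProj Y (relFlip k A B M N ((op c • x) ⊗ₜ y))
      = φ.actProj Y (relFlip k A B M N (x ⊗ₜ (c • y))) := by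
  refine LinearMap.ext fun v => ?_
  have h1 : (y ⊗ₜ[k] op (x * NullSquare.diag c) : Λ ⊗[k] Λᵐᵒᵖ)
      = (1 ⊗ₜ op (NullSquare.diag c)) * (y ⊗ₜ op x) := by
    rw [Algebra.TensorProduct.tmul_mul_tmul, one_mul, op_mul]
  have h2 : ((NullSquare.diag c * y) ⊗ₜ[k] op x : Λ ⊗[k] Λᵐᵒᵖ)
      = (NullSquare.diag c ⊗ₜ 1) * (y ⊗ₜ op x) := by
    rw [Algebra.TensorProduct.tmul_mul_tmul, one_mul]
  rw [relFlip_tmul, relFlip_tmul, actProj_apply, actProj_apply, NullSquare.op_diag_smul,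
    NullSquare.diag_smul, unop_op, h1, h2, mul_smul, mul_smul, oneTensor_proj_diag]

/-- The map `x ⊗ y ↦ (v ↦ 1 ⊗ e y v x e)` on `Λ ⊗_C Λ`. -/
def relActProj (Y : BimodCat k Λ) : BalTensor k (A × B) Λ Λ →ₗ[k]
    Y →ₗ[k] BimodTensor (bimod k D D) (φ.corner.obj Y) :=
  BalTensor.lift (φ.actProj Y ∘ₗ relFlip k A B M N) fun x c y =>
    φ.actProj_relFlip_balanced Y x c y

theorem relActProj_mk (Y : BimodCat k Λ) (x y : Λ) (v : Y) :
    φ.relActProj Y (BalTensor.mk k (A × B) Λ Λ (x ⊗ₜ y)) v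
      = oneTensor _ (φ.proj Y ((y ⊗ₜ[k] op x : Λ ⊗[k] Λᵐᵒᵖ) • v)) := rfl

theorem relActProj_balanced (Y : BimodCat k Λ) (r s : Λ) (t : BalTensor k (A × B) Λ Λ) (v : Y) :
    φ.relActProj Y (s • op r • t) v = φ.relActProj Y t ((r ⊗ₜ[k] op s : Λ ⊗[k] Λᵐᵒᵖ) • v) := by
  refine LinearMap.congr_fun
    (f := (φ.relActProj Y).flip v ∘ₗ BalTensor.leftMul k (A × B) Λ Λ Λ s ∘ₗ
      BalTensor.rightMul k (A × B) Λ Λ Λ (op r))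
    (g := (φ.relActProj Y).flip ((r ⊗ₜ[k] op s : Λ ⊗[k] Λᵐᵒᵖ) • v))
    (BalTensor.hom_ext fun x y => ?_) t
  rw [LinearMap.comp_apply, LinearMap.comp_apply, BalTensor.rightMul_mk, BalTensor.leftMul_mk,
    LinearMap.flip_apply, LinearMap.flip_apply, relActProj_mk, relActProj_mk, ← mul_smul,
    Algebra.TensorProduct.tmul_mul_tmul, ← op_mul]
  rfl

theorem relTensor_hom_ext {V : Type u} [AddCommGroup V] [Module k V]
    {f g : relTensor k A B M N →ₗ[k] V}
    (h : ∀ x y, f (bimodIn k Λ _ (BalTensor.mk k (A × B) Λ Λ (x ⊗ₜ y)))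
      = g (bimodIn k Λ _ (BalTensor.mk k (A × B) Λ Λ (x ⊗ₜ y)))) : f = g := by
  have := BalTensor.hom_ext (f := f ∘ₗ (bimodIn k Λ _).toLinearMap)
    (g := g ∘ₗ (bimodIn k Λ _).toLinearMap) h
  ext x
  exact LinearMap.congr_fun this x

theorem relTensor_tensor_ext {V : Type u} [AddCommGroup V] [Module k V] {Y : BimodCat k Λ}
    {f g : BimodTensor (relTensor k A B M N) Y →ₗ[k] V}
    (h : ∀ x y v, f (bimk (bimodIn k Λ _ (BalTensor.mk k (A × B) Λ Λ (x ⊗ₜ y))) v)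
      = g (bimk (bimodIn k Λ _ (BalTensor.mk k (A × B) Λ Λ (x ⊗ₜ y))) v)) : f = g :=
  bimodTensor_ext fun t v => LinearMap.congr_fun
    (f := f ∘ₗ (bimkLin (relTensor k A B M N) Y).flip v)
    (g := g ∘ₗ (bimkLin (relTensor k A B M N) Y).flip v)
    (relTensor_hom_ext fun x y => h x y v) t

/-- The map `(x ⊗ y) ⊗ v ↦ 1 ⊗ e y v x e`. -/
def toCorner (Y : BimodCat k Λ) :
    BimodTensor (relTensor k A B M N) Y →ₗ[k] BimodTensor (bimod k D D) (φ.corner.obj Y) :=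
  bimodLift (φ.relActProj Y ∘ₗ (bimodIn k Λ _).symm.toLinearMap) fun r s t v => by
    obtain ⟨t, rfl⟩ := (bimodIn k Λ _).surjective t
    rw [bimodIn_smul, LinearMap.comp_apply, LinearMap.comp_apply, LinearEquiv.coe_coe,
      LinearEquiv.symm_apply_apply, LinearEquiv.symm_apply_apply]
    exact φ.relActProj_balanced Y r s t v

theorem toCorner_bimk (Y : BimodCat k Λ) (x y : Λ) (v : Y) :
    φ.toCorner Y (bimk (bimodIn k Λ _ (BalTensor.mk k (A × B) Λ Λ (x ⊗ₜ y))) v)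
      = oneTensor _ (φ.proj Y ((y ⊗ₜ[k] op x : Λ ⊗[k] Λᵐᵒᵖ) • v)) := rfl

/-- The bilinear map `(d, y) ↦ (1 ⊗ 1) ⊗ d y`. -/
def ofCornerBilin (Y : BimodCat k Λ) :
    D →ₗ[k] φ.corner.obj Y →ₗ[k] BimodTensor (relTensor k A B M N) Y :=
  LinearMap.mk₂ k (fun d y => bimk relOne
      ((φ.incl d ⊗ₜ[k] 1 : Λ ⊗[k] Λᵐᵒᵖ) • φ.val Y y))
    (fun d d' y => by rw [map_add, TensorProduct.add_tmul, add_smul, bimk_add_right])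
    (fun c d y => by rw [map_smul, ← TensorProduct.smul_tmul', smul_assoc, bimk_smul_right])
    (fun d y y' => by rw [map_add, smul_add, bimk_add_right])
    (fun c d y => by rw [map_smul, smul_comm, bimk_smul_right])

theorem ofCornerBilin_apply (Y : BimodCat k Λ) (d : D) (y : φ.corner.obj Y) :
    φ.ofCornerBilin Y d y = bimk relOne
      ((φ.incl d ⊗ₜ[k] 1 : Λ ⊗[k] Λᵐᵒᵖ) • φ.val Y y) := rfl

theorem ofCornerBilin_balanced (Y : BimodCat k Λ) (r s d : D) (y : φ.corner.obj Y) :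
    φ.ofCornerBilin Y (s * (d * r)) y
      = φ.ofCornerBilin Y d ((r ⊗ₜ[k] op s : D ⊗[k] Dᵐᵒᵖ) • y) := by
  have h1 : (φ.incl (s * (d * r))) ⊗ₜ[k] (1 : Λᵐᵒᵖ) =
      (φ.incl s ⊗ₜ[k] (1 : Λᵐᵒᵖ)) * (φ.incl (d * r) ⊗ₜ[k] (1 : Λᵐᵒᵖ)) := by
    rw [Algebra.TensorProduct.tmul_mul_tmul, one_mul, map_mul]
  have h2 : (φ.incl d ⊗ₜ[k] (1 : Λᵐᵒᵖ)) * (φ.incl r ⊗ₜ[k] op (φ.incl s))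
      = (1 ⊗ₜ[k] op (φ.incl s)) * (φ.incl (d * r) ⊗ₜ[k] (1 : Λᵐᵒᵖ)) := by
    rw [Algebra.TensorProduct.tmul_mul_tmul, Algebra.TensorProduct.tmul_mul_tmul, one_mul, one_mul,
      mul_one, map_mul]
  rw [ofCornerBilin_apply, ofCornerBilin_apply, val_smul, envMap_tmul, unop_op, ← mul_smul, h1, h2,
    mul_smul, mul_smul, φ.incl_eq s, bimk_relOne_diag]

/-- The map `d ⊗ y ↦ (1 ⊗ 1) ⊗ d y`. -/
def ofCorner (Y : BimodCat k Λ) :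
    BimodTensor (bimod k D D) (φ.corner.obj Y) →ₗ[k] BimodTensor (relTensor k A B M N) Y :=
  bimodLift (φ.ofCornerBilin Y ∘ₗ (bimodIn k D D).symm.toLinearMap) fun r s d y => by
    obtain ⟨d, rfl⟩ := (bimodIn k D D).surjective d
    rw [bimodIn_smul, LinearMap.comp_apply, LinearMap.comp_apply, LinearEquiv.coe_coe,
      LinearEquiv.symm_apply_apply, LinearEquiv.symm_apply_apply]
    exact φ.ofCornerBilin_balanced Y r s d y

theorem ofCorner_bimk (Y : BimodCat k Λ) (d : D) (y : φ.corner.obj Y) :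
    φ.ofCorner Y (bimk (bimodIn k D D d) y) = bimk relOne
      ((φ.incl d ⊗ₜ[k] 1 : Λ ⊗[k] Λᵐᵒᵖ) • φ.val Y y) := rfl

theorem toCorner_relOne (Y : BimodCat k Λ) (v : Y) :
    φ.toCorner Y (bimk relOne v) = oneTensor _ (φ.proj Y v) := by
  rw [relOne, toCorner_bimk, op_one, ← Algebra.TensorProduct.one_def, one_smul]

theorem toCorner_ofCorner (Y : BimodCat k Λ) : φ.toCorner Y ∘ₗ φ.ofCorner Y = LinearMap.id := by
  refine bimodTensor_ext fun d y => ?_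
  obtain ⟨d, rfl⟩ := (bimodIn k D D).surjective d
  rw [LinearMap.comp_apply, ofCorner_bimk, toCorner_relOne, LinearMap.id_apply,
    bimk_eq_oneTensor]
  congr 1
  apply φ.val_injective
  rw [val_proj, val_smul, envMap_one, envMap_tmul, unop_one, ← mul_smul,
    Algebra.TensorProduct.tmul_mul_tmul, ← map_mul, one_mul, mul_one]

theorem toCorner_ofCorner_of_ne {D' : Type u} [Ring D'] [Algebra k D']
    (ψ : DiagFactor k A B M N D') (h : ∀ d, ψ.incl 1 * φ.incl d = 0) (Y : BimodCat k Λ) :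
    ψ.toCorner Y ∘ₗ φ.ofCorner Y = 0 := by
  refine bimodTensor_ext fun d y => ?_
  obtain ⟨d, rfl⟩ := (bimodIn k D D).surjective d
  rw [LinearMap.comp_apply, ofCorner_bimk, toCorner_relOne, LinearMap.zero_apply]
  have : ψ.proj Y ((φ.incl d ⊗ₜ[k] 1 : Λ ⊗[k] Λᵐᵒᵖ) • φ.val Y y) = 0 := by
    apply ψ.val_injective
    rw [val_proj, envMap_one, ← mul_smul, Algebra.TensorProduct.tmul_mul_tmul, h,
      TensorProduct.zero_tmul, map_zero]
    exact zero_smul (Λ ⊗[k] Λᵐᵒᵖ) (φ.val Y y)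
  rw [this, map_zero]

theorem ofCorner_toCorner (Y : BimodCat k Λ) (x y : Λ) (v : Y) :
    φ.ofCorner Y (φ.toCorner Y
        (bimk (bimodIn k Λ _ (BalTensor.mk k (A × B) Λ Λ (x ⊗ₜ y))) v))
      = bimk relOne ((φ.incl 1 ⊗ₜ[k] 1 : Λ ⊗[k] Λᵐᵒᵖ) • (y ⊗ₜ[k] op x : Λ ⊗[k] Λᵐᵒᵖ) • v) := by
  rw [toCorner_bimk]
  refine (φ.ofCorner_bimk Y 1 _).trans ?_
  rw [val_proj, envMap_one, ← mul_smul (φ.incl 1 ⊗ₜ[k] (1 : Λᵐᵒᵖ)),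
    Algebra.TensorProduct.tmul_mul_tmul, ← map_mul, one_mul, one_mul]
  have : (φ.incl 1 ⊗ₜ[k] op (φ.incl 1)) = (φ.incl 1 ⊗ₜ[k] (1 : Λᵐᵒᵖ)) *
      (1 ⊗ₜ[k] op (φ.incl 1)) := by
    rw [Algebra.TensorProduct.tmul_mul_tmul, mul_one, one_mul]
  have h2 : (1 ⊗ₜ[k] op (φ.incl 1)) * (φ.incl 1 ⊗ₜ[k] (1 : Λᵐᵒᵖ)) =
      (φ.incl 1 ⊗ₜ[k] op (φ.incl 1)) := by
    rw [Algebra.TensorProduct.tmul_mul_tmul, mul_one, one_mul]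
  rw [← h2, mul_smul, φ.incl_eq 1, ← bimk_relOne_diag, ← mul_smul,
    Algebra.TensorProduct.tmul_mul_tmul, ← φ.incl_eq 1, ← map_mul, one_mul, one_mul]

/-- The natural transformation with components `toCorner`. -/
def toCornerNat : (bimodTensor k Λ).obj (relTensor k A B M N) ⟶
    φ.corner ⋙ (bimodTensor k D).obj (bimod k D D) where
  app Y := ModuleCat.ofHom (φ.toCorner Y)
  naturality Y Y' f := ModuleCat.hom_ext <| relTensor_tensor_ext fun x y v => by
    change φ.toCorner Y' (bimk (bimodIn k Λ _ (BalTensor.mk k (A × B) Λ Λ (x ⊗ₜ y))) (f v)) =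
      bimodTensorMap (𝟙 (bimod k D D)) (φ.corner.map f)
        (φ.toCorner Y (bimk (bimodIn k Λ _ (BalTensor.mk k (A × B) Λ Λ (x ⊗ₜ y))) v))
    rw [toCorner_bimk, toCorner_bimk, ← map_smul, proj_map]
    rfl

/-- The natural transformation with components `ofCorner`. -/
def ofCornerNat : φ.corner ⋙ (bimodTensor k D).obj (bimod k D D) ⟶
    (bimodTensor k Λ).obj (relTensor k A B M N) where
  app Y := ModuleCat.ofHom (φ.ofCorner Y)
  naturality Y Y' f := ModuleCat.hom_ext <| bimodTensor_ext fun d y => by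
    obtain ⟨d, rfl⟩ := (bimodIn k D D).surjective d
    change φ.ofCorner Y' (bimk (bimodIn k D D d) (φ.corner.map f y)) =
      bimodTensorMap (𝟙 (relTensor k A B M N)) f (φ.ofCorner Y (bimk (bimodIn k D D d) y))
    rw [ofCorner_bimk, ofCorner_bimk, val_map, ← map_smul]
    rfl

end DiagFactor

end RelativeTensorTor

section HomologyProduct

theorem homology_prod_equiv {k : Type u} [Field k] {K L L' : ChainComplex (ModuleCat.{u} k) ℕ}
    (p : K ⟶ L) (p' : K ⟶ L') (s : L ⟶ K) (s' : L' ⟶ K) (h : s ≫ p = 𝟙 L) (h' : s' ≫ p' = 𝟙 L')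
    (hz : s ≫ p' = 0) (hz' : s' ≫ p = 0) (hsum : p ≫ s + p' ≫ s' = 𝟙 K) (n : ℕ) :
    Nonempty (K.homology n ≃ₗ[k] L.homology n × L'.homology n) := by
  let H := HomologicalComplex.homologyFunctor (ModuleCat.{u} k) (ComplexShape.down ℕ) n
  have key {X Y Z : ChainComplex (ModuleCat.{u} k) ℕ} {f : X ⟶ Y} {g : Y ⟶ Z} {e : X ⟶ Z}
      (hf : f ≫ g = e) (x) : (H.map g).hom ((H.map f).hom x) = (H.map e).hom x := by
    rw [← hf, H.map_comp]
    rfl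
  have e1 := key h
  have e2 := key h'
  have e3 := key hz
  have e4 := key hz'
  have e5 : ∀ x, (H.map s).hom ((H.map p).hom x) + (H.map s').hom ((H.map p').hom x) = x :=
    fun x => by
      have := congrArg (fun f => (H.map f).hom x) hsum
      simpa [H.map_add] using this
  simp only [H.map_id, ModuleCat.hom_id, LinearMap.id_apply, Functor.map_zero, ModuleCat.hom_zero,
    LinearMap.zero_apply] at e1 e2 e3 e4
  exact ⟨LinearEquiv.ofLinearMap ((H.map p).hom.prod (H.map p').hom)
    ((H.map s).hom.coprod (H.map s').hom)
    (LinearMap.ext fun x => by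
      refine Prod.ext ?_ ?_
      · change (H.map p).hom ((H.map s).hom x.1 + (H.map s').hom x.2) = x.1
        exact (map_add (H.map p).hom _ _).trans
          ((congrArg₂ (· + ·) (e1 x.1) (e4 x.2)).trans (add_zero _))
      · change (H.map p').hom ((H.map s).hom x.1 + (H.map s').hom x.2) = x.2
        exact (map_add (H.map p').hom _ _).trans
          ((congrArg₂ (· + ·) (e3 x.1) (e2 x.2)).trans (zero_add _)))
    (LinearMap.ext e5)⟩

end HomologyProduct

section RelativeTensorTor

variable {k A B M N : Type u} [Field k] [Ring A] [Algebra k A] [Ring B] [Algebra k B]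
  [AddCommGroup M] [Module k M] [Module B M] [Module Aᵐᵒᵖ M]
  [IsScalarTower k B M] [IsScalarTower k Aᵐᵒᵖ M] [SMulCommClass B Aᵐᵒᵖ M]
  [AddCommGroup N] [Module k N] [Module A N] [Module Bᵐᵒᵖ N]
  [IsScalarTower k A N] [IsScalarTower k Bᵐᵒᵖ N] [SMulCommClass A Bᵐᵒᵖ N]

local notation "Λ" => NullSquare A B M N

namespace DiagFactor

variable {D : Type u} [Ring D] [Algebra k D] (φ : DiagFactor k A B M N D)

/-- The isomorphism `e Λ e ≅ D`. -/
def cornerSelfIso (hi : Function.Injective φ.incl)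
    (hc : ∀ l, ∃ d, φ.incl 1 * l * φ.incl 1 = φ.incl d) :
    bimod k D D ≅ φ.corner.obj (bimod k Λ Λ) := by
  have hsm : ∀ (d : D) (e : D) (l : Λ), envMap φ.incl (d ⊗ₜ op e) • bimodIn k Λ Λ l
      = bimodIn k Λ Λ (φ.incl d * (l * φ.incl e)) := fun d e l => by
    rw [envMap_tmul, bimodIn_smul]
    rfl
  let f : D →+ φ.corner.obj (bimod k Λ Λ) :=
    { toFun := fun d => Corner.mk (j := envMap φ.incl) (bimodIn k Λ Λ (φ.incl d)) (by
        rw [Algebra.TensorProduct.one_def, ← op_one, hsm, ← map_mul, ← map_mul, one_mul, mul_one])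
      map_zero' := Corner.ext (by simp only [map_zero]; rfl)
      map_add' := fun d e => Corner.ext (by simp only [map_add]; rfl) }
  have hf : ∀ d, φ.val _ (f d) = bimodIn k Λ Λ (φ.incl d) := fun d => rfl
  have hs : ∀ (x : D ⊗[k] Dᵐᵒᵖ) (d : bimod k D D),
      f ((bimodIn k D D).symm (x • d)) = x • f ((bimodIn k D D).symm d) := fun x d => by
    obtain ⟨d, rfl⟩ := (bimodIn k D D).surjective d
    induction x using TensorProduct.induction_on with
    | zero =>
      have h0 : (0 : D ⊗[k] Dᵐᵒᵖ) • bimodIn k D D d = 0 :=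
        zero_smul (D ⊗[k] Dᵐᵒᵖ) (bimodIn k D D d)
      rw [h0, map_zero, map_zero]
      exact (zero_smul (D ⊗[k] Dᵐᵒᵖ) (f _)).symm
    | add x y hx hy => rw [add_smul, map_add, map_add, hx, hy, add_smul]
    | tmul x y =>
      apply φ.val_injective
      rw [bimodIn_smul, LinearEquiv.symm_apply_apply, LinearEquiv.symm_apply_apply, val_smul, hf, hf,
        ← op_unop y, hsm, ← map_mul, ← map_mul]
      rfl
  let g : bimod k D D →ₗ[D ⊗[k] Dᵐᵒᵖ] φ.corner.obj (bimod k Λ Λ) :=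
    { toFun := fun d => f ((bimodIn k D D).symm d)
      map_add' := fun d e => by rw [map_add, map_add]
      map_smul' := hs }
  refine (LinearEquiv.ofBijective g ⟨?_, ?_⟩).toModuleIso
  · intro d e h
    have h' := congrArg (φ.val _) h
    exact (bimodIn k D D).symm.injective (hi ((bimodIn k Λ Λ).injective h'))
  · intro y
    obtain ⟨l, hl⟩ := (bimodIn k Λ Λ).surjective (φ.val _ y)
    obtain ⟨d, hd⟩ := hc l
    refine ⟨bimodIn k D D d, φ.val_injective _ ?_⟩
    refine (hf d).trans ?_
    rw [← hd, mul_assoc, ← hsm, op_one, ← Algebra.TensorProduct.one_def, hl, one_smul_val]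

/-- Hochschild homology of `D` computed from a resolution of `Λ`. -/
theorem hh_equiv (hi : Function.Injective φ.incl)
    (hc : ∀ l, ∃ d, φ.incl 1 * l * φ.incl 1 = φ.incl d)
    (hp : Module.Projective (D ⊗[k] Dᵐᵒᵖ) (Corner (envMap φ.incl) (Λ ⊗[k] Λᵐᵒᵖ)))
    (P : ProjectiveResolution (bimod k Λ Λ)) (n : ℕ) :
    Nonempty (HH k D n ≃ₗ[k]
      (((φ.corner ⋙ (bimodTensor k D).obj (bimod k D D)).mapHomologicalComplex _).obj
        P.complex).homology n) := by
  have := cornerFunctor_preservesProjective (j := envMap φ.incl) hp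
  exact ⟨(((((bimodTensor k D).obj (bimod k D D)).leftDerived n).mapIso
    (φ.cornerSelfIso hi hc)) ≪≫ (φ.corner.mapProjectiveResolution P).isoLeftDerivedObj
      ((bimodTensor k D).obj (bimod k D D)) n).toLinearEquiv⟩

end DiagFactor

theorem projective_corner_A [Module.Projective A N] [Module.Projective Aᵐᵒᵖ M] :
    Module.Projective (A ⊗[k] Aᵐᵒᵖ)
      (Corner (envMap (diagFactorA k A B M N).incl) (Λ ⊗[k] Λᵐᵒᵖ)) := by
  have : Module.Projective Aᵐᵒᵖ A :=
    Module.Projective.of_equiv' (LinearEquiv.ofBijective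
      (LinearMap.toSpanSingleton Aᵐᵒᵖ A 1)
        ⟨fun x y h => by simpa using h, fun x => ⟨op x, by simp⟩⟩)
  have e : ∀ a, (diagFactorA k A B M N).incl a = ⟨a, 0, 0, 0⟩ := fun _ => rfl
  refine projective_corner_env (diagFactorA k A B M N).incl (A × N) (A × M)
    { toFun := fun l => (l.a, l.n), map_add' := fun _ _ => rfl, map_smul' := fun _ _ => rfl }
    { toFun := fun x => ⟨x.1, x.2, 0, 0⟩
      map_add' := fun _ _ => by ext <;> simp
      map_smul' := fun _ _ => by ext <;> simp }
    (fun a l => by ext <;> simp [e]) (fun a x => by ext <;> simp [e])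
    (fun l => by ext <;> simp [e])
    { toFun := fun l => (l.a, l.m), map_add' := fun _ _ => rfl, map_smul' := fun _ _ => rfl }
    { toFun := fun x => ⟨x.1, 0, x.2, 0⟩
      map_add' := fun _ _ => by ext <;> simp
      map_smul' := fun _ _ => by ext <;> simp }
    (fun a l => by ext <;> simp [e]) (fun a x => by ext <;> simp [e])
    (fun l => by ext <;> simp [e])

theorem projective_corner_B [Module.Projective B M] [Module.Projective Bᵐᵒᵖ N] :
    Module.Projective (B ⊗[k] Bᵐᵒᵖ)
      (Corner (envMap (diagFactorB k A B M N).incl) (Λ ⊗[k] Λᵐᵒᵖ)) := by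
  have : Module.Projective Bᵐᵒᵖ B :=
    Module.Projective.of_equiv' (LinearEquiv.ofBijective
      (LinearMap.toSpanSingleton Bᵐᵒᵖ B 1)
        ⟨fun x y h => by simpa using h, fun x => ⟨op x, by simp⟩⟩)
  have e : ∀ a, (diagFactorB k A B M N).incl a = ⟨0, 0, 0, a⟩ := fun _ => rfl
  refine projective_corner_env (diagFactorB k A B M N).incl (B × M) (B × N)
    { toFun := fun l => (l.b, l.m), map_add' := fun _ _ => rfl, map_smul' := fun _ _ => rfl }
    { toFun := fun x => ⟨0, 0, x.2, x.1⟩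
      map_add' := fun _ _ => by ext <;> simp
      map_smul' := fun _ _ => by ext <;> simp }
    (fun a l => by ext <;> simp [e]) (fun a x => by ext <;> simp [e])
    (fun l => by ext <;> simp [e])
    { toFun := fun l => (l.b, l.n), map_add' := fun _ _ => rfl, map_smul' := fun _ _ => rfl }
    { toFun := fun x => ⟨0, x.2, 0, x.1⟩
      map_add' := fun _ _ => by ext <;> simp
      map_smul' := fun _ _ => by ext <;> simp }
    (fun a l => by ext <;> simp [e]) (fun a x => by ext <;> simp [e])
    (fun l => by ext <;> simp [e])

theorem ofCorner_toCorner_sum (Y : BimodCat k Λ) :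
    (diagFactorA k A B M N).ofCorner Y ∘ₗ (diagFactorA k A B M N).toCorner Y +
      (diagFactorB k A B M N).ofCorner Y ∘ₗ (diagFactorB k A B M N).toCorner Y
      = LinearMap.id := by
  refine DiagFactor.relTensor_tensor_ext fun x y v => ?_
  rw [LinearMap.add_apply, LinearMap.comp_apply, LinearMap.comp_apply,
    DiagFactor.ofCorner_toCorner, DiagFactor.ofCorner_toCorner, ← bimk_add_right, ← add_smul,
    ← TensorProduct.add_tmul, LinearMap.id_apply]
  have h : (diagFactorA k A B M N).incl 1 + (diagFactorB k A B M N).incl 1 = 1 := by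
    ext <;> simp [diagFactorA, diagFactorB]
  rw [h, ← Algebra.TensorProduct.one_def, one_smul, ← bimk_balanced, relOne, relTensor_smul,
    mul_one, one_mul]
  rfl

theorem tor_relTensor_equiv [Module.Projective A N] [Module.Projective Aᵐᵒᵖ M]
    [Module.Projective B M] [Module.Projective Bᵐᵒᵖ N] (n : ℕ) :
    Nonempty (TorObj n (relTensor k A B M N) (bimod k Λ Λ) ≃ₗ[k] HH k A n × HH k B n) := by
  have P := projectiveResolution (bimod k Λ Λ)
  obtain ⟨eA⟩ := (diagFactorA k A B M N).hh_equiv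
    (fun a b h => congrArg NullSquare.a h)
    (fun l => ⟨l.a, by ext <;> simp [diagFactorA]⟩) projective_corner_A P n
  obtain ⟨eB⟩ := (diagFactorB k A B M N).hh_equiv
    (fun a b h => congrArg NullSquare.b h)
    (fun l => ⟨l.b, by ext <;> simp [diagFactorB]⟩) projective_corner_B P n
  obtain ⟨e⟩ := homology_prod_equiv
    ((NatTrans.mapHomologicalComplex (diagFactorA k A B M N).toCornerNat _).app P.complex)
    ((NatTrans.mapHomologicalComplex (diagFactorB k A B M N).toCornerNat _).app P.complex)
    ((NatTrans.mapHomologicalComplex (diagFactorA k A B M N).ofCornerNat _).app P.complex)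
    ((NatTrans.mapHomologicalComplex (diagFactorB k A B M N).ofCornerNat _).app P.complex)
    (by
      ext i : 1
      exact ModuleCat.hom_ext (DiagFactor.toCorner_ofCorner _ _))
    (by
      ext i : 1
      exact ModuleCat.hom_ext (DiagFactor.toCorner_ofCorner _ _))
    (by
      ext i : 1
      refine ModuleCat.hom_ext (DiagFactor.toCorner_ofCorner_of_ne _ _ (fun a => ?_) _)
      ext <;> simp [diagFactorA, diagFactorB])
    (by
      ext i : 1
      refine ModuleCat.hom_ext (DiagFactor.toCorner_ofCorner_of_ne _ _ (fun a => ?_) _)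
      ext <;> simp [diagFactorA, diagFactorB])
    (by
      ext i : 1
      exact ModuleCat.hom_ext (ofCorner_toCorner_sum _)) n
  exact ⟨(P.isoLeftDerivedObj ((bimodTensor k Λ).obj (relTensor k A B M N)) n).toLinearEquiv ≪≫ₗ
    e ≪≫ₗ (eA.symm.prodCongr eB.symm)⟩

end RelativeTensorTor

namespace TensorPow

variable {k A X : Type u} [Field k] [Ring A] [Algebra k A]
  [AddCommGroup X] [Module k X] [Module A X] [Module Aᵐᵒᵖ X]
  {V : Type u} [AddCommGroup V] [Module k V] {m : ℕ}

variable (k A X m) in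
/-- The canonical multilinear map to the tensor power. -/
def mkMulti : MultilinearMap k (fun _ : Fin (m + 1) => X) (TensorPow k A X m) :=
  (mkLin k A X m).compMultilinearMap (PiTensorProduct.tprod k)

/-- The linear map induced by a balanced multilinear map. -/
def liftMulti (f : MultilinearMap k (fun _ : Fin (m + 1) => X) V)
    (h : ∀ (x : Fin (m + 1) → X) (i : Fin m) (a : A),
      f (Function.update x i.castSucc (op a • x i.castSucc))
        = f (Function.update x i.succ (a • x i.succ))) : TensorPow k A X m →ₗ[k] V :=
  lift (PiTensorProduct.lift f) fun x i a => by
    rw [PiTensorProduct.lift.tprod, PiTensorProduct.lift.tprod, h]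

theorem liftMulti_mk (f : MultilinearMap k (fun _ : Fin (m + 1) => X) V)
    (h : ∀ (x : Fin (m + 1) → X) (i : Fin m) (a : A),
      f (Function.update x i.castSucc (op a • x i.castSucc))
        = f (Function.update x i.succ (a • x i.succ))) (x : Fin (m + 1) → X) :
    liftMulti f h (mk k A x) = f x := by
  rw [liftMulti, lift_mk, PiTensorProduct.lift.tprod]

theorem mk_cons_update_smul (x : X) (y : Fin (m + 1) → X) (i : Fin m) (a : A) :
    mk k A (Fin.cons x (Function.update y i.castSucc (op a • y i.castSucc)) : Fin (m + 2) → X)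
      = mk k A (Fin.cons x (Function.update y i.succ (a • y i.succ)) : Fin (m + 2) → X) := by
  rw [Fin.cons_update, Fin.cons_update]
  exact mk_smul (Fin.cons x y : Fin (m + 2) → X) i.succ a

theorem mk_snoc_update_smul (x : X) (y : Fin (m + 1) → X) (i : Fin m) (a : A) :
    mk k A (Fin.snoc (Function.update y i.castSucc (op a • y i.castSucc)) x : Fin (m + 2) → X)
      = mk k A (Fin.snoc (Function.update y i.succ (a • y i.succ)) x : Fin (m + 2) → X) := by
  rw [Fin.snoc_update, Fin.snoc_update]
  have h := mk_smul (k := k) (Fin.snoc y x : Fin (m + 2) → X) i.castSucc a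
  rw [← Fin.castSucc_succ, Fin.snoc_castSucc, Fin.snoc_castSucc] at h
  exact h

/-- The map `x₀ ⊗ ⋯ ⊗ xₘ ↦ x ⊗ x₀ ⊗ ⋯ ⊗ xₘ`. -/
def consAt (x : X) : TensorPow k A X m →ₗ[k] TensorPow k A X (m + 1) :=
  liftMulti ((mkMulti k A X (m + 1)).curryLeft x) fun y i a =>
    mk_cons_update_smul x y i a

theorem consAt_mk (x : X) (y : Fin (m + 1) → X) :
    consAt x (mk k A y) = mk k A (Fin.cons x y : Fin (m + 2) → X) :=
  liftMulti_mk _ (fun y i a => mk_cons_update_smul x y i a) y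

/-- The map `(x, x₀ ⊗ ⋯ ⊗ xₘ) ↦ x ⊗ x₀ ⊗ ⋯ ⊗ xₘ`. -/
def cons : X →ₗ[k] TensorPow k A X m →ₗ[k] TensorPow k A X (m + 1) where
  toFun := consAt
  map_add' x y := hom_ext fun z => by
    rw [LinearMap.add_apply, consAt_mk, consAt_mk, consAt_mk]
    exact congrArg (fun f => f z) ((mkMulti k A X (m + 1)).curryLeft.map_add x y)
  map_smul' c x := hom_ext fun z => by
    rw [LinearMap.smul_apply, consAt_mk, consAt_mk]
    exact congrArg (fun f => f z) ((mkMulti k A X (m + 1)).curryLeft.map_smul c x)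

theorem cons_mk (x : X) (y : Fin (m + 1) → X) :
    cons x (mk k A y) = mk k A (Fin.cons x y : Fin (m + 2) → X) :=
  consAt_mk x y

/-- The map `(x₀ ⊗ ⋯ ⊗ xₘ, x) ↦ x₀ ⊗ ⋯ ⊗ xₘ ⊗ x`. -/
def snoc : TensorPow k A X m →ₗ[k] X →ₗ[k] TensorPow k A X (m + 1) :=
  liftMulti ((mkMulti k A X (m + 1)).curryRight) fun y i a =>
    LinearMap.ext fun x => mk_snoc_update_smul x y i a

theorem snoc_mk (x : X) (y : Fin (m + 1) → X) :
    snoc (mk k A y) x = mk k A (Fin.snoc y x : Fin (m + 2) → X) := by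
  rw [snoc, liftMulti_mk]
  rfl

theorem mk_eq_cons (x : Fin (m + 2) → X) : mk k A x = cons (x 0) (mk k A (Fin.tail x)) := by
  rw [cons_mk, Fin.cons_self_tail]

theorem mk_eq_snoc (x : Fin (m + 2) → X) :
    mk k A x = snoc (mk k A (Fin.init x)) (x (Fin.last (m + 1))) := by
  rw [snoc_mk, Fin.snoc_init_self]

theorem cons_ext {f g : TensorPow k A X (m + 1) →ₗ[k] V}
    (h : ∀ x t, f (cons x t) = g (cons x t)) : f = g :=
  hom_ext fun x => by rw [mk_eq_cons, h]

theorem snoc_ext {f g : TensorPow k A X (m + 1) →ₗ[k] V}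
    (h : ∀ t x, f (snoc t x) = g (snoc t x)) : f = g :=
  hom_ext fun x => by rw [mk_eq_snoc, h]

theorem cons_op_smul (a : A) (x : X) (t : TensorPow k A X m)
    [IsScalarTower k A X] [IsScalarTower k Aᵐᵒᵖ X] [SMulCommClass A Aᵐᵒᵖ X] :
    cons (op a • x) t = cons x (a • t) := by
  refine LinearMap.congr_fun (f := cons (op a • x)) (g := cons x ∘ₗ leftMul k A X m a)
    (hom_ext fun y => ?_) t
  rw [LinearMap.comp_apply, leftMul_mk, cons_mk, cons_mk, Fin.cons_update]
  have h := mk_smul (k := k) (Fin.cons x y : Fin (m + 2) → X) 0 a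
  rw [Fin.castSucc_zero, Fin.cons_zero, Fin.update_cons_zero] at h
  exact h

theorem snoc_smul (a : A) (x : X) (t : TensorPow k A X m)
    [IsScalarTower k A X] [IsScalarTower k Aᵐᵒᵖ X] [SMulCommClass A Aᵐᵒᵖ X] :
    snoc (op a • t) x = snoc t (a • x) := by
  refine LinearMap.congr_fun (f := snoc.flip x ∘ₗ rightMul k A X m (op a)) (g := snoc.flip (a • x))
    (hom_ext fun y => ?_) t
  rw [LinearMap.comp_apply, rightMul_mk, LinearMap.flip_apply, LinearMap.flip_apply, snoc_mk,
    snoc_mk, Fin.snoc_update]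
  have h := mk_smul (k := k) (Fin.snoc y x : Fin (m + 2) → X) (Fin.last m) a
  rw [Fin.snoc_castSucc, Fin.succ_last, Fin.snoc_last, Fin.update_snoc_last] at h
  exact h

theorem cons_snoc (x y : X) (t : TensorPow k A X m) :
    cons x (snoc t y) = snoc (cons x t) y := by
  refine LinearMap.congr_fun (f := cons x ∘ₗ snoc.flip y) (g := snoc.flip y ∘ₗ cons x)
    (hom_ext fun z => ?_) t
  rw [LinearMap.comp_apply, LinearMap.comp_apply, LinearMap.flip_apply, LinearMap.flip_apply,
    snoc_mk, cons_mk, cons_mk, snoc_mk, Fin.cons_snoc_eq_snoc_cons]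

section Act

variable [IsScalarTower k A X] [IsScalarTower k Aᵐᵒᵖ X] [SMulCommClass A Aᵐᵒᵖ X]

theorem smul_cons (a : A) (x : X) (t : TensorPow k A X m) :
    a • cons x t = cons (a • x) t := by
  refine LinearMap.congr_fun (f := leftMul k A X (m + 1) a ∘ₗ cons x) (g := cons (a • x))
    (hom_ext fun y => ?_) t
  rw [LinearMap.comp_apply, cons_mk, leftMul_mk, cons_mk, Fin.cons_zero, Fin.update_cons_zero]

theorem op_smul_cons (a : Aᵐᵒᵖ) (x : X) (t : TensorPow k A X m) :
    a • cons x t = cons x (a • t) := by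
  refine LinearMap.congr_fun (f := rightMul k A X (m + 1) a ∘ₗ cons x)
    (g := cons x ∘ₗ rightMul k A X m a) (hom_ext fun y => ?_) t
  rw [LinearMap.comp_apply, LinearMap.comp_apply, cons_mk, rightMul_mk, rightMul_mk, cons_mk,
    Fin.cons_update]
  rfl

theorem smul_snoc (a : A) (x : X) (t : TensorPow k A X m) :
    a • snoc t x = snoc (a • t) x := by
  refine LinearMap.congr_fun (f := leftMul k A X (m + 1) a ∘ₗ snoc.flip x)
    (g := snoc.flip x ∘ₗ leftMul k A X m a) (hom_ext fun y => ?_) t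
  rw [LinearMap.comp_apply, LinearMap.comp_apply, LinearMap.flip_apply, LinearMap.flip_apply,
    snoc_mk, leftMul_mk, leftMul_mk, snoc_mk, Fin.snoc_update]
  have h : (Fin.snoc y x : Fin (m + 2) → X) 0 = y 0 :=
    Fin.snoc_castSucc (α := fun _ => X) x y 0
  rw [h]
  rfl

theorem op_smul_snoc (a : Aᵐᵒᵖ) (x : X) (t : TensorPow k A X m) :
    a • snoc t x = snoc t (a • x) := by
  refine LinearMap.congr_fun (f := rightMul k A X (m + 1) a ∘ₗ snoc.flip x)
    (g := snoc.flip (a • x)) (hom_ext fun y => ?_) t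
  rw [LinearMap.comp_apply, LinearMap.flip_apply, LinearMap.flip_apply,
    snoc_mk, rightMul_mk, snoc_mk, Fin.snoc_last, Fin.update_snoc_last]

instance : IsScalarTower k A (TensorPow k A X m) where
  smul_assoc c a t := by
    refine LinearMap.congr_fun (f := leftMul k A X m (c • a)) (g := c • leftMul k A X m a)
      (hom_ext fun x => ?_) t
    rw [leftMul_mk, LinearMap.smul_apply, leftMul_mk, smul_assoc]
    exact (mkMulti k A X m).map_update_smul x 0 c (a • x 0)

instance : IsScalarTower k Aᵐᵒᵖ (TensorPow k A X m) where
  smul_assoc c a t := by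
    refine LinearMap.congr_fun (f := rightMul k A X m (c • a)) (g := c • rightMul k A X m a)
      (hom_ext fun x => ?_) t
    rw [rightMul_mk, LinearMap.smul_apply, rightMul_mk, smul_assoc]
    exact (mkMulti k A X m).map_update_smul x _ c (a • x _)

instance : SMulCommClass A Aᵐᵒᵖ (TensorPow k A X m) where
  smul_comm a b t := by
    refine LinearMap.congr_fun (f := leftMul k A X m a ∘ₗ rightMul k A X m b)
      (g := rightMul k A X m b ∘ₗ leftMul k A X m a) (hom_ext fun x => ?_) t
    rw [LinearMap.comp_apply, LinearMap.comp_apply, leftMul_mk, rightMul_mk, rightMul_mk,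
      leftMul_mk]
    exact congrArg (mk k A) (update_update_comm x (Fin.last m) 0 (fun z => a • z)
      (fun z => b • z) fun _ z => smul_comm a b z)

/-- The linear map on `X ⊗_A X^{⊗ m + 1}` induced by a balanced bilinear map. -/
def consLift (f : X →ₗ[k] TensorPow k A X m →ₗ[k] V)
    (h : ∀ (a : A) x t, f (op a • x) t = f x (a • t)) : TensorPow k A X (m + 1) →ₗ[k] V :=
  liftMulti (LinearMap.uncurryLeft
    { toFun := fun x => (f x).compMultilinearMap (mkMulti k A X m)
      map_add' := fun x y => by ext; simp
      map_smul' := fun c x => by ext; simp }) fun x i a => by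
    change f _ (mk k A _) = f _ (mk k A _)
    induction i using Fin.cases with
    | zero =>
      have h0 : (Function.update x (0 : Fin (m + 1)).castSucc
          (op a • x (0 : Fin (m + 1)).castSucc)) 0 = op a • x 0 := by simp
      have h1 : (Function.update x (0 : Fin (m + 1)).succ (a • x (0 : Fin (m + 1)).succ)) 0 = x 0 :=
        Function.update_of_ne (Fin.succ_ne_zero _).symm _ _
      have h2 : Fin.tail (Function.update x (0 : Fin (m + 1)).castSucc
          (op a • x (0 : Fin (m + 1)).castSucc)) = Fin.tail x := Fin.tail_update_zero _ _
      have h3 : Fin.tail (Function.update x (0 : Fin (m + 1)).succ (a • x (0 : Fin (m + 1)).succ))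
          = Function.update (Fin.tail x) 0 (a • Fin.tail x 0) := Fin.tail_update_succ _ _ _
      rw [h0, h1, h2, h3, h, smul_mk]
    | succ i =>
      have h0 : (Function.update x i.succ.castSucc (op a • x i.succ.castSucc)) 0 = x 0 :=
        Function.update_of_ne (Fin.succ_ne_zero i.castSucc).symm _ _
      have h1 : (Function.update x i.succ.succ (a • x i.succ.succ)) 0 = x 0 :=
        Function.update_of_ne (Fin.succ_ne_zero _).symm _ _
      have h2 : Fin.tail (Function.update x i.succ.castSucc (op a • x i.succ.castSucc))
          = Function.update (Fin.tail x) i.castSucc (op a • Fin.tail x i.castSucc) :=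
        Fin.tail_update_succ x i.castSucc _
      have h3 : Fin.tail (Function.update x i.succ.succ (a • x i.succ.succ))
          = Function.update (Fin.tail x) i.succ (a • Fin.tail x i.succ) :=
        Fin.tail_update_succ _ _ _
      rw [h0, h1, h2, h3, mk_smul]

theorem consLift_cons (f : X →ₗ[k] TensorPow k A X m →ₗ[k] V)
    (h : ∀ (a : A) x t, f (op a • x) t = f x (a • t)) (x : X) (t : TensorPow k A X m) :
    consLift f h (cons x t) = f x t := by
  refine LinearMap.congr_fun (f := consLift f h ∘ₗ cons x) (g := f x) (hom_ext fun y => ?_) t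
  rw [LinearMap.comp_apply, cons_mk, consLift, liftMulti_mk]
  rfl

/-- The linear map on `X^{⊗ m + 1} ⊗_A X` induced by a balanced bilinear map. -/
def snocLift (f : TensorPow k A X m →ₗ[k] X →ₗ[k] V)
    (h : ∀ (a : A) t x, f (op a • t) x = f t (a • x)) : TensorPow k A X (m + 1) →ₗ[k] V :=
  liftMulti (MultilinearMap.uncurryRight (f.compMultilinearMap (mkMulti k A X m))) fun x i a => by
    change f (mk k A _) _ = f (mk k A _) _
    induction i using Fin.lastCases with
    | last =>
      have h0 : (Function.update x (Fin.last m).castSucc (op a • x (Fin.last m).castSucc))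
          (Fin.last (m + 1)) = x (Fin.last (m + 1)) :=
        Function.update_of_ne (Fin.castSucc_lt_last _).ne' _ _
      have h1 : (Function.update x (Fin.last m).succ (a • x (Fin.last m).succ)) (Fin.last (m + 1))
          = a • x (Fin.last (m + 1)) := Function.update_self _ _ _
      have h2 : Fin.init (Function.update x (Fin.last m).castSucc
          (op a • x (Fin.last m).castSucc))
          = Function.update (Fin.init x) (Fin.last m) (op a • Fin.init x (Fin.last m)) :=
        Fin.init_update_castSucc _ _ _
      have h3 : Fin.init (Function.update x (Fin.last m).succ (a • x (Fin.last m).succ))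
          = Fin.init x := Fin.init_update_last _ _
      rw [h0, h1, h2, h3, ← h, op_smul_mk]
    | cast i =>
      have h0 : (Function.update x i.castSucc.castSucc (op a • x i.castSucc.castSucc))
          (Fin.last (m + 1)) = x (Fin.last (m + 1)) :=
        Function.update_of_ne (Fin.castSucc_lt_last _).ne' _ _
      have h1 : (Function.update x i.castSucc.succ (a • x i.castSucc.succ)) (Fin.last (m + 1))
          = x (Fin.last (m + 1)) :=
        Function.update_of_ne (Fin.castSucc_lt_last i.succ).ne' _ _
      have h2 : Fin.init (Function.update x i.castSucc.castSucc (op a • x i.castSucc.castSucc))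
          = Function.update (Fin.init x) i.castSucc (op a • Fin.init x i.castSucc) :=
        Fin.init_update_castSucc _ _ _
      have h3 : Fin.init (Function.update x i.castSucc.succ (a • x i.castSucc.succ))
          = Function.update (Fin.init x) i.succ (a • Fin.init x i.succ) :=
        Fin.init_update_castSucc x i.succ _
      rw [h0, h1, h2, h3, mk_smul]

theorem snocLift_snoc (f : TensorPow k A X m →ₗ[k] X →ₗ[k] V)
    (h : ∀ (a : A) t x, f (op a • t) x = f t (a • x)) (t : TensorPow k A X m) (x : X) :
    snocLift f h (snoc t x) = f t x := by
  refine LinearMap.congr_fun (f := snocLift f h ∘ₗ snoc.flip x) (g := f.flip x)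
    (hom_ext fun y => ?_) t
  rw [LinearMap.comp_apply, LinearMap.flip_apply, LinearMap.flip_apply, snoc_mk, snocLift,
    liftMulti_mk, MultilinearMap.uncurryRight_apply, Fin.init_snoc, Fin.snoc_last]
  rfl

theorem update_fin_one (x : Fin (0 + 1) → X) (i : Fin (0 + 1)) (y : X) :
    Function.update x i y = fun _ => y := by
  funext j
  rw [Fin.fin_one_eq_zero i, Fin.fin_one_eq_zero j, Function.update_self]

variable (k A X) in
/-- The canonical map from `X` to its first tensor power. -/
def singleLin : X →ₗ[k] TensorPow k A X 0 where
  toFun x := mk k A fun _ => x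
  map_add' x y := by
    have := mk_update_add (k := k) (A := A) (fun _ : Fin (0 + 1) => x) 0 x y
    rwa [update_fin_one, update_fin_one, update_fin_one] at this
  map_smul' c x := by
    have := (mkMulti k A X 0).map_update_smul (fun _ : Fin (0 + 1) => x) 0 c x
    rwa [update_fin_one, update_fin_one] at this

variable (k A X) in
/-- The canonical map from the first tensor power of `X` to `X`. -/
def unsingle : TensorPow k A X 0 →ₗ[k] X :=
  liftMulti
    { toFun := fun x => x 0
      map_update_add' := fun x i y z => by
        rw [Fin.fin_one_eq_zero i, Function.update_self, Function.update_self,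
          Function.update_self]
      map_update_smul' := fun x i c y => by
        rw [Fin.fin_one_eq_zero i, Function.update_self, Function.update_self] }
    fun _ i => i.elim0

theorem unsingle_mk (x : Fin (0 + 1) → X) : unsingle k A X (mk k A x) = x 0 :=
  liftMulti_mk _ (fun _ i => i.elim0) x

variable (k A X) in
/-- The first tensor power of `X` is `X`. -/
def single : X ≃ₗ[k] TensorPow k A X 0 :=
  LinearEquiv.ofLinearMap (singleLin k A X) (unsingle k A X)
    (hom_ext fun x => by
      rw [LinearMap.comp_apply, unsingle_mk]
      exact congrArg (mk k A) (funext fun i => by rw [Fin.fin_one_eq_zero i]))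
    (LinearMap.ext fun x => unsingle_mk (k := k) (A := A) fun _ => x)

theorem single_apply (x : X) : single k A X x = mk k A fun _ => x := rfl

theorem smul_single (a : A) (x : X) : a • single k A X x = single k A X (a • x) := by
  rw [single_apply, single_apply, smul_mk, update_fin_one]

theorem op_smul_single (a : Aᵐᵒᵖ) (x : X) : a • single k A X x = single k A X (a • x) := by
  rw [single_apply, single_apply, op_smul_mk, update_fin_one]

theorem cons_single (x y : X) :
    cons x (single k A X y) = snoc (single k A X x) y := by
  rw [single_apply, single_apply, cons_mk, snoc_mk]
  congr 1
  funext i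
  fin_cases i <;> rfl

/-- The class of a tensor in the zeroth homology. -/
def toH0 : TensorPow k A X m →ₗ[k] H0 k A (TensorPow k A X m) :=
  (commRel k A (TensorPow k A X m)).mkQ

theorem toH0_surjective : Function.Surjective (toH0 : TensorPow k A X m →ₗ[k] _) :=
  Submodule.mkQ_surjective _

theorem toH0_smul (a : A) (t : TensorPow k A X m) :
    toH0 (a • t) = toH0 (op a • t) :=
  (Submodule.Quotient.eq _).2 (Submodule.subset_span ⟨a, t, rfl⟩)

theorem rotate_toH0_snoc (t : TensorPow k A X m) (x : X) :
    rotate k A X (m + 1) (toH0 (snoc t x)) = toH0 (cons x t) := by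
  refine LinearMap.congr_fun (f := rotate k A X (m + 1) ∘ₗ toH0 ∘ₗ snoc.flip x)
    (g := toH0 ∘ₗ cons x) (hom_ext fun y => ?_) t
  rw [LinearMap.comp_apply, LinearMap.comp_apply, LinearMap.comp_apply, LinearMap.flip_apply,
    snoc_mk, cons_mk, Fin.snoc_eq_cons_rotate]
  refine (rotate_cyc _).trans ?_
  simp only [Equiv.apply_symm_apply]
  rfl

end Act

end TensorPow

section BimodActions

variable {k R : Type u} [Field k] [Ring R] [Algebra k R]

instance (X : BimodCat k R) : Module R X :=
  Module.compHom X (Algebra.TensorProduct.includeLeft : R →ₐ[k] R ⊗[k] Rᵐᵒᵖ).toRingHom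

instance (X : BimodCat k R) : Module Rᵐᵒᵖ X :=
  Module.compHom X (Algebra.TensorProduct.includeRight : Rᵐᵒᵖ →ₐ[k] R ⊗[k] Rᵐᵒᵖ).toRingHom

variable {X Y : BimodCat k R}

theorem bimodCat_smul_def (r : R) (x : X) : r • x = (r ⊗ₜ[k] 1 : R ⊗[k] Rᵐᵒᵖ) • x := rfl

theorem bimodCat_op_smul_def (r : Rᵐᵒᵖ) (x : X) : r • x = (1 ⊗ₜ[k] r : R ⊗[k] Rᵐᵒᵖ) • x := rfl

theorem bimodCat_tmul_smul (r : R) (s : Rᵐᵒᵖ) (x : X) :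
    (r ⊗ₜ[k] s : R ⊗[k] Rᵐᵒᵖ) • x = r • s • x := by
  rw [bimodCat_smul_def, bimodCat_op_smul_def, ← mul_smul, Algebra.TensorProduct.tmul_mul_tmul,
    one_mul, mul_one]

instance : SMulCommClass R Rᵐᵒᵖ X where
  smul_comm r s x := by
    rw [← bimodCat_tmul_smul, bimodCat_smul_def, bimodCat_op_smul_def, ← mul_smul,
      Algebra.TensorProduct.tmul_mul_tmul, one_mul, mul_one]

instance : IsScalarTower k R X where
  smul_assoc c r x := by
    rw [bimodCat_smul_def, bimodCat_smul_def, ← TensorProduct.smul_tmul', smul_assoc]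

instance : IsScalarTower k Rᵐᵒᵖ X where
  smul_assoc c r x := by
    rw [bimodCat_op_smul_def, bimodCat_op_smul_def, TensorProduct.tmul_smul, smul_assoc]

theorem bimodCat_map_smul (f : X ⟶ Y) (r : R) (x : X) : f (r • x) = r • f x :=
  map_smul f.hom _ x

theorem bimodCat_map_op_smul (f : X ⟶ Y) (r : Rᵐᵒᵖ) (x : X) : f (r • x) = r • f x :=
  map_smul f.hom _ x

/-- The morphism given by a `k`-linear map that commutes with both actions. -/
def bimodCatHom (f : X →ₗ[k] Y) (hl : ∀ (r : R) (x : X), f (r • x) = r • f x)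
    (hr : ∀ (r : Rᵐᵒᵖ) (x : X), f (r • x) = r • f x) : X ⟶ Y :=
  ModuleCat.ofHom
    { toFun := f
      map_add' := map_add f
      map_smul' := fun e x => by
        induction e using TensorProduct.induction_on with
        | zero =>
          exact (congrArg f (zero_smul (R ⊗[k] Rᵐᵒᵖ) x)).trans
            ((map_zero f).trans (zero_smul (R ⊗[k] Rᵐᵒᵖ) (f x)).symm)
        | tmul r s => rw [bimodCat_tmul_smul, hl, hr, RingHom.id_apply, bimodCat_tmul_smul]
        | add e e' h h' => rw [add_smul, map_add, h, h', map_add, add_smul] }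

theorem bimodCatHom_apply (f : X →ₗ[k] Y) (hl : ∀ (r : R) (x : X), f (r • x) = r • f x)
    (hr : ∀ (r : Rᵐᵒᵖ) (x : X), f (r • x) = r • f x) (x : X) : bimodCatHom f hl hr x = f x := rfl

variable {Z : Type u} [AddCommGroup Z] [Module k Z] [Module R Z] [Module Rᵐᵒᵖ Z]
  [IsScalarTower k R Z] [IsScalarTower k Rᵐᵒᵖ Z] [SMulCommClass R Rᵐᵒᵖ Z]

theorem smul_bimodIn (r : R) (z : Z) : r • bimodIn k R Z z = bimodIn k R Z (r • z) := by
  rw [bimodCat_smul_def, bimodIn_smul, one_smul]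

theorem op_smul_bimodIn (r : Rᵐᵒᵖ) (z : Z) : r • bimodIn k R Z z = bimodIn k R Z (r • z) := by
  rw [bimodCat_op_smul_def, bimodIn_smul, one_smul]

end BimodActions

section Lifting

variable (k C T : Type u) [Field k] [Ring C] [Algebra k C]
  [AddCommGroup T] [Module k T] [Module C T] [Module Cᵐᵒᵖ T]

/-- Morphisms of bimodules with source `T` lift along surjections. -/
def BimodLifting : Prop :=
  ∀ ⦃E X : Type u⦄ [AddCommGroup E] [Module k E] [Module C E] [Module Cᵐᵒᵖ E]
    [IsScalarTower k C E] [IsScalarTower k Cᵐᵒᵖ E] [SMulCommClass C Cᵐᵒᵖ E]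
    [AddCommGroup X] [Module k X] [Module C X] [Module Cᵐᵒᵖ X]
    [IsScalarTower k C X] [IsScalarTower k Cᵐᵒᵖ X] [SMulCommClass C Cᵐᵒᵖ X]
    (e : E →ₗ[k] X) (f : T →ₗ[k] X), Function.Surjective e →
    (∀ (c : C) x, e (c • x) = c • e x) → (∀ (c : Cᵐᵒᵖ) x, e (c • x) = c • e x) →
    (∀ (c : C) x, f (c • x) = c • f x) → (∀ (c : Cᵐᵒᵖ) x, f (c • x) = c • f x) →
    ∃ g : T →ₗ[k] E, (∀ (c : C) x, g (c • x) = c • g x) ∧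
      (∀ (c : Cᵐᵒᵖ) x, g (c • x) = c • g x) ∧ ∀ x, e (g x) = f x

variable {k C T}

theorem bimodLifting_of_projective [IsScalarTower k C T] [IsScalarTower k Cᵐᵒᵖ T]
    [SMulCommClass C Cᵐᵒᵖ T]
    (h : letI : Module (C ⊗[k] Cᵐᵒᵖ) T := TensorProduct.Algebra.module
      Module.Projective (C ⊗[k] Cᵐᵒᵖ) T) : BimodLifting k C T := by
  intro E X _ _ _ _ _ _ _ _ _ _ _ _ _ _ e f he hel her hfl hfr
  let : Module (C ⊗[k] Cᵐᵒᵖ) T := TensorProduct.Algebra.module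
  let : Module (C ⊗[k] Cᵐᵒᵖ) E := TensorProduct.Algebra.module
  let : Module (C ⊗[k] Cᵐᵒᵖ) X := TensorProduct.Algebra.module
  obtain ⟨g, hg⟩ := Module.projective_lifting_property (tensorAlgebraHom e hel her)
    (tensorAlgebraHom f hfl hfr) he
  have hc (c : k) (x : T) : c • x = (algebraMap k (C ⊗[k] Cᵐᵒᵖ) c) • x := by
    rw [Algebra.TensorProduct.algebraMap_apply, TensorProduct.Algebra.smul_def, one_smul,
      algebraMap_smul]
  have hc' (c : k) (x : E) : c • x = (algebraMap k (C ⊗[k] Cᵐᵒᵖ) c) • x := by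
    rw [Algebra.TensorProduct.algebraMap_apply, TensorProduct.Algebra.smul_def, one_smul,
      algebraMap_smul]
  have hl (c : C) (x : T) : c • x = (c ⊗ₜ[k] 1 : C ⊗[k] Cᵐᵒᵖ) • x := by
    rw [TensorProduct.Algebra.smul_def, one_smul]
  have hl' (c : C) (x : E) : c • x = (c ⊗ₜ[k] 1 : C ⊗[k] Cᵐᵒᵖ) • x := by
    rw [TensorProduct.Algebra.smul_def, one_smul]
  have hr (c : Cᵐᵒᵖ) (x : T) : c • x = (1 ⊗ₜ[k] c : C ⊗[k] Cᵐᵒᵖ) • x := by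
    rw [TensorProduct.Algebra.smul_def, one_smul]
  have hr' (c : Cᵐᵒᵖ) (x : E) : c • x = (1 ⊗ₜ[k] c : C ⊗[k] Cᵐᵒᵖ) • x := by
    rw [TensorProduct.Algebra.smul_def, one_smul]
  refine ⟨{ toFun := g, map_add' := map_add g, map_smul' := fun c x => ?_ }, fun c x => ?_,
    fun c x => ?_, fun x => LinearMap.congr_fun hg x⟩
  · rw [hc, map_smul, RingHom.id_apply, hc']
  · change g _ = c • g x
    rw [hl, map_smul, hl']
  · change g _ = c • g x
    rw [hr, map_smul, hr']

end Lifting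

section LeftHom

variable (C J E : Type u) [Ring C] [AddCommGroup J] [Module C J] [Module Cᵐᵒᵖ J]
  [AddCommGroup E] [Module C E]

/-- The left linear maps from a bimodule `J` to `E`. -/
def LeftHom : Type u := J →ₗ[C] E

instance : AddCommGroup (LeftHom C J E) := inferInstanceAs (AddCommGroup (J →ₗ[C] E))

instance : FunLike (LeftHom C J E) J E := inferInstanceAs (FunLike (J →ₗ[C] E) J E)

instance : AddMonoidHomClass (LeftHom C J E) J E :=
  inferInstanceAs (AddMonoidHomClass (J →ₗ[C] E) J E)

variable {C J E}

theorem LeftHom.ext {f g : LeftHom C J E} (h : ∀ j, f j = g j) : f = g := LinearMap.ext h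

theorem LeftHom.add_apply (f g : LeftHom C J E) (j : J) : (f + g) j = f j + g j := rfl

theorem LeftHom.map_smul (f : LeftHom C J E) (c : C) (j : J) : f (c • j) = c • f j :=
  LinearMap.map_smul (show J →ₗ[C] E from f) c j

variable [SMulCommClass C Cᵐᵒᵖ J]

instance : Module C (LeftHom C J E) where
  smul c f :=
    { toFun := fun j => f (op c • j)
      map_add' := fun x y => by rw [smul_add, map_add]
      map_smul' := fun d x => by rw [← smul_comm, LeftHom.map_smul, RingHom.id_apply] }
  one_smul f := LeftHom.ext fun j => congrArg f (one_smul Cᵐᵒᵖ j)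
  mul_smul c d f := LeftHom.ext fun j => congrArg f (mul_smul (op d) (op c) j)
  smul_zero c := rfl
  smul_add c f g := rfl
  add_smul c d f := LeftHom.ext fun j =>
    (congrArg f (add_smul (op c) (op d) j)).trans (map_add f _ _)
  zero_smul f := LeftHom.ext fun j => (congrArg f (zero_smul Cᵐᵒᵖ j)).trans (map_zero f)

theorem LeftHom.smul_apply (c : C) (f : LeftHom C J E) (j : J) : (c • f) j = f (op c • j) := rfl

variable [Module Cᵐᵒᵖ E] [SMulCommClass C Cᵐᵒᵖ E]

instance : Module Cᵐᵒᵖ (LeftHom C J E) := inferInstanceAs (Module Cᵐᵒᵖ (J →ₗ[C] E))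

theorem LeftHom.op_smul_apply (c : Cᵐᵒᵖ) (f : LeftHom C J E) (j : J) : (c • f) j = c • f j := rfl

instance : SMulCommClass C Cᵐᵒᵖ (LeftHom C J E) where
  smul_comm _ _ _ := rfl

variable {k : Type u} [Field k] [Algebra k C] [Module k J] [IsScalarTower k C J]
  [IsScalarTower k Cᵐᵒᵖ J] [Module k E] [IsScalarTower k C E] [IsScalarTower k Cᵐᵒᵖ E]

theorem LeftHom.map_field_smul (f : LeftHom C J E) (c : k) (j : J) : f (c • j) = c • f j := by
  rw [← algebraMap_smul C c j, LeftHom.map_smul, algebraMap_smul]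

instance : Module k (LeftHom C J E) :=
  letI : SMulCommClass C k E := IsScalarTower.to_smulCommClass'
  inferInstanceAs (Module k (J →ₗ[C] E))

theorem LeftHom.field_smul_apply (c : k) (f : LeftHom C J E) (j : J) : (c • f) j = c • f j := rfl

instance : IsScalarTower k C (LeftHom C J E) where
  smul_assoc c d f := LeftHom.ext fun j => by
    rw [LeftHom.smul_apply, LeftHom.field_smul_apply, LeftHom.smul_apply, op_smul, smul_assoc,
      LeftHom.map_field_smul]

instance : IsScalarTower k Cᵐᵒᵖ (LeftHom C J E) where
  smul_assoc c d f := LeftHom.ext fun j => smul_assoc c d (f j)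

variable {X : Type u} [AddCommGroup X] [Module C X] [Module Cᵐᵒᵖ X] [SMulCommClass C Cᵐᵒᵖ X]
  [Module k X] [IsScalarTower k C X] [IsScalarTower k Cᵐᵒᵖ X]

/-- Composition with a left linear map. -/
def LeftHom.postcomp (e : E →ₗ[k] X) (he : ∀ (c : C) x, e (c • x) = c • e x) :
    LeftHom C J E →ₗ[k] LeftHom C J X where
  toFun f :=
    { toFun := fun j => e (f j)
      map_add' := fun x y => by rw [_root_.map_add, _root_.map_add]
      map_smul' := fun c x => by rw [LeftHom.map_smul, he, RingHom.id_apply] }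
  map_add' f g := LeftHom.ext fun j => map_add e (f j) (g j)
  map_smul' c f := LeftHom.ext fun j => _root_.map_smul e c (f j)

theorem LeftHom.postcomp_apply (e : E →ₗ[k] X) (he : ∀ (c : C) x, e (c • x) = c • e x)
    (f : LeftHom C J E) (j : J) : LeftHom.postcomp e he f j = e (f j) := rfl

theorem LeftHom.postcomp_surjective [Module.Projective C J] (e : E →ₗ[k] X)
    (he : ∀ (c : C) x, e (c • x) = c • e x) (h : Function.Surjective e) :
    Function.Surjective (LeftHom.postcomp (J := J) e he) := fun f => by
  let e' : E →ₗ[C] X := { toFun := e, map_add' := map_add e, map_smul' := he }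
  obtain ⟨g, hg⟩ := Module.projective_lifting_property e' (show J →ₗ[C] X from f) h
  exact ⟨g, LeftHom.ext fun j => LinearMap.congr_fun hg j⟩

/-- The adjoint of a left linear map on `J ⊗_C J^{⊗ m + 1}`. -/
def LeftHom.curry {m : ℕ} (f : TensorPow k C J (m + 1) →ₗ[k] E)
    (hf : ∀ (c : C) x, f (c • x) = c • f x) : TensorPow k C J m →ₗ[k] LeftHom C J E where
  toFun t :=
    { toFun := fun j => f (TensorPow.cons j t)
      map_add' := fun x y => by rw [map_add, LinearMap.add_apply, map_add]
      map_smul' := fun c x => by rw [← TensorPow.smul_cons, hf, RingHom.id_apply] }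
  map_add' s t := LeftHom.ext fun j =>
    (congrArg f (map_add (TensorPow.cons j) s t)).trans (map_add f _ _)
  map_smul' c t := LeftHom.ext fun j =>
    (congrArg f (_root_.map_smul (TensorPow.cons j) c t)).trans (_root_.map_smul f c _)

theorem LeftHom.curry_apply {m : ℕ} (f : TensorPow k C J (m + 1) →ₗ[k] E)
    (hf : ∀ (c : C) x, f (c • x) = c • f x) (t : TensorPow k C J m) (j : J) :
    LeftHom.curry f hf t j = f (TensorPow.cons j t) := rfl

theorem LeftHom.map_add_of {m : ℕ} (g : TensorPow k C J m →ₗ[k] LeftHom C J E) (j : J)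
    (s t : TensorPow k C J m) : g (s + t) j = g s j + g t j :=
  (congrArg (fun f => f j) (map_add g s t)).trans (LeftHom.add_apply _ _ _)

/-- The bilinear map of a linear map to `LeftHom`. -/
def LeftHom.flipLin {m : ℕ} (g : TensorPow k C J m →ₗ[k] LeftHom C J E) :
    J →ₗ[k] TensorPow k C J m →ₗ[k] E where
  toFun j :=
    { toFun := fun t => g t j
      map_add' := LeftHom.map_add_of g j
      map_smul' := fun c t => congrArg (fun f => f j) (_root_.map_smul g c t) }
  map_add' x y := LinearMap.ext fun t => map_add (g t) x y
  map_smul' c x := LinearMap.ext fun t => LeftHom.map_field_smul (g t) c x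

theorem LeftHom.flipLin_apply {m : ℕ} (g : TensorPow k C J m →ₗ[k] LeftHom C J E) (j : J)
    (t : TensorPow k C J m) : LeftHom.flipLin g j t = g t j := rfl

theorem LeftHom.flipLin_balanced {m : ℕ} (g : TensorPow k C J m →ₗ[k] LeftHom C J E)
    (hg : ∀ (c : C) x, g (c • x) = c • g x) (c : C) (j : J) (t : TensorPow k C J m) :
    LeftHom.flipLin g (op c • j) t = LeftHom.flipLin g j (c • t) := by
  rw [LeftHom.flipLin_apply, LeftHom.flipLin_apply, hg, LeftHom.smul_apply]

/-- The left linear map on `J ⊗_C J^{⊗ m + 1}` with a given adjoint. -/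
def LeftHom.uncurry {m : ℕ} (g : TensorPow k C J m →ₗ[k] LeftHom C J E)
    (hg : ∀ (c : C) x, g (c • x) = c • g x) : TensorPow k C J (m + 1) →ₗ[k] E :=
  TensorPow.consLift (LeftHom.flipLin g) (LeftHom.flipLin_balanced g hg)

theorem LeftHom.uncurry_cons {m : ℕ} (g : TensorPow k C J m →ₗ[k] LeftHom C J E)
    (hg : ∀ (c : C) x, g (c • x) = c • g x) (j : J) (t : TensorPow k C J m) :
    LeftHom.uncurry g hg (TensorPow.cons j t) = g t j :=
  TensorPow.consLift_cons _ (LeftHom.flipLin_balanced g hg) j t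

end LeftHom

theorem TensorPow.cons_induction {k C J : Type u} [Field k] [Ring C] [Algebra k C]
    [AddCommGroup J] [Module k J] [Module C J] [Module Cᵐᵒᵖ J] {m : ℕ} {V : Type u}
    [AddCommGroup V] [Module k V] {f g : TensorPow k C J (m + 1) →ₗ[k] V}
    (h : ∀ x t, f (cons x t) = g (cons x t)) (z : TensorPow k C J (m + 1)) : f z = g z :=
  LinearMap.congr_fun (cons_ext h) z

theorem TensorPow.bimodLifting {k C J : Type u} [Field k] [Ring C] [Algebra k C]
    [AddCommGroup J] [Module k J] [Module C J] [Module Cᵐᵒᵖ J] [IsScalarTower k C J]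
    [IsScalarTower k Cᵐᵒᵖ J] [SMulCommClass C Cᵐᵒᵖ J] [Module.Projective C J]
    (hJ : BimodLifting k C J) (m : ℕ) : BimodLifting k C (TensorPow k C J m) := by
  induction m with
  | zero =>
    intro E X _ _ _ _ _ _ _ _ _ _ _ _ _ _ e f he hel her hfl hfr
    obtain ⟨g, hgl, hgr, hg⟩ := hJ e (f ∘ₗ (single k C J).toLinearMap) he hel her
      (fun c x => by
        rw [LinearMap.comp_apply, LinearEquiv.coe_coe, ← smul_single, hfl]; rfl)
      (fun c x => by
        rw [LinearMap.comp_apply, LinearEquiv.coe_coe, ← op_smul_single, hfr]; rfl)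
    refine ⟨g ∘ₗ (single k C J).symm.toLinearMap, fun c x => ?_, fun c x => ?_, fun x => ?_⟩
    · obtain ⟨x, rfl⟩ := (single k C J).surjective x
      rw [LinearMap.comp_apply, LinearMap.comp_apply, LinearEquiv.coe_coe, smul_single,
        LinearEquiv.symm_apply_apply, LinearEquiv.symm_apply_apply, hgl]
    · obtain ⟨x, rfl⟩ := (single k C J).surjective x
      rw [LinearMap.comp_apply, LinearMap.comp_apply, LinearEquiv.coe_coe, op_smul_single,
        LinearEquiv.symm_apply_apply, LinearEquiv.symm_apply_apply, hgr]
    · obtain ⟨x, rfl⟩ := (single k C J).surjective x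
      rw [LinearMap.comp_apply, LinearEquiv.coe_coe, LinearEquiv.symm_apply_apply, hg]
      rfl
  | succ m ih =>
    intro E X _ _ _ _ _ _ _ _ _ _ _ _ _ _ e f he hel her hfl hfr
    obtain ⟨g, hgl, hgr, hg⟩ := ih (LeftHom.postcomp (J := J) e hel) (LeftHom.curry f hfl)
      (LeftHom.postcomp_surjective e hel he) (fun c x => rfl)
      (fun c x => LeftHom.ext fun j => her c (x j))
      (fun c t => LeftHom.ext fun j => by
        rw [LeftHom.curry_apply, LeftHom.smul_apply, LeftHom.curry_apply, cons_op_smul])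
      (fun c t => LeftHom.ext fun j => by
        rw [LeftHom.curry_apply, LeftHom.op_smul_apply, LeftHom.curry_apply, ← op_smul_cons, hfr])
    refine ⟨LeftHom.uncurry g hgl, fun c x => ?_, fun c x => ?_, fun x => ?_⟩
    · exact cons_induction (f := LeftHom.uncurry g hgl ∘ₗ Algebra.lsmul k k _ c)
        (g := Algebra.lsmul k k _ c ∘ₗ LeftHom.uncurry g hgl) (fun j t => by
          change LeftHom.uncurry g hgl (c • cons j t) = c • LeftHom.uncurry g hgl (cons j t)
          rw [smul_cons, LeftHom.uncurry_cons, LeftHom.uncurry_cons, LeftHom.map_smul]) x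
    · exact cons_induction (f := LeftHom.uncurry g hgl ∘ₗ Algebra.lsmul k k _ c)
        (g := Algebra.lsmul k k _ c ∘ₗ LeftHom.uncurry g hgl) (fun j t => by
          change LeftHom.uncurry g hgl (c • cons j t) = c • LeftHom.uncurry g hgl (cons j t)
          rw [op_smul_cons, LeftHom.uncurry_cons, LeftHom.uncurry_cons, hgr,
            LeftHom.op_smul_apply]) x
    · exact cons_induction (f := e ∘ₗ LeftHom.uncurry g hgl) (g := f) (fun j t => by
        rw [LinearMap.comp_apply, LeftHom.uncurry_cons, ← LeftHom.postcomp_apply e hel, hg,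
          LeftHom.curry_apply]) x

section NullExtension

variable (k C J L : Type u) [Field k] [Ring C] [Algebra k C] [Ring L] [Algebra k L]
  [AddCommGroup J] [Module k J] [Module C J] [Module Cᵐᵒᵖ J]

/-- The structure on `L` of a trivial extension of `C` by a square zero ideal `J`. -/
structure NullExt where
  /-- The projection to `C`. -/
  proj : L →ₐ[k] C
  /-- The projection to `J`. -/
  tail : L →ₗ[k] J
  /-- The inclusion of `C`. -/
  incl : C →ₐ[k] L
  /-- The inclusion of `J`. -/
  emb : J →ₗ[k] L
  proj_incl : ∀ c, proj (incl c) = c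
  tail_incl : ∀ c, tail (incl c) = 0
  proj_emb : ∀ j, proj (emb j) = 0
  tail_emb : ∀ j, tail (emb j) = j
  decomp : ∀ x, incl (proj x) + emb (tail x) = x
  tail_mul : ∀ x y, tail (x * y) = proj x • tail y + op (proj y) • tail x

variable {k C J L} (D : NullExt k C J L)

namespace NullExt

theorem ext_of {x y : L} (h : D.proj x = D.proj y) (h' : D.tail x = D.tail y) : x = y := by
  rw [← D.decomp x, h, h', D.decomp]

theorem emb_smul (c : C) (j : J) : D.emb (c • j) = D.incl c * D.emb j := by
  refine D.ext_of ?_ ?_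
  · rw [map_mul, D.proj_emb, D.proj_emb, mul_zero]
  · rw [D.tail_mul, D.tail_emb, D.tail_emb, D.tail_incl, D.proj_incl, smul_zero, add_zero]

theorem emb_op_smul (c : C) (j : J) : D.emb (op c • j) = D.emb j * D.incl c := by
  refine D.ext_of ?_ ?_
  · rw [map_mul, D.proj_emb, D.proj_emb, zero_mul]
  · rw [D.tail_mul, D.tail_emb, D.tail_emb, D.tail_incl, D.proj_incl, smul_zero, zero_add]

theorem emb_mul_emb (j j' : J) : D.emb j * D.emb j' = 0 := by
  refine D.ext_of ?_ ?_
  · rw [map_mul, D.proj_emb, zero_mul, map_zero]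
  · rw [D.tail_mul, D.proj_emb, D.proj_emb, zero_smul, op_zero, zero_smul, add_zero, map_zero]

end NullExt

variable (k C J) in
/-- Commuting left and right actions of square zero of `J` on a `C`-bimodule `Z`. -/
structure NullAct (Z : Type u) [AddCommGroup Z] [Module k Z] [Module C Z] [Module Cᵐᵒᵖ Z] where
  /-- The left action. -/
  l : J →ₗ[k] Z →ₗ[k] Z
  /-- The right action. -/
  r : J →ₗ[k] Z →ₗ[k] Z
  l_smul : ∀ (c : C) j z, l (c • j) z = c • l j z
  l_op_smul : ∀ (c : C) j z, l (op c • j) z = l j (c • z)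
  l_right : ∀ (c : Cᵐᵒᵖ) j z, l j (c • z) = c • l j z
  l_l : ∀ j j' z, l j (l j' z) = 0
  r_op_smul : ∀ (c : Cᵐᵒᵖ) j z, r (c • j) z = c • r j z
  r_smul : ∀ (c : C) j z, r (c • j) z = r j (op c • z)
  r_left : ∀ (c : C) j z, r j (c • z) = c • r j z
  r_r : ∀ j j' z, r j (r j' z) = 0
  l_r : ∀ j j' z, l j (r j' z) = r j' (l j z)

namespace NullAct

variable {Z : Type u} [AddCommGroup Z] [Module k Z] [Module C Z] [Module Cᵐᵒᵖ Z]
  [SMulCommClass C Cᵐᵒᵖ Z] [IsScalarTower k C Z] [IsScalarTower k Cᵐᵒᵖ Z]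
  (α : NullAct k C J Z)

/-- The bimodule over the trivial extension defined by the actions of `J`. -/
@[nolint unusedArguments]
def Mod (_D : NullExt k C J L) (_α : NullAct k C J Z) : Type u := Z

instance : AddCommGroup (α.Mod D) := inferInstanceAs (AddCommGroup Z)

instance : Module k (α.Mod D) := inferInstanceAs (Module k Z)

/-- The identity map. -/
def toMod : Z ≃ₗ[k] α.Mod D := LinearEquiv.refl k Z

instance : Module L (α.Mod D) where
  smul x z := α.toMod D (D.proj x • (α.toMod D).symm z + α.l (D.tail x) ((α.toMod D).symm z))
  one_smul z := by
    change D.proj 1 • (show Z from z) + α.l (D.tail 1) (show Z from z) = z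
    rw [map_one, ← map_one D.incl, D.tail_incl, one_smul, map_zero, LinearMap.zero_apply, add_zero]
  mul_smul x y z := by
    change D.proj (x * y) • (show Z from z) + α.l (D.tail (x * y)) (show Z from z)
      = D.proj x • (D.proj y • (show Z from z) + α.l (D.tail y) (show Z from z))
        + α.l (D.tail x) (D.proj y • (show Z from z) + α.l (D.tail y) (show Z from z))
    rw [map_mul, D.tail_mul, map_add, LinearMap.add_apply, α.l_smul, α.l_op_smul, map_add, α.l_l,
      add_zero, smul_add, mul_smul, add_assoc]
  smul_zero x := by
    change D.proj x • (0 : Z) + α.l (D.tail x) (0 : Z) = 0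
    rw [smul_zero, map_zero, add_zero]
  smul_add x y z := by
    change D.proj x • ((show Z from y) + (show Z from z))
      + α.l (D.tail x) ((show Z from y) + (show Z from z))
      = D.proj x • (show Z from y) + α.l (D.tail x) (show Z from y)
        + (D.proj x • (show Z from z) + α.l (D.tail x) (show Z from z))
    rw [smul_add, map_add, add_add_add_comm]
  add_smul x y z := by
    change D.proj (x + y) • (show Z from z) + α.l (D.tail (x + y)) (show Z from z)
      = D.proj x • (show Z from z) + α.l (D.tail x) (show Z from z)
        + (D.proj y • (show Z from z) + α.l (D.tail y) (show Z from z))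
    rw [map_add, map_add, map_add, add_smul, LinearMap.add_apply, add_add_add_comm]
  zero_smul z := by
    change D.proj 0 • (show Z from z) + α.l (D.tail 0) (show Z from z) = 0
    rw [map_zero, map_zero, map_zero, zero_smul, LinearMap.zero_apply, add_zero]

instance : Module Lᵐᵒᵖ (α.Mod D) where
  smul x z := α.toMod D (op (D.proj x.unop) • (α.toMod D).symm z
    + α.r (D.tail x.unop) ((α.toMod D).symm z))
  one_smul z := by
    change op (D.proj 1) • (show Z from z) + α.r (D.tail 1) (show Z from z) = z
    rw [map_one, ← map_one D.incl, D.tail_incl, op_one, one_smul, map_zero, LinearMap.zero_apply,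
      add_zero]
  mul_smul x y z := by
    change op (D.proj (y.unop * x.unop)) • (show Z from z)
        + α.r (D.tail (y.unop * x.unop)) (show Z from z)
      = op (D.proj x.unop) • (op (D.proj y.unop) • (show Z from z)
          + α.r (D.tail y.unop) (show Z from z))
        + α.r (D.tail x.unop) (op (D.proj y.unop) • (show Z from z)
          + α.r (D.tail y.unop) (show Z from z))
    rw [map_mul, D.tail_mul, map_add, LinearMap.add_apply, α.r_smul, α.r_op_smul, map_add, α.r_r,
      add_zero, smul_add, op_mul, mul_smul, add_assoc, add_comm (α.r (D.tail x.unop) _)]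
  smul_zero x := by
    change op (D.proj x.unop) • (0 : Z) + α.r (D.tail x.unop) (0 : Z) = 0
    rw [smul_zero, map_zero, add_zero]
  smul_add x y z := by
    change op (D.proj x.unop) • ((show Z from y) + (show Z from z))
      + α.r (D.tail x.unop) ((show Z from y) + (show Z from z))
      = op (D.proj x.unop) • (show Z from y) + α.r (D.tail x.unop) (show Z from y)
        + (op (D.proj x.unop) • (show Z from z) + α.r (D.tail x.unop) (show Z from z))
    rw [smul_add, map_add, add_add_add_comm]
  add_smul x y z := by
    change op (D.proj (x.unop + y.unop)) • (show Z from z)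
        + α.r (D.tail (x.unop + y.unop)) (show Z from z)
      = op (D.proj x.unop) • (show Z from z) + α.r (D.tail x.unop) (show Z from z)
        + (op (D.proj y.unop) • (show Z from z) + α.r (D.tail y.unop) (show Z from z))
    rw [map_add, map_add, map_add, MulOpposite.op_add, add_smul, LinearMap.add_apply,
      add_add_add_comm]
  zero_smul z := by
    change op (D.proj 0) • (show Z from z) + α.r (D.tail 0) (show Z from z) = 0
    rw [map_zero, map_zero, map_zero, op_zero, zero_smul, LinearMap.zero_apply, add_zero]

theorem smul_toMod (x : L) (z : Z) :
    x • α.toMod D z = α.toMod D (D.proj x • z + α.l (D.tail x) z) := rfl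

theorem op_smul_toMod (x : Lᵐᵒᵖ) (z : Z) :
    x • α.toMod D z = α.toMod D (op (D.proj x.unop) • z + α.r (D.tail x.unop) z) := rfl

instance : SMulCommClass L Lᵐᵒᵖ (α.Mod D) where
  smul_comm x y z := by
    obtain ⟨z, rfl⟩ := (α.toMod D).surjective z
    rw [smul_toMod, op_smul_toMod, op_smul_toMod, smul_toMod]
    congr 1
    rw [smul_add, smul_add, map_add, map_add, α.l_r, α.l_right, α.r_left,
      smul_comm (D.proj x) (op (D.proj y.unop)) z]
    abel

instance : IsScalarTower k L (α.Mod D) where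
  smul_assoc c x z := by
    obtain ⟨z, rfl⟩ := (α.toMod D).surjective z
    rw [smul_toMod, smul_toMod, ← map_smul (α.toMod D), map_smul, map_smul, map_smul, smul_assoc,
      smul_add, LinearMap.smul_apply]

instance : IsScalarTower k Lᵐᵒᵖ (α.Mod D) where
  smul_assoc c x z := by
    obtain ⟨z, rfl⟩ := (α.toMod D).surjective z
    rw [op_smul_toMod, op_smul_toMod, ← map_smul (α.toMod D), unop_smul, map_smul, map_smul,
      map_smul, op_smul, smul_assoc, smul_add, LinearMap.smul_apply]

/-- The object of `BimodCat` defined by the actions of `J`. -/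
abbrev bimod : BimodCat k L := NullSquareHH.bimod k L (α.Mod D)

/-- The identity map. -/
def cls : Z ≃ₗ[k] α.bimod D := (α.toMod D).trans (bimodIn k L (α.Mod D))

theorem smul_cls (x : L) (z : Z) :
    x • α.cls D z = α.cls D (D.proj x • z + α.l (D.tail x) z) := by
  rw [cls, LinearEquiv.trans_apply, smul_bimodIn, smul_toMod]
  rfl

theorem op_smul_cls (x : Lᵐᵒᵖ) (z : Z) :
    x • α.cls D z = α.cls D (op (D.proj x.unop) • z + α.r (D.tail x.unop) z) := by
  rw [cls, LinearEquiv.trans_apply, op_smul_bimodIn, op_smul_toMod]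
  rfl

theorem incl_smul_cls (c : C) (z : Z) : D.incl c • α.cls D z = α.cls D (c • z) := by
  rw [smul_cls, D.proj_incl, D.tail_incl, map_zero, LinearMap.zero_apply, add_zero]

theorem op_incl_smul_cls (c : C) (z : Z) : op (D.incl c) • α.cls D z = α.cls D (op c • z) := by
  rw [op_smul_cls, unop_op, D.proj_incl, D.tail_incl, map_zero, LinearMap.zero_apply, add_zero]

theorem emb_smul_cls (j : J) (z : Z) : D.emb j • α.cls D z = α.cls D (α.l j z) := by
  rw [smul_cls, D.proj_emb, D.tail_emb, zero_smul, zero_add]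

theorem op_emb_smul_cls (j : J) (z : Z) : op (D.emb j) • α.cls D z = α.cls D (α.r j z) := by
  rw [op_smul_cls, unop_op, D.proj_emb, D.tail_emb, op_zero, zero_smul, zero_add]

variable {α}

/-- The morphism given by a linear map that commutes with the actions of `C` and `J`. -/
def homOf {X : BimodCat k L} (f : Z →ₗ[k] X)
    (hl : ∀ (c : C) z, f (c • z) = D.incl c • f z)
    (hr : ∀ (c : C) z, f (op c • z) = op (D.incl c) • f z)
    (hjl : ∀ (j : J) z, f (α.l j z) = D.emb j • f z)
    (hjr : ∀ (j : J) z, f (α.r j z) = op (D.emb j) • f z) : α.bimod D ⟶ X :=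
  bimodCatHom (f ∘ₗ (α.cls D).symm.toLinearMap)
    (fun x z => by
      obtain ⟨z, rfl⟩ := (α.cls D).surjective z
      rw [smul_cls, LinearMap.comp_apply, LinearMap.comp_apply, LinearEquiv.coe_coe,
        LinearEquiv.symm_apply_apply, LinearEquiv.symm_apply_apply, map_add, hl, hjl, ← add_smul,
        D.decomp])
    (fun x z => by
      obtain ⟨z, rfl⟩ := (α.cls D).surjective z
      rw [op_smul_cls, LinearMap.comp_apply, LinearMap.comp_apply, LinearEquiv.coe_coe,
        LinearEquiv.symm_apply_apply, LinearEquiv.symm_apply_apply, map_add, hr, hjr, ← add_smul,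
        ← MulOpposite.op_add, D.decomp, op_unop])

theorem homOf_cls {X : BimodCat k L} (f : Z →ₗ[k] X)
    (hl : ∀ (c : C) z, f (c • z) = D.incl c • f z)
    (hr : ∀ (c : C) z, f (op c • z) = op (D.incl c) • f z)
    (hjl : ∀ (j : J) z, f (α.l j z) = D.emb j • f z)
    (hjr : ∀ (j : J) z, f (α.r j z) = op (D.emb j) • f z) (z : Z) :
    homOf D f hl hr hjl hjr (α.cls D z) = f z := by
  refine (bimodCatHom_apply _ _ _ _).trans ?_
  rw [LinearMap.comp_apply, LinearEquiv.coe_coe, LinearEquiv.symm_apply_apply]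

end NullAct

/-! ### The bimodules `T_n × T_{n+1}` and their projective covers -/

variable [IsScalarTower k C J] [IsScalarTower k Cᵐᵒᵖ J] [SMulCommClass C Cᵐᵒᵖ J]

open TensorPow

variable (k C J) in
/-- The action of `J` on `T_n ⊕ T_{n+1}`, where `T_n` is a tensor power of `J`, by left
multiplication and by `ε` times right multiplication. -/
def kosAct (ε : k) (n : ℕ) : NullAct k C J (TensorPow k C J n × TensorPow k C J (n + 1)) where
  l := LinearMap.mk₂ k (fun j x => (0, cons j x.1)) (by simp) (by simp) (by simp) (by simp)
  r := LinearMap.mk₂ k (fun j x => (0, ε • snoc x.1 j)) (by simp) (by simp [smul_comm ε])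
    (by simp) (by simp [smul_comm ε])
  l_smul c j x := by simp [smul_cons]
  l_op_smul c j x := by simp [cons_op_smul]
  l_right c j x := by simp [op_smul_cons]
  l_l j j' x := by simp
  r_op_smul c j x := Prod.ext (smul_zero c).symm
    ((congrArg (ε • ·) (op_smul_snoc c j x.1).symm).trans (smul_comm ε c _))
  r_smul c j x := by simp [snoc_smul]
  r_left c j x := Prod.ext (smul_zero c).symm
    ((congrArg (ε • ·) (smul_snoc c j x.1).symm).trans (smul_comm ε c _))
  r_r j j' x := by simp
  l_r j j' x := by simp

theorem kosAct_l (ε : k) (n : ℕ) (j : J) (x : TensorPow k C J n) (y : TensorPow k C J (n + 1)) :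
    (kosAct k C J ε n).l j (x, y) = (0, cons j x) := rfl

theorem kosAct_r (ε : k) (n : ℕ) (j : J) (x : TensorPow k C J n) (y : TensorPow k C J (n + 1)) :
    (kosAct k C J ε n).r j (x, y) = (0, ε • snoc x j) := rfl

variable (k C J) in
/-- The action of `J` on the bimodule `Λ ⊗_C T_n ⊗_C Λ`. -/
def freeAct (n : ℕ) : NullAct k C J (TensorPow k C J n × TensorPow k C J (n + 1) ×
    TensorPow k C J (n + 1) × TensorPow k C J (n + 2)) where
  l := LinearMap.mk₂ k (fun j x => (0, cons j x.1, 0, cons j x.2.2.1))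
    (by simp) (by simp) (by simp) (by simp)
  r := LinearMap.mk₂ k (fun j x => (0, 0, snoc x.1 j, snoc x.2.1 j)) (by simp) (by simp)
    (by simp) (by simp)
  l_smul c j x := by simp [smul_cons]
  l_op_smul c j x := by simp [cons_op_smul]
  l_right c j x := by simp [op_smul_cons]
  l_l j j' x := by simp
  r_op_smul c j x := by simp [op_smul_snoc]
  r_smul c j x := by simp [snoc_smul]
  r_left c j x := by simp [smul_snoc]
  r_r j j' x := by simp
  l_r j j' x := by simp [cons_snoc]

theorem freeAct_l (n : ℕ) (j : J) (x : TensorPow k C J n) (p q : TensorPow k C J (n + 1))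
    (r : TensorPow k C J (n + 2)) :
    (freeAct k C J n).l j (x, p, q, r) = (0, cons j x, 0, cons j q) := rfl

theorem freeAct_r (n : ℕ) (j : J) (x : TensorPow k C J n) (p q : TensorPow k C J (n + 1))
    (r : TensorPow k C J (n + 2)) :
    (freeAct k C J n).r j (x, p, q, r) = (0, 0, snoc x j, snoc p j) := rfl

end NullExtension

section

open TensorPow

section NullExtension

variable {k C J L : Type u} [Field k] [Ring C] [Algebra k C] [Ring L] [Algebra k L]
  [AddCommGroup J] [Module k J] [Module C J] [Module Cᵐᵒᵖ J] (D : NullExt k C J L)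

/-- The restriction of a bimodule over the trivial extension to `C`. -/
@[nolint unusedArguments]
def NullExt.Res (_D : NullExt k C J L) (X : BimodCat k L) : Type u := X

namespace NullExt

instance (X : BimodCat k L) : AddCommGroup (D.Res X) := inferInstanceAs (AddCommGroup X)

instance (X : BimodCat k L) : Module k (D.Res X) := inferInstanceAs (Module k X)

instance (X : BimodCat k L) : Module C (D.Res X) :=
  letI : Module C X := Module.compHom X (D.incl : C →ₐ[k] L).toRingHom
  inferInstanceAs (Module C X)

instance (X : BimodCat k L) : Module Cᵐᵒᵖ (D.Res X) :=
  letI : Module Cᵐᵒᵖ X := Module.compHom X (RingHom.op (D.incl : C →ₐ[k] L).toRingHom)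
  inferInstanceAs (Module Cᵐᵒᵖ X)

/-- The identity map. -/
def toRes (X : BimodCat k L) : X ≃ₗ[k] D.Res X := LinearEquiv.refl k X

theorem smul_toRes {X : BimodCat k L} (c : C) (x : X) :
    c • D.toRes X x = D.toRes X (D.incl c • x) := rfl

theorem op_smul_toRes {X : BimodCat k L} (c : Cᵐᵒᵖ) (x : X) :
    c • D.toRes X x = D.toRes X (op (D.incl c.unop) • x) := rfl

instance (X : BimodCat k L) : SMulCommClass C Cᵐᵒᵖ (D.Res X) where
  smul_comm c d x := by
    obtain ⟨x, rfl⟩ := (D.toRes X).surjective x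
    rw [smul_toRes, op_smul_toRes, op_smul_toRes, smul_toRes, smul_comm]

instance (X : BimodCat k L) : IsScalarTower k C (D.Res X) where
  smul_assoc c d x := by
    obtain ⟨x, rfl⟩ := (D.toRes X).surjective x
    rw [smul_toRes, smul_toRes, map_smul D.incl, smul_assoc, map_smul (D.toRes X)]

instance (X : BimodCat k L) : IsScalarTower k Cᵐᵒᵖ (D.Res X) where
  smul_assoc c d x := by
    obtain ⟨x, rfl⟩ := (D.toRes X).surjective x
    rw [op_smul_toRes, op_smul_toRes, unop_smul, map_smul D.incl, op_smul, smul_assoc,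
      map_smul (D.toRes X)]

variable [IsScalarTower k C J] [IsScalarTower k Cᵐᵒᵖ J] [SMulCommClass C Cᵐᵒᵖ J]
  {X : BimodCat k L} {n : ℕ}

/-- The bilinear map `(j, t) ↦ j g(t)`. -/
def leftExtBilin (g : TensorPow k C J n →ₗ[k] X) : J →ₗ[k] TensorPow k C J n →ₗ[k] X :=
  LinearMap.mk₂ k (fun j t => D.emb j • g t)
    (fun j j' t => by rw [map_add, add_smul]) (fun c j t => by rw [map_smul, smul_assoc])
    (fun j t t' => by rw [map_add, smul_add]) (fun c j t => by rw [map_smul, smul_comm])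

/-- The linear map `j ⊗ t ↦ j g(t)`. -/
def leftExt (g : TensorPow k C J n →ₗ[k] X) (hg : ∀ (c : C) t, g (c • t) = D.incl c • g t) :
    TensorPow k C J (n + 1) →ₗ[k] X :=
  consLift (D.leftExtBilin g) fun c j t => by
    change D.emb _ • g t = D.emb j • g _
    rw [D.emb_op_smul, hg, mul_smul]

theorem leftExt_cons (g : TensorPow k C J n →ₗ[k] X)
    (hg : ∀ (c : C) t, g (c • t) = D.incl c • g t) (j : J) (t : TensorPow k C J n) :
    D.leftExt g hg (cons j t) = D.emb j • g t := by
  rw [leftExt, consLift_cons]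
  rfl

/-- The bilinear map `(t, j) ↦ g(t) j`. -/
def rightExtBilin (g : TensorPow k C J n →ₗ[k] X) : TensorPow k C J n →ₗ[k] J →ₗ[k] X :=
  LinearMap.mk₂ k (fun t j => op (D.emb j) • g t)
    (fun t t' j => by rw [map_add, smul_add]) (fun c t j => by rw [map_smul, smul_comm])
    (fun t j j' => by rw [map_add, MulOpposite.op_add, add_smul])
    (fun c t j => by rw [map_smul, op_smul, smul_assoc])

/-- The linear map `t ⊗ j ↦ g(t) j`. -/
def rightExt (g : TensorPow k C J n →ₗ[k] X)
    (hg : ∀ (c : C) t, g (op c • t) = op (D.incl c) • g t) :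
    TensorPow k C J (n + 1) →ₗ[k] X :=
  snocLift (D.rightExtBilin g) fun c t j => by
    change op (D.emb j) • g _ = op (D.emb _) • g t
    rw [D.emb_smul, hg, op_mul, mul_smul]

theorem rightExt_snoc (g : TensorPow k C J n →ₗ[k] X)
    (hg : ∀ (c : C) t, g (op c • t) = op (D.incl c) • g t) (t : TensorPow k C J n) (j : J) :
    D.rightExt g hg (snoc t j) = op (D.emb j) • g t := by
  rw [rightExt, snocLift_snoc]
  rfl

theorem cons_ind {p : TensorPow k C J (n + 1) → X} {q : TensorPow k C J (n + 1) → X}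
    (hp : ∃ f : TensorPow k C J (n + 1) →ₗ[k] X, ∀ z, f z = p z)
    (hq : ∃ f : TensorPow k C J (n + 1) →ₗ[k] X, ∀ z, f z = q z)
    (h : ∀ j t, p (cons j t) = q (cons j t)) (z : TensorPow k C J (n + 1)) : p z = q z := by
  obtain ⟨f, hf⟩ := hp
  obtain ⟨g, hg⟩ := hq
  rw [← hf, ← hg]
  exact LinearMap.congr_fun (cons_ext fun j t => by rw [hf, hg, h]) z

theorem snoc_ind {p : TensorPow k C J (n + 1) → X} {q : TensorPow k C J (n + 1) → X}
    (hp : ∃ f : TensorPow k C J (n + 1) →ₗ[k] X, ∀ z, f z = p z)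
    (hq : ∃ f : TensorPow k C J (n + 1) →ₗ[k] X, ∀ z, f z = q z)
    (h : ∀ t j, p (snoc t j) = q (snoc t j)) (z : TensorPow k C J (n + 1)) : p z = q z := by
  obtain ⟨f, hf⟩ := hp
  obtain ⟨g, hg⟩ := hq
  rw [← hf, ← hg]
  exact LinearMap.congr_fun (snoc_ext fun j t => by rw [hf, hg, h]) z

theorem exists_comp_smul {S : Type u} [Ring S] [Algebra k S] {T : Type u} [AddCommGroup T]
    [Module k T] [Module S T] [IsScalarTower k S T] {U : Type u} [AddCommGroup U] [Module k U]
    (f : T →ₗ[k] U) (s : S) : ∃ g : T →ₗ[k] U, ∀ z, g z = f (s • z) :=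
  ⟨f ∘ₗ Algebra.lsmul k k T s, fun _ => rfl⟩

theorem exists_smul_comp {S : Type u} [Ring S] [Algebra k S] {T : Type u} [AddCommGroup T]
    [Module k T] {U : Type u} [AddCommGroup U] [Module k U] [Module S U] [IsScalarTower k S U]
    (f : T →ₗ[k] U) (s : S) : ∃ g : T →ₗ[k] U, ∀ z, g z = s • f z :=
  ⟨Algebra.lsmul k k U s ∘ₗ f, fun _ => rfl⟩

theorem exists_zero {T U : Type u} [AddCommGroup T] [Module k T] [AddCommGroup U] [Module k U] :
    ∃ g : T →ₗ[k] U, ∀ z, g z = (fun _ => 0) z := ⟨0, fun _ => rfl⟩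

section

theorem leftExt_smul (g : TensorPow k C J n →ₗ[k] X)
    (hg : ∀ (c : C) t, g (c • t) = D.incl c • g t)
    (c : C) (z : TensorPow k C J (n + 1)) :
    D.leftExt g hg (c • z) = D.incl c • D.leftExt g hg z :=
  cons_ind (exists_comp_smul _ c) (exists_smul_comp _ (D.incl c)) (fun j t => by
    rw [smul_cons, leftExt_cons, leftExt_cons, D.emb_smul, mul_smul]) z

theorem leftExt_op_smul (g : TensorPow k C J n →ₗ[k] X)
    (hg : ∀ (c : C) t, g (c • t) = D.incl c • g t)
    (hg' : ∀ (c : C) t, g (op c • t) = op (D.incl c) • g t)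
    (c : C) (z : TensorPow k C J (n + 1)) :
    D.leftExt g hg (op c • z) = op (D.incl c) • D.leftExt g hg z :=
  cons_ind (exists_comp_smul _ (op c)) (exists_smul_comp _ (op (D.incl c))) (fun j t => by
    rw [op_smul_cons, leftExt_cons, leftExt_cons, hg', smul_comm]) z

theorem emb_smul_leftExt (g : TensorPow k C J n →ₗ[k] X)
    (hg : ∀ (c : C) t, g (c • t) = D.incl c • g t)
    (j : J) (z : TensorPow k C J (n + 1)) :
    D.emb j • D.leftExt g hg z = 0 :=
  cons_ind (exists_smul_comp _ (D.emb j)) exists_zero (fun j t => by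
    rw [leftExt_cons, ← mul_smul, D.emb_mul_emb, zero_smul]) z

theorem rightExt_smul (g : TensorPow k C J n →ₗ[k] X)
    (hg : ∀ (c : C) t, g (c • t) = D.incl c • g t)
    (hg' : ∀ (c : C) t, g (op c • t) = op (D.incl c) • g t)
    (c : C) (z : TensorPow k C J (n + 1)) :
    D.rightExt g hg' (c • z) = D.incl c • D.rightExt g hg' z :=
  snoc_ind (exists_comp_smul _ c) (exists_smul_comp _ (D.incl c)) (fun j t => by
    rw [smul_snoc, rightExt_snoc, rightExt_snoc, hg]
    exact (smul_comm _ _ _).symm) z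

theorem rightExt_op_smul (g : TensorPow k C J n →ₗ[k] X)
    (hg' : ∀ (c : C) t, g (op c • t) = op (D.incl c) • g t)
    (c : C) (z : TensorPow k C J (n + 1)) :
    D.rightExt g hg' (op c • z) = op (D.incl c) • D.rightExt g hg' z :=
  snoc_ind (exists_comp_smul _ (op c)) (exists_smul_comp _ (op (D.incl c))) (fun j t => by
    rw [op_smul_snoc, rightExt_snoc, rightExt_snoc, D.emb_op_smul, op_mul, mul_smul]) z

theorem op_emb_smul_rightExt (g : TensorPow k C J n →ₗ[k] X)
    (hg' : ∀ (c : C) t, g (op c • t) = op (D.incl c) • g t)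
    (j : J) (z : TensorPow k C J (n + 1)) :
    op (D.emb j) • D.rightExt g hg' z = 0 :=
  snoc_ind (exists_smul_comp _ (op (D.emb j))) exists_zero (fun t j => by
    rw [rightExt_snoc, ← mul_smul, ← op_mul, D.emb_mul_emb, op_zero, zero_smul]) z

variable (g : TensorPow k C J n →ₗ[k] X) (hg : ∀ (c : C) t, g (c • t) = D.incl c • g t)
  (hg' : ∀ (c : C) t, g (op c • t) = op (D.incl c) • g t)

/-- The map `j ⊗ t ⊗ j' ↦ j g(t) j'`. -/
def bothExt : TensorPow k C J (n + 2) →ₗ[k] X :=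
  D.leftExt (D.rightExt g hg') (D.rightExt_smul g hg hg')

theorem bothExt_cons (j : J) (q : TensorPow k C J (n + 1)) :
    D.bothExt g hg hg' (cons j q) = D.emb j • D.rightExt g hg' q :=
  D.leftExt_cons _ _ _ _

theorem bothExt_snoc (p : TensorPow k C J (n + 1)) (j : J) :
    D.bothExt g hg hg' (snoc p j) = op (D.emb j) • D.leftExt g hg p :=
  cons_ind (p := fun p => D.bothExt g hg hg' (snoc p j))
    ⟨D.bothExt g hg hg' ∘ₗ snoc.flip j, fun _ => rfl⟩
    (exists_smul_comp _ (op (D.emb j))) (fun j' t => by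
      rw [← cons_snoc, bothExt_cons, rightExt_snoc, leftExt_cons, smul_comm]) p

theorem op_emb_smul_bothExt (j : J) (z : TensorPow k C J (n + 2)) :
    op (D.emb j) • D.bothExt g hg hg' z = 0 :=
  snoc_ind (exists_smul_comp _ (op (D.emb j))) exists_zero (fun t j => by
    rw [bothExt_snoc, ← mul_smul, ← op_mul, D.emb_mul_emb, op_zero, zero_smul]) z

/-- The linear map on `Λ ⊗_C T_n ⊗_C Λ` that extends a map on `T_n`. -/
def freeExt : TensorPow k C J n × TensorPow k C J (n + 1) × TensorPow k C J (n + 1) ×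
    TensorPow k C J (n + 2) →ₗ[k] X :=
  g.coprod ((D.leftExt g hg).coprod ((D.rightExt g hg').coprod (D.bothExt g hg hg')))

theorem freeExt_apply (x : TensorPow k C J n) (p q : TensorPow k C J (n + 1))
    (r : TensorPow k C J (n + 2)) :
    D.freeExt g hg hg' (x, p, q, r) = g x + (D.leftExt g hg p + (D.rightExt g hg' q
      + D.bothExt g hg hg' r)) := rfl

/-- The morphism of bimodules on `Λ ⊗_C T_n ⊗_C Λ` that extends a map on `T_n`. -/
def freeHom : (freeAct k C J n).bimod D ⟶ X :=
  NullAct.homOf D (D.freeExt g hg hg')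
    (fun c ⟨x, p, q, r⟩ => by
      change D.freeExt g hg hg' (c • x, c • p, c • q, c • r) = _
      rw [freeExt_apply, freeExt_apply, hg, leftExt_smul, rightExt_smul D g hg, bothExt,
        leftExt_smul, smul_add, smul_add, smul_add])
    (fun c ⟨x, p, q, r⟩ => by
      change D.freeExt g hg hg' (op c • x, op c • p, op c • q, op c • r) = _
      rw [freeExt_apply, freeExt_apply, hg', leftExt_op_smul D g hg hg', rightExt_op_smul, bothExt,
        leftExt_op_smul D _ _ (D.rightExt_op_smul g hg'), smul_add, smul_add, smul_add])
    (fun j ⟨x, p, q, r⟩ => by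
      rw [freeAct_l, freeExt_apply, freeExt_apply, map_zero, map_zero, leftExt_cons, bothExt_cons,
        smul_add, smul_add, smul_add, emb_smul_leftExt, bothExt, emb_smul_leftExt, zero_add,
        zero_add, zero_add, add_zero])
    (fun j ⟨x, p, q, r⟩ => by
      rw [freeAct_r, freeExt_apply, freeExt_apply, map_zero, map_zero, rightExt_snoc, bothExt_snoc,
        smul_add, smul_add, smul_add, op_emb_smul_rightExt, op_emb_smul_bothExt, zero_add,
        zero_add, zero_add, add_zero, add_comm])

theorem freeHom_cls (x : TensorPow k C J n) :
    D.freeHom g hg hg' ((freeAct k C J n).cls D (x, 0)) = g x := by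
  rw [freeHom, NullAct.homOf_cls]
  change D.freeExt g hg hg' (x, 0, 0, 0) = _
  rw [freeExt_apply, map_zero, map_zero, map_zero, add_zero, add_zero, add_zero]

end

theorem free_linear_ext {u v : TensorPow k C J n × TensorPow k C J (n + 1) ×
      TensorPow k C J (n + 1) × TensorPow k C J (n + 2) →ₗ[k] X}
    (hul : ∀ j z, u ((freeAct k C J n).l j z) = D.emb j • u z)
    (hur : ∀ j z, u ((freeAct k C J n).r j z) = op (D.emb j) • u z)
    (hvl : ∀ j z, v ((freeAct k C J n).l j z) = D.emb j • v z)
    (hvr : ∀ j z, v ((freeAct k C J n).r j z) = op (D.emb j) • v z)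
    (h : ∀ x, u (x, 0, 0, 0) = v (x, 0, 0, 0)) : u = v := by
  have el (j : J) (x : TensorPow k C J n) (q : TensorPow k C J (n + 1)) :
      (0, cons j x, 0, cons j q) = (freeAct k C J n).l j (x, 0, q, 0) := rfl
  have hq (t : TensorPow k C J n) (j : J) : u (0, 0, snoc t j, 0) = v (0, 0, snoc t j, 0) := by
    have e : (0, 0, snoc t j, 0) = (freeAct k C J n).r j (t, 0, 0, 0) := by
      rw [freeAct_r, map_zero, LinearMap.zero_apply]
    rw [e, hur, hvr, h]
  have hq' := LinearMap.congr_fun (snoc_ext (f := u ∘ₗ LinearMap.inr k _ _ ∘ₗ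
    LinearMap.inr k _ _ ∘ₗ LinearMap.inl k _ _) (g := v ∘ₗ LinearMap.inr k _ _ ∘ₗ
    LinearMap.inr k _ _ ∘ₗ LinearMap.inl k _ _) hq)
  refine LinearMap.prod_ext (LinearMap.ext h) (LinearMap.prod_ext (cons_ext fun j t => ?_)
    (LinearMap.prod_ext (snoc_ext hq) (cons_ext fun j q => ?_)))
  · change u (0, cons j t, 0, 0) = v (0, cons j t, 0, 0)
    have e : (0, cons j t, 0, 0) = (freeAct k C J n).l j (t, 0, 0, 0) := by
      rw [freeAct_l, map_zero]
    rw [e, hul, hvl, h]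
  · change u (0, 0, 0, cons j q) = v (0, 0, 0, cons j q)
    have e : (0, 0, 0, cons j q) = (freeAct k C J n).l j (0, 0, q, 0) := by
      rw [freeAct_l, map_zero]
    rw [e, hul, hvl]
    exact congrArg (D.emb j • ·) (hq' q)

theorem freeHom_ext {f f' : (freeAct k C J n).bimod D ⟶ X}
    (h : ∀ x, f ((freeAct k C J n).cls D (x, 0)) = f' ((freeAct k C J n).cls D (x, 0))) :
    f = f' := by
  have := D.free_linear_ext
    (u := f.hom.restrictScalars k ∘ₗ ((freeAct k C J n).cls D).toLinearMap)
    (v := f'.hom.restrictScalars k ∘ₗ ((freeAct k C J n).cls D).toLinearMap)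
    (fun j z => (congrArg f (NullAct.emb_smul_cls D _ j z).symm).trans (bimodCat_map_smul f _ _))
    (fun j z => (congrArg f (NullAct.op_emb_smul_cls D _ j z).symm).trans
      (bimodCat_map_op_smul f _ _))
    (fun j z => (congrArg f' (NullAct.emb_smul_cls D _ j z).symm).trans
      (bimodCat_map_smul f' _ _))
    (fun j z => (congrArg f' (NullAct.op_emb_smul_cls D _ j z).symm).trans
      (bimodCat_map_op_smul f' _ _)) h
  ext z
  obtain ⟨z, rfl⟩ := ((freeAct k C J n).cls D).surjective z
  exact LinearMap.congr_fun this z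

theorem projective_free (hJ : BimodLifting k C J) [Module.Projective C J] :
    Projective ((freeAct k C J n).bimod D) where
  factors {E X} f e he := by
    obtain ⟨g, hgl, hgr, hg⟩ := TensorPow.bimodLifting hJ n
      ((D.toRes X).toLinearMap ∘ₗ e.hom.restrictScalars k ∘ₗ (D.toRes E).symm.toLinearMap)
      ((D.toRes X).toLinearMap ∘ₗ f.hom.restrictScalars k ∘ₗ
        ((freeAct k C J n).cls D).toLinearMap ∘ₗ LinearMap.inl k _ _)
      ((ModuleCat.epi_iff_surjective e).1 he)
      (fun c x => bimodCat_map_smul e _ x) (fun c x => bimodCat_map_op_smul e _ x)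
      (fun c x => by
        change D.toRes X (f ((freeAct k C J n).cls D (c • x, 0)))
          = c • D.toRes X (f ((freeAct k C J n).cls D (x, 0)))
        rw [smul_toRes, ← bimodCat_map_smul, NullAct.incl_smul_cls, Prod.smul_mk, smul_zero])
      (fun c x => by
        change D.toRes X (f ((freeAct k C J n).cls D (c • x, 0)))
          = c • D.toRes X (f ((freeAct k C J n).cls D (x, 0)))
        rw [op_smul_toRes, ← bimodCat_map_op_smul, NullAct.op_incl_smul_cls, Prod.smul_mk,
          smul_zero, op_unop])
    refine ⟨D.freeHom (X := E) ((D.toRes E).symm.toLinearMap ∘ₗ g) hgl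
      (fun c => hgr (op c)), D.freeHom_ext fun x => ?_⟩
    refine (congrArg e (D.freeHom_cls _ _ _ x)).trans (hg x)

end NullExt

variable [IsScalarTower k C J] [IsScalarTower k Cᵐᵒᵖ J] [SMulCommClass C Cᵐᵒᵖ J]

/-- The inclusion of `T_{n+1} ⊕ T_{n+2}` into `Λ ⊗_C T_n ⊗_C Λ`. -/
def kosIncl (ε : k) (n : ℕ) : (kosAct k C J (-ε) (n + 1)).bimod D ⟶ (freeAct k C J n).bimod D :=
  NullAct.homOf D (((freeAct k C J n).cls D).toLinearMap ∘ₗ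
      LinearMap.prod 0 (LinearMap.prod (-ε • LinearMap.fst k _ _) LinearMap.id))
    (fun c z => by
      refine Eq.trans ?_ ((freeAct k C J n).incl_smul_cls D c _).symm
      simp [smul_comm ε c])
    (fun c z => by
      refine Eq.trans ?_ ((freeAct k C J n).op_incl_smul_cls D c _).symm
      simp [smul_comm ε (op c)])
    (fun j ⟨x, y⟩ => by
      refine Eq.trans ?_ ((freeAct k C J n).emb_smul_cls D j _).symm
      simp [freeAct_l, kosAct_l])
    (fun j ⟨x, y⟩ => by
      refine Eq.trans ?_ ((freeAct k C J n).op_emb_smul_cls D j _).symm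
      simp [freeAct_r, kosAct_r])

theorem kosIncl_cls (ε : k) (n : ℕ) (q : TensorPow k C J (n + 1)) (r : TensorPow k C J (n + 2)) :
    kosIncl D ε n ((kosAct k C J (-ε) (n + 1)).cls D (q, r))
      = (freeAct k C J n).cls D (0, -ε • q, q, r) :=
  NullAct.homOf_cls D _ _ _ _ _ _

/-- The projection from `Λ ⊗_C T_n ⊗_C Λ` to `T_n ⊕ T_{n+1}`. -/
def kosProj (ε : k) (n : ℕ) : (freeAct k C J n).bimod D ⟶ (kosAct k C J ε n).bimod D :=
  NullAct.homOf D (((kosAct k C J ε n).cls D).toLinearMap ∘ₗ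
      LinearMap.coprod (LinearMap.inl k _ _)
        (LinearMap.inr k _ _ ∘ₗ LinearMap.coprod LinearMap.id (ε • LinearMap.fst k _ _)))
    (fun c z => by
      refine Eq.trans ?_ ((kosAct k C J ε n).incl_smul_cls D c _).symm
      simp [smul_comm ε c])
    (fun c z => by
      refine Eq.trans ?_ ((kosAct k C J ε n).op_incl_smul_cls D c _).symm
      simp [smul_comm ε (op c)])
    (fun j ⟨x, p, q, r⟩ => by
      refine Eq.trans ?_ ((kosAct k C J ε n).emb_smul_cls D j _).symm
      simp [freeAct_l, kosAct_l])
    (fun j ⟨x, p, q, r⟩ => by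
      refine Eq.trans ?_ ((kosAct k C J ε n).op_emb_smul_cls D j _).symm
      simp [freeAct_r, kosAct_r])

theorem kosProj_cls (ε : k) (n : ℕ) (x : TensorPow k C J n) (p q : TensorPow k C J (n + 1))
    (r : TensorPow k C J (n + 2)) :
    kosProj D ε n ((freeAct k C J n).cls D (x, p, q, r))
      = (kosAct k C J ε n).cls D (x, p + ε • q) := by
  refine (NullAct.homOf_cls D _ _ _ _ _ _).trans ?_
  simp

/-- The sequence `0 → T_{n+1} ⊕ T_{n+2} → Λ ⊗_C T_n ⊗_C Λ → T_n ⊕ T_{n+1} → 0`. -/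
def kosSeq (ε : k) (n : ℕ) : ShortComplex (BimodCat k L) :=
  ShortComplex.mk (kosIncl D ε n) (kosProj D ε n) <| by
    ext z
    obtain ⟨⟨q, r⟩, rfl⟩ := ((kosAct k C J (-ε) (n + 1)).cls D).surjective z
    refine (congrArg (kosProj D ε n) (kosIncl_cls D ε n q r)).trans ?_
    rw [kosProj_cls, neg_smul, neg_add_cancel]
    exact map_zero _

theorem kosSeq_shortExact (ε : k) (n : ℕ) : (kosSeq D ε n).ShortExact where
  exact := by
    rw [ShortComplex.moduleCat_exact_iff]
    intro z hz
    obtain ⟨⟨x, p, q, r⟩, rfl⟩ := ((freeAct k C J n).cls D).surjective z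
    have h := (kosProj_cls D ε n x p q r).symm.trans hz
    have h' := ((kosAct k C J ε n).cls D).map_eq_zero_iff.1 h
    obtain ⟨rfl, hp⟩ := Prod.ext_iff.1 h'
    have hp' : p = -ε • q := by
      rw [neg_smul]
      exact eq_neg_of_add_eq_zero_left hp
    subst hp'
    exact ⟨(kosAct k C J (-ε) (n + 1)).cls D (q, r), kosIncl_cls D ε n q r⟩
  mono_f := by
    rw [ModuleCat.mono_iff_injective]
    refine (injective_iff_map_eq_zero (kosIncl D ε n).hom).2 fun z hz => ?_
    obtain ⟨⟨q, r⟩, rfl⟩ := ((kosAct k C J (-ε) (n + 1)).cls D).surjective z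
    have h := (kosIncl_cls D ε n q r).symm.trans hz
    have h' := ((freeAct k C J n).cls D).map_eq_zero_iff.1 h
    simp only [Prod.mk_eq_zero] at h'
    rw [h'.2.2.1, h'.2.2.2]
    exact map_zero _
  epi_g := by
    rw [ModuleCat.epi_iff_surjective]
    intro z
    obtain ⟨⟨x, p⟩, rfl⟩ := ((kosAct k C J ε n).cls D).surjective z
    refine ⟨(freeAct k C J n).cls D (x, p, 0, 0), (kosProj_cls D ε n x p 0 0).trans ?_⟩
    rw [smul_zero, add_zero]

end NullExtension

end

section

open TensorPow

section Trace

variable {k R : Type u} [Field k] [Ring R] [Algebra k R] {X : BimodCat k R}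
  {V : Type u} [AddCommGroup V] [Module k V]

variable (X) in
/-- The map `x ↦ x ⊗ 1` from a bimodule `X` to `X ⊗_{R-R} R`. -/
def trace : X →ₗ[k] BimodTensor X (bimod k R R) :=
  (bimkLin X (bimod k R R)).flip (bimodIn k R R 1)

theorem trace_apply (x : X) : trace X x = bimk x (bimodIn k R R 1) := rfl

theorem bimk_bimodIn (x : X) (r : R) : bimk x (bimodIn k R R r) = trace X (op r • x) := by
  rw [trace_apply, bimodCat_op_smul_def, bimk_balanced, bimodIn_smul]
  simp

theorem trace_smul (r : R) (x : X) : trace X (r • x) = trace X (op r • x) := by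
  have h := bimk_balanced 1 r x (bimodIn k R R 1)
  rw [bimodIn_smul, op_smul_eq_mul, one_mul, one_smul] at h
  rw [← bimk_bimodIn, ← h]
  rfl

theorem trace_surjective : Function.Surjective (trace X) := fun z => by
  obtain ⟨z, rfl⟩ := Submodule.Quotient.mk_surjective _ z
  induction z using TensorProduct.induction_on with
  | zero => exact ⟨0, map_zero _⟩
  | tmul x y =>
    obtain ⟨r, rfl⟩ := (bimodIn k R R).surjective y
    exact ⟨op r • x, (bimk_bimodIn x r).symm⟩
  | add x y hx hy =>
    obtain ⟨x', hx⟩ := hx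
    obtain ⟨y', hy⟩ := hy
    exact ⟨x' + y', by rw [map_add, hx, hy]; rfl⟩

/-- The bilinear map `(x, r) ↦ f(x r)`. -/
def traceBilin (f : X →ₗ[k] V) : X →ₗ[k] bimod k R R →ₗ[k] V :=
  LinearMap.mk₂ k (fun x y => f (op ((bimodIn k R R).symm y) • x))
    (fun x x' y => by rw [smul_add, map_add]) (fun c x y => by rw [smul_comm, map_smul])
    (fun x y y' => by rw [map_add, MulOpposite.op_add, add_smul, map_add])
    (fun c x y => by rw [map_smul (bimodIn k R R).symm, op_smul, smul_assoc, map_smul f])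

theorem traceBilin_bimodIn (f : X →ₗ[k] V) (x : X) (r : R) :
    traceBilin f x (bimodIn k R R r) = f (op r • x) :=
  congrArg (fun r => f (op r • x)) ((bimodIn k R R).symm_apply_apply r)

/-- The linear map on `X ⊗_{R-R} R` induced by a trace on `X`. -/
def traceLift (f : X →ₗ[k] V) (hf : ∀ (r : R) (x : X), f (r • x) = f (op r • x)) :
    BimodTensor X (bimod k R R) →ₗ[k] V :=
  bimodLift (traceBilin f) fun r s x y => by
    obtain ⟨y, rfl⟩ := (bimodIn k R R).surjective y
    rw [bimodIn_smul, traceBilin_bimodIn, traceBilin_bimodIn, bimodCat_tmul_smul,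
      ← smul_comm s (op y), hf, op_smul_eq_mul, smul_eq_mul, op_mul, op_mul, mul_smul, mul_smul]

theorem traceLift_trace (f : X →ₗ[k] V) (hf : ∀ (r : R) (x : X), f (r • x) = f (op r • x))
    (x : X) : traceLift f hf (trace X x) = f x := by
  refine (bimodLift_bimk _ _ _ _).trans ?_
  rw [traceBilin_bimodIn, op_one, one_smul]

theorem bimodTensorMap_trace {X' : BimodCat k R} (f : X ⟶ X') (x : X) :
    bimodTensorMap f (𝟙 (bimod k R R)) (trace X x) = trace X' (f x) := rfl

end Trace

section NullExtension

variable {k C J L : Type u} [Field k] [Ring C] [Algebra k C] [Ring L] [Algebra k L]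
  [AddCommGroup J] [Module k J] [Module C J] [Module Cᵐᵒᵖ J] (D : NullExt k C J L)
  {V : Type u} [AddCommGroup V] [Module k V]

namespace NullAct

variable {Z : Type u} [AddCommGroup Z] [Module k Z] [Module C Z] [Module Cᵐᵒᵖ Z]
  [SMulCommClass C Cᵐᵒᵖ Z] [IsScalarTower k C Z] [IsScalarTower k Cᵐᵒᵖ Z]
  (α : NullAct k C J Z)

/-- The map `z ↦ z ⊗ 1`. -/
def tr : Z →ₗ[k] BimodTensor (α.bimod D) (NullSquareHH.bimod k L L) :=
    trace _ ∘ₗ (α.cls D).toLinearMap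

theorem tr_surjective : Function.Surjective (α.tr D) :=
  trace_surjective.comp (α.cls D).surjective

theorem tr_smul (c : C) (z : Z) : α.tr D (c • z) = α.tr D (op c • z) := by
  change trace _ (α.cls D (c • z)) = trace _ (α.cls D (op c • z))
  rw [← incl_smul_cls, ← op_incl_smul_cls, trace_smul]

theorem tr_l (j : J) (z : Z) : α.tr D (α.l j z) = α.tr D (α.r j z) := by
  change trace _ (α.cls D (α.l j z)) = trace _ (α.cls D (α.r j z))
  rw [← emb_smul_cls, ← op_emb_smul_cls, trace_smul]

/-- The linear map on `Z ⊗_{Λ-Λ} Λ` induced by a trace on `Z`. -/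
def trLift (f : Z →ₗ[k] V) (hf : ∀ (c : C) z, f (c • z) = f (op c • z))
    (hj : ∀ (j : J) z, f (α.l j z) = f (α.r j z)) :
    BimodTensor (α.bimod D) (NullSquareHH.bimod k L L) →ₗ[k] V :=
  traceLift (f ∘ₗ (α.cls D).symm.toLinearMap) fun r x => by
    obtain ⟨x, rfl⟩ := (α.cls D).surjective x
    rw [smul_cls, op_smul_cls, LinearMap.comp_apply, LinearMap.comp_apply, LinearEquiv.coe_coe,
      LinearEquiv.symm_apply_apply, LinearEquiv.symm_apply_apply, map_add, map_add, hf, hj,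
      unop_op]

theorem trLift_tr (f : Z →ₗ[k] V) (hf : ∀ (c : C) z, f (c • z) = f (op c • z))
    (hj : ∀ (j : J) z, f (α.l j z) = f (α.r j z)) (z : Z) :
    α.trLift D f hf hj (α.tr D z) = f z := by
  exact (traceLift_trace _ _ _).trans (congrArg f ((α.cls D).symm_apply_apply z))

end NullAct

theorem exists_H0_lift {T : Type u} [AddCommGroup T] [Module k T] [Module C T] [Module Cᵐᵒᵖ T]
    (f : T →ₗ[k] V) (hf : ∀ (c : C) t, f (c • t) = f (op c • t)) :
    ∃ g : H0 k C T →ₗ[k] V, ∀ t, g ((commRel k C T).mkQ t) = f t :=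
  ⟨Submodule.liftQ _ f (Submodule.span_le.2 (by
    rintro _ ⟨c, t, rfl⟩
    simp [hf])), fun _ => rfl⟩

variable [IsScalarTower k C J] [IsScalarTower k Cᵐᵒᵖ J] [SMulCommClass C Cᵐᵒᵖ J]

theorem exists_toH0_lift {n : ℕ} (f : TensorPow k C J n →ₗ[k] V)
    (hf : ∀ (c : C) t, f (c • t) = f (op c • t)) :
    ∃ g : H0 k C (TensorPow k C J n) →ₗ[k] V, ∀ t, g (toH0 t) = f t := exists_H0_lift f hf

theorem eq_zero_of_subsingleton {n : ℕ} [Subsingleton (H0 k C (TensorPow k C J n))]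
    (f : TensorPow k C J n →ₗ[k] V) (hf : ∀ (c : C) t, f (c • t) = f (op c • t)) (t) :
    f t = 0 := by
  obtain ⟨g, hg⟩ := exists_toH0_lift f hf
  rw [← hg, Subsingleton.elim (toH0 t) 0, map_zero]

/-- The class of `x ⊗ 1` for `x` in `T_n`. -/
def freeTrX (n : ℕ) : TensorPow k C J n →ₗ[k]
    BimodTensor ((freeAct k C J n).bimod D) (bimod k L L) :=
  (freeAct k C J n).tr D ∘ₗ LinearMap.inl k _ _

/-- The class of `p ⊗ 1` for `p` in `J ⊗_C T_n`. -/
def freeTrP (n : ℕ) : TensorPow k C J (n + 1) →ₗ[k]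
    BimodTensor ((freeAct k C J n).bimod D) (bimod k L L) :=
  (freeAct k C J n).tr D ∘ₗ LinearMap.inr k _ _ ∘ₗ LinearMap.inl k _ _

/-- The class of `q ⊗ 1` for `q` in `T_n ⊗_C J`. -/
def freeTrQ (n : ℕ) : TensorPow k C J (n + 1) →ₗ[k]
    BimodTensor ((freeAct k C J n).bimod D) (bimod k L L) :=
  (freeAct k C J n).tr D ∘ₗ LinearMap.inr k _ _ ∘ₗ LinearMap.inr k _ _ ∘ₗ LinearMap.inl k _ _

/-- The class of `r ⊗ 1` for `r` in `J ⊗_C T_n ⊗_C J`. -/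
def freeTrR (n : ℕ) : TensorPow k C J (n + 2) →ₗ[k]
    BimodTensor ((freeAct k C J n).bimod D) (bimod k L L) :=
  (freeAct k C J n).tr D ∘ₗ LinearMap.inr k _ _ ∘ₗ LinearMap.inr k _ _ ∘ₗ LinearMap.inr k _ _

theorem freeTrX_eq_zero (n : ℕ) [Subsingleton (H0 k C (TensorPow k C J n))]
    (x : TensorPow k C J n) : freeTrX D n x = 0 :=
  eq_zero_of_subsingleton (freeTrX D n) (fun c t => by
    have h := (freeAct k C J n).tr_smul D c (t, 0, 0, 0)
    simp only [Prod.smul_mk, smul_zero] at h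
    exact h) x

theorem freeTrP_smul (n : ℕ) (c : C) (p : TensorPow k C J (n + 1)) :
    freeTrP D n (c • p) = freeTrP D n (op c • p) := by
  have h := (freeAct k C J n).tr_smul D c (0, p, 0, 0)
  simp only [Prod.smul_mk, smul_zero] at h
  exact h

theorem freeTrQ_snoc (n : ℕ) (t : TensorPow k C J n) (j : J) :
    freeTrQ D n (snoc t j) = freeTrP D n (cons j t) := by
  have := (freeAct k C J n).tr_l D j (t, 0, 0, 0)
  rw [freeAct_l, freeAct_r, map_zero, map_zero, LinearMap.zero_apply] at this
  exact this.symm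

theorem freeTrR_eq_zero (n : ℕ) (r : TensorPow k C J (n + 2)) : freeTrR D n r = 0 := by
  refine LinearMap.congr_fun (f := freeTrR D n) (g := 0) (cons_ext fun j q => ?_) r
  have := (freeAct k C J n).tr_l D j (0, 0, q, 0)
  rw [freeAct_l, freeAct_r, map_zero, map_zero, LinearMap.zero_apply] at this
  exact this.trans (map_zero _)

theorem free_tr_split (n : ℕ) (x : TensorPow k C J n) (p q : TensorPow k C J (n + 1))
    (r : TensorPow k C J (n + 2)) : (freeAct k C J n).tr D (x, p, q, r)
      = freeTrX D n x + (freeTrP D n p + freeTrQ D n q) := by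
  have e : (x, p, q, r) = LinearMap.inl k _ _ x + (LinearMap.inr k _ _ (LinearMap.inl k _ _ p)
      + LinearMap.inr k _ _ (LinearMap.inr k _ _ (LinearMap.inl k _ _ q)))
      + LinearMap.inr k _ _ (LinearMap.inr k _ _ (LinearMap.inr k _ _ r)) := by
    simp only [LinearMap.inl_apply, LinearMap.inr_apply, Prod.mk_add_mk, add_zero, zero_add]
  refine (congrArg ((freeAct k C J n).tr D) e).trans ?_
  rw [map_add, map_add, map_add]
  refine (congrArg (_ + ·) (freeTrR_eq_zero D n r)).trans (add_zero _)

/-- The map `(x, p, q, r) ↦ [p] + t [q]`. -/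
def freeTrace (n : ℕ) : TensorPow k C J n × TensorPow k C J (n + 1) × TensorPow k C J (n + 1) ×
    TensorPow k C J (n + 2) →ₗ[k] H0 k C (TensorPow k C J (n + 1)) :=
  LinearMap.coprod 0 (LinearMap.coprod toH0 (LinearMap.coprod (rotate k C J (n + 1) ∘ₗ toH0) 0))

theorem freeTrace_apply (n : ℕ) (x : TensorPow k C J n) (p q : TensorPow k C J (n + 1))
    (r : TensorPow k C J (n + 2)) :
    freeTrace n (x, p, q, r) = toH0 p + rotate k C J (n + 1) (toH0 q) := by
  simp [freeTrace]

/-- The map from `(Λ ⊗_C T_n ⊗_C Λ) ⊗_{Λ-Λ} Λ` to `H₀(C, T_{n+1})`. -/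
def freeTr (n : ℕ) : BimodTensor ((freeAct k C J n).bimod D) (bimod k L L) →ₗ[k]
    H0 k C (TensorPow k C J (n + 1)) :=
  (freeAct k C J n).trLift D (freeTrace n)
    (fun c ⟨x, p, q, r⟩ => by
      change freeTrace n (c • x, c • p, c • q, c • r)
        = freeTrace n (op c • x, op c • p, op c • q, op c • r)
      rw [freeTrace_apply, freeTrace_apply, toH0_smul, toH0_smul])
    (fun j ⟨x, p, q, r⟩ => by
      rw [freeAct_l, freeAct_r, freeTrace_apply, freeTrace_apply, rotate_toH0_snoc, map_zero,
        map_zero, add_zero, zero_add])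

theorem freeTr_tr (n : ℕ) (x : TensorPow k C J n) (p q : TensorPow k C J (n + 1))
    (r : TensorPow k C J (n + 2)) : freeTr D n ((freeAct k C J n).tr D (x, p, q, r))
      = toH0 p + rotate k C J (n + 1) (toH0 q) :=
  (NullAct.trLift_tr D _ _ _ _ _).trans (freeTrace_apply n x p q r)

theorem exists_ofFreeTr (n : ℕ) : ∃ g : H0 k C (TensorPow k C J (n + 1)) →ₗ[k]
    BimodTensor ((freeAct k C J n).bimod D) (bimod k L L),
    (∀ p, g (toH0 p) = freeTrP D n p) ∧
    ∀ q, g (rotate k C J (n + 1) (toH0 q)) = freeTrQ D n q := by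
  obtain ⟨g, hg⟩ := exists_toH0_lift (freeTrP D n) (freeTrP_smul D n)
  refine ⟨g, hg, fun q => ?_⟩
  refine LinearMap.congr_fun (f := g ∘ₗ rotate k C J (n + 1) ∘ₗ toH0)
    (g := freeTrQ D n) (snoc_ext fun t j => ?_) q
  rw [LinearMap.comp_apply, LinearMap.comp_apply, rotate_toH0_snoc, hg, freeTrQ_snoc]

end NullExtension

end

section

open TensorPow

section NullExtension

variable {k C J L : Type u} [Field k] [Ring C] [Algebra k C] [Ring L] [Algebra k L]
  [AddCommGroup J] [Module k J] [Module C J] [Module Cᵐᵒᵖ J] (D : NullExt k C J L)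
  {V : Type u} [AddCommGroup V] [Module k V]
  [IsScalarTower k C J] [IsScalarTower k Cᵐᵒᵖ J] [SMulCommClass C Cᵐᵒᵖ J]

theorem freeTr_injective (n : ℕ) [Subsingleton (H0 k C (TensorPow k C J n))] :
    Function.Injective (freeTr D n) := by
  obtain ⟨g, hg, hg'⟩ := exists_ofFreeTr D n
  refine Function.LeftInverse.injective (g := g) fun z => ?_
  obtain ⟨⟨x, p, q, r⟩, rfl⟩ := (freeAct k C J n).tr_surjective D z
  rw [freeTr_tr, map_add, hg, hg', free_tr_split D n x p q r, freeTrX_eq_zero D n x]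
  exact (zero_add _).symm

theorem kosIncl_tr (ε : k) (n : ℕ) (q : TensorPow k C J (n + 1)) (r : TensorPow k C J (n + 2)) :
    bimodTensorMap (kosIncl D ε n) (𝟙 (bimod k L L)) ((kosAct k C J (-ε) (n + 1)).tr D (q, r))
      = (freeAct k C J n).tr D (0, -ε • q, q, r) :=
  (bimodTensorMap_trace _ _).trans (congrArg (trace _) (kosIncl_cls D ε n q r))

theorem kosIncl_tensor_eq_zero (ε : k) (n : ℕ)
    [Subsingleton (H0 k C (TensorPow k C J (n + 1)))] :
    bimodTensorMap (kosIncl D ε n) (𝟙 (bimod k L L)) = 0 := by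
  obtain ⟨g, hg, hg'⟩ := exists_ofFreeTr D n
  refine LinearMap.ext fun z => ?_
  obtain ⟨⟨q, r⟩, rfl⟩ := (kosAct k C J (-ε) (n + 1)).tr_surjective D z
  have h0 : freeTrX D n 0 = 0 := map_zero _
  have hP (p) : freeTrP D n p = 0 := by
    rw [← hg, Subsingleton.elim (toH0 p) 0, map_zero]
  have hQ (p) : freeTrQ D n p = 0 := by
    rw [← hg', Subsingleton.elim (toH0 p) 0, map_zero, map_zero]
  refine (kosIncl_tr D ε n q r).trans ((free_tr_split D n 0 (-ε • q) q r).trans ?_)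
  exact (congrArg₂ (· + ·) h0 ((congrArg₂ (· + ·) (hP _) (hQ q)).trans (zero_add _))).trans
    (zero_add _)

theorem kos_tr_snd (ε : k) (n : ℕ) [Subsingleton (H0 k C (TensorPow k C J (n + 1)))]
    (r : TensorPow k C J (n + 1)) : (kosAct k C J ε n).tr D (0, r) = 0 :=
  eq_zero_of_subsingleton ((kosAct k C J ε n).tr D ∘ₗ LinearMap.inr k _ _)
    (fun c t => by
      have := (kosAct k C J ε n).tr_smul D c (0, t)
      rwa [Prod.smul_mk, Prod.smul_mk, smul_zero, smul_zero] at this) r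

theorem kos_tr_fst (ε : k) (n : ℕ) [Subsingleton (H0 k C (TensorPow k C J n))]
    (x : TensorPow k C J n) : (kosAct k C J ε n).tr D (x, 0) = 0 :=
  eq_zero_of_subsingleton ((kosAct k C J ε n).tr D ∘ₗ LinearMap.inl k _ _)
    (fun c t => by
      have := (kosAct k C J ε n).tr_smul D c (t, 0)
      rwa [Prod.smul_mk, Prod.smul_mk, smul_zero, smul_zero] at this) x

theorem kos_fst_equiv (ε : k) (n : ℕ) [Subsingleton (H0 k C (TensorPow k C J (n + 1)))] :
    ∃ u : BimodTensor ((kosAct k C J ε n).bimod D) (bimod k L L) ≃ₗ[k]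
      H0 k C (TensorPow k C J n), ∀ x y, u ((kosAct k C J ε n).tr D (x, y)) = toH0 x := by
  let f : BimodTensor ((kosAct k C J ε n).bimod D) (bimod k L L) →ₗ[k]
      H0 k C (TensorPow k C J n) :=
    (kosAct k C J ε n).trLift D (toH0 ∘ₗ LinearMap.fst k _ _) (fun c z => toH0_smul c z.1)
      (fun j z => rfl)
  have hf : ∀ x y, f ((kosAct k C J ε n).tr D (x, y)) = toH0 x := fun x y =>
    NullAct.trLift_tr D _ _ _ _ _
  obtain ⟨g, hg⟩ := exists_toH0_lift ((kosAct k C J ε n).tr D ∘ₗ LinearMap.inl k _ _)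
    (fun c t => by
      have := (kosAct k C J ε n).tr_smul D c (t, 0)
      rwa [Prod.smul_mk, Prod.smul_mk, smul_zero, smul_zero] at this)
  refine ⟨LinearEquiv.ofLinearMap f g ?_ ?_, hf⟩
  · refine LinearMap.ext fun z => ?_
    obtain ⟨x, rfl⟩ := toH0_surjective z
    rw [LinearMap.comp_apply, hg]
    exact hf x 0
  · refine LinearMap.ext fun z => ?_
    obtain ⟨⟨x, y⟩, rfl⟩ := (kosAct k C J ε n).tr_surjective D z
    rw [LinearMap.comp_apply, hf, hg, LinearMap.id_apply]
    have e : (x, y) = (x, 0) + (0, y) := by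
      rw [Prod.mk_add_mk, add_zero, zero_add]
    rw [e, map_add]
    exact ((congrArg (_ + ·) (kos_tr_snd D ε n y)).trans (add_zero _)).symm

theorem ker_kosIncl_equiv (ε : k) (n : ℕ) [Subsingleton (H0 k C (TensorPow k C J n))]
    [Subsingleton (H0 k C (TensorPow k C J (n + 2)))] :
    Nonempty (LinearMap.ker (bimodTensorMap (kosIncl D ε n) (𝟙 (bimod k L L))) ≃ₗ[k]
      LinearMap.ker (rotate k C J (n + 1) - ε • 1)) := by
  obtain ⟨u, hu⟩ := kos_fst_equiv D (-ε) (n + 1)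
  have h : freeTr D n ∘ₗ bimodTensorMap (kosIncl D ε n) (𝟙 (bimod k L L))
      = (rotate k C J (n + 1) - ε • 1) ∘ₗ u.toLinearMap := by
    refine LinearMap.ext fun z => ?_
    obtain ⟨⟨q, r⟩, rfl⟩ := (kosAct k C J (-ε) (n + 1)).tr_surjective D z
    have e1 := (congrArg (freeTr D n) (kosIncl_tr D ε n q r)).trans (freeTr_tr D n 0 (-ε • q) q r)
    refine e1.trans (Eq.trans ?_ (congrArg
      (rotate k C J (n + 1) - ε • (1 : Module.End k (H0 k C (TensorPow k C J (n + 1)))))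
      (hu q r)).symm)
    rw [LinearMap.sub_apply, LinearMap.smul_apply, Module.End.one_apply, map_smul, neg_smul,
      neg_add_eq_sub]
  refine ⟨u.submoduleMap _ |>.trans (LinearEquiv.ofEq _ _ ?_)⟩
  ext v
  rw [LinearMap.mem_ker, Submodule.mem_map_equiv, LinearMap.mem_ker,
    ← (freeTr_injective D n).eq_iff, map_zero]
  have := LinearMap.congr_fun h (u.symm v)
  rw [LinearMap.comp_apply, LinearMap.comp_apply, LinearEquiv.coe_coe,
    LinearEquiv.apply_symm_apply] at this
  rw [this]

theorem kos_snd_equiv (ε : k) (n : ℕ) [Subsingleton (H0 k C (TensorPow k C J n))] :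
    Nonempty (BimodTensor ((kosAct k C J ε n).bimod D) (bimod k L L) ≃ₗ[k]
      H0 k C (TensorPow k C J (n + 1)) ⧸ LinearMap.range (rotate k C J (n + 1) - ε • 1)) := by
  let q := (LinearMap.range (rotate k C J (n + 1) - ε • 1)).mkQ
  have hq (v) : q (rotate k C J (n + 1) v) = ε • q v := by
    rw [← sub_eq_zero, ← map_smul, ← map_sub]
    exact (Submodule.Quotient.mk_eq_zero _).2 ⟨v, rfl⟩
  let f : BimodTensor ((kosAct k C J ε n).bimod D) (bimod k L L) →ₗ[k]
      H0 k C (TensorPow k C J (n + 1)) ⧸ LinearMap.range (rotate k C J (n + 1) - ε • 1) :=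
    (kosAct k C J ε n).trLift D (q ∘ₗ toH0 ∘ₗ LinearMap.snd k _ _)
      (fun c z => congrArg q (toH0_smul c z.2))
      (fun j z => by
        change q (toH0 (cons j z.1)) = q (toH0 (ε • snoc z.1 j))
        rw [← rotate_toH0_snoc, hq, map_smul, map_smul])
  have hf : ∀ x y, f ((kosAct k C J ε n).tr D (x, y)) = q (toH0 y) := fun x y =>
    NullAct.trLift_tr D _ _ _ _ _
  obtain ⟨g, hg⟩ := exists_toH0_lift ((kosAct k C J ε n).tr D ∘ₗ LinearMap.inr k _ _)
    (fun c t => by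
      have := (kosAct k C J ε n).tr_smul D c (0, t)
      rwa [Prod.smul_mk, Prod.smul_mk, smul_zero, smul_zero] at this)
  have hg' : g ∘ₗ (rotate k C J (n + 1) - ε • 1) = 0 := by
    refine LinearMap.ext fun v => ?_
    obtain ⟨y, rfl⟩ := toH0_surjective v
    refine LinearMap.congr_fun (f := (g ∘ₗ (rotate k C J (n + 1) - ε • 1)) ∘ₗ toH0) (g := 0)
      (snoc_ext fun t j => ?_) y
    rw [LinearMap.comp_apply, LinearMap.comp_apply, LinearMap.sub_apply, LinearMap.smul_apply,
      Module.End.one_apply, rotate_toH0_snoc, ← map_smul, ← map_sub, hg, LinearMap.comp_apply,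
      map_sub, map_sub, LinearMap.zero_apply, sub_eq_zero]
    exact (kosAct k C J ε n).tr_l D j (t, 0)
  let g' := Submodule.liftQ (LinearMap.range (rotate k C J (n + 1) - ε • 1)) g
    (LinearMap.range_le_ker_iff.2 hg')
  refine ⟨LinearEquiv.ofLinearMap f g' ?_ ?_⟩
  · refine Submodule.linearMap_qext _ (LinearMap.ext fun z => ?_)
    obtain ⟨x, rfl⟩ := toH0_surjective z
    change f (g (toH0 x)) = q (toH0 x)
    rw [hg]
    exact hf 0 x
  · refine LinearMap.ext fun z => ?_
    obtain ⟨⟨x, y⟩, rfl⟩ := (kosAct k C J ε n).tr_surjective D z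
    rw [LinearMap.comp_apply, hf]
    change g (toH0 y) = _
    rw [hg, LinearMap.id_apply]
    have e : (x, y) = (x, 0) + (0, y) := by
      rw [Prod.mk_add_mk, add_zero, zero_add]
    rw [e, map_add]
    exact ((congrArg (· + _) (kos_tr_fst D ε n x)).trans (zero_add _)).symm

end NullExtension

end

section OffDiag

/-- The off-diagonal part `N ⊕ M` of a null-square algebra. -/
@[nolint unusedArguments]
def OffDiag (_A _B M N : Type u) : Type u := N × M

variable {k A B M N : Type u} [Field k] [Ring A] [Algebra k A] [Ring B] [Algebra k B]
  [AddCommGroup M] [Module k M] [Module B M] [Module Aᵐᵒᵖ M]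
  [AddCommGroup N] [Module k N] [Module A N] [Module Bᵐᵒᵖ N]

namespace OffDiag

instance : AddCommGroup (OffDiag A B M N) := inferInstanceAs (AddCommGroup (N × M))

instance : Module k (OffDiag A B M N) := inferInstanceAs (Module k (N × M))

instance : Module (A × B) (OffDiag A B M N) :=
  letI : Module (A × B) N := Module.compHom N (RingHom.fst A B)
  letI : Module (A × B) M := Module.compHom M (RingHom.snd A B)
  inferInstanceAs (Module (A × B) (N × M))

instance : Module (A × B)ᵐᵒᵖ (OffDiag A B M N) :=
  letI : Module (A × B)ᵐᵒᵖ N := Module.compHom N (RingHom.op (RingHom.snd A B))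
  letI : Module (A × B)ᵐᵒᵖ M := Module.compHom M (RingHom.op (RingHom.fst A B))
  inferInstanceAs (Module (A × B)ᵐᵒᵖ (N × M))

variable (k A B M N) in
/-- The inclusion of `N`. -/
def inN : N →ₗ[k] OffDiag A B M N := LinearMap.inl k N M

variable (k A B M N) in
/-- The inclusion of `M`. -/
def inM : M →ₗ[k] OffDiag A B M N := LinearMap.inr k N M

variable (k A B M N) in
/-- The projection to `N`. -/
def prN : OffDiag A B M N →ₗ[k] N := LinearMap.fst k N M

variable (k A B M N) in
/-- The projection to `M`. -/
def prM : OffDiag A B M N →ₗ[k] M := LinearMap.snd k N M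

theorem smul_inN (c : A × B) (n : N) : c • inN k A B M N n = inN k A B M N (c.1 • n) :=
  Prod.ext rfl (smul_zero c.2)

theorem smul_inM (c : A × B) (m : M) : c • inM k A B M N m = inM k A B M N (c.2 • m) :=
  Prod.ext (smul_zero c.1) rfl

theorem op_smul_inN (c : A × B) (n : N) :
    op c • inN k A B M N n = inN k A B M N (op c.2 • n) :=
  Prod.ext rfl (smul_zero (op c.1))

theorem op_smul_inM (c : A × B) (m : M) :
    op c • inM k A B M N m = inM k A B M N (op c.1 • m) :=
  Prod.ext (smul_zero (op c.2)) rfl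

instance [SMulCommClass B Aᵐᵒᵖ M] [SMulCommClass A Bᵐᵒᵖ N] :
    SMulCommClass (A × B) (A × B)ᵐᵒᵖ (OffDiag A B M N) where
  smul_comm c d x := Prod.ext (smul_comm c.1 (op d.unop.2) x.1) (smul_comm c.2 (op d.unop.1) x.2)

instance [IsScalarTower k B M] [IsScalarTower k A N] :
    IsScalarTower k (A × B) (OffDiag A B M N) where
  smul_assoc r c x := Prod.ext (smul_assoc r c.1 x.1) (smul_assoc r c.2 x.2)

instance [IsScalarTower k Aᵐᵒᵖ M] [IsScalarTower k Bᵐᵒᵖ N] :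
    IsScalarTower k (A × B)ᵐᵒᵖ (OffDiag A B M N) where
  smul_assoc r c x :=
    Prod.ext (smul_assoc r (op c.unop.2) x.1) (smul_assoc r (op c.unop.1) x.2)

end OffDiag

end OffDiag

section Projective

variable (k A B N : Type u) [Field k] [Ring A] [Algebra k A] [Ring B] [Algebra k B]
  [AddCommGroup N] [Module k N] [Module A N] [Module Bᵐᵒᵖ N]
  [IsScalarTower k A N] [IsScalarTower k Bᵐᵒᵖ N] [SMulCommClass A Bᵐᵒᵖ N]

/-- If `φ : E → R` is a surjection of algebras with an `E`-linear section, projective modules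
over `R` are projective over `E`. -/
theorem projective_of_section {E R P : Type u} [Ring E] [Ring R] [AddCommGroup P] [Module R P]
    [Module E P] (φ : E →+* R) (s : R →+ E) (hs : ∀ e r, s (φ e * r) = e * s r)
    (hφ : ∀ r, φ (s r) = r) (hP : ∀ (e : E) (x : P), e • x = φ e • x) [Module.Projective R P] :
    Module.Projective E P := by
  let : Module E R := Module.compHom R φ
  have hE (e : E) (r : R) : e • r = φ e * r := rfl
  have : IsScalarTower E R R := ⟨fun e r r' => mul_assoc _ _ _⟩
  have : IsScalarTower E R P := ⟨fun e r x => by rw [hE, hP, mul_smul]⟩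
  have : Module.Projective E R := Module.Projective.of_split (M := E)
    { s with map_smul' := hs }
    { φ with map_smul' := fun e x => map_mul φ e x } (LinearMap.ext hφ)
  exact projective_trans E R P

/-- The nonunital inclusion of the tensor product of factors of a product algebra. -/
def factorSection (C D R S : Type u) [Ring C] [Algebra k C] [Ring D] [Algebra k D]
    [Ring R] [Algebra k R] [Ring S] [Algebra k S] (f : R →ₗ[k] C) (g : S →ₗ[k] D) :
    R ⊗[k] S →+ C ⊗[k] D := (TensorProduct.map f g).toAddMonoidHom

theorem factorSection_mul {C D R S : Type u} [Ring C] [Algebra k C] [Ring D] [Algebra k D]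
    [Ring R] [Algebra k R] [Ring S] [Algebra k S] (f : R →ₗ[k] C) (g : S →ₗ[k] D)
    (p : C →ₐ[k] R) (q : D →ₐ[k] S) (hf : ∀ c r, f (p c * r) = c * f r)
    (hg : ∀ d s, g (q d * s) = d * g s) (e : C ⊗[k] D) (x : R ⊗[k] S) :
    factorSection k C D R S f g (Algebra.TensorProduct.map p q e * x)
      = e * factorSection k C D R S f g x := by
  induction e using TensorProduct.induction_on with
  | zero => rw [map_zero, zero_mul, zero_mul, map_zero]
  | add e e' h h' => rw [map_add, add_mul, add_mul, map_add, h, h']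
  | tmul c d =>
    induction x using TensorProduct.induction_on with
    | zero => rw [mul_zero, map_zero, mul_zero]
    | add x x' h h' => rw [mul_add, map_add, map_add, mul_add, h, h']
    | tmul r s =>
      rw [Algebra.TensorProduct.map_tmul, Algebra.TensorProduct.tmul_mul_tmul]
      refine Eq.trans ?_ (Algebra.TensorProduct.tmul_mul_tmul c (f r) d (g s)).symm
      exact congrArg₂ (fun x y => x ⊗ₜ[k] y) (hf c r) (hg d s)

theorem factorSection_retract {C D R S : Type u} [Ring C] [Algebra k C] [Ring D] [Algebra k D]
    [Ring R] [Algebra k R] [Ring S] [Algebra k S] (f : R →ₗ[k] C) (g : S →ₗ[k] D)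
    (p : C →ₐ[k] R) (q : D →ₐ[k] S) (hf : ∀ r, p (f r) = r)
    (hg : ∀ s, q (g s) = s) (x : R ⊗[k] S) :
    Algebra.TensorProduct.map p q (factorSection k C D R S f g x) = x := by
  induction x using TensorProduct.induction_on with
  | zero => rw [map_zero, map_zero]
  | add x x' h h' => rw [map_add, map_add, h, h']
  | tmul r s =>
    change p (f r) ⊗ₜ[k] q (g s) = _
    rw [hf, hg]

end Projective

section OffDiagProjective

variable (k A B M N : Type u) [Field k] [Ring A] [Algebra k A] [Ring B] [Algebra k B]
  [AddCommGroup M] [Module k M] [Module B M] [Module Aᵐᵒᵖ M]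
  [IsScalarTower k B M] [IsScalarTower k Aᵐᵒᵖ M] [SMulCommClass B Aᵐᵒᵖ M]
  [AddCommGroup N] [Module k N] [Module A N] [Module Bᵐᵒᵖ N]
  [IsScalarTower k A N] [IsScalarTower k Bᵐᵒᵖ N] [SMulCommClass A Bᵐᵒᵖ N]

/-- The action of the enveloping algebra of `A × B` on an `A`-`B`-bimodule. -/
abbrev envProj : (A × B) ⊗[k] (A × B)ᵐᵒᵖ →ₐ[k] A ⊗[k] Bᵐᵒᵖ :=
  Algebra.TensorProduct.map (AlgHom.fst k A B) (AlgHom.op (AlgHom.snd k A B))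

/-- The action of the enveloping algebra of `A × B` on a `B`-`A`-bimodule. -/
abbrev envProj' : (A × B) ⊗[k] (A × B)ᵐᵒᵖ →ₐ[k] B ⊗[k] Aᵐᵒᵖ :=
  Algebra.TensorProduct.map (AlgHom.snd k A B) (AlgHom.op (AlgHom.fst k A B))

theorem offDiag_env_projective (hM : IsProjectiveBimod k B A M) (hN : IsProjectiveBimod k A B N) :
    letI : Module ((A × B) ⊗[k] (A × B)ᵐᵒᵖ) (OffDiag A B M N) := TensorProduct.Algebra.module
    Module.Projective ((A × B) ⊗[k] (A × B)ᵐᵒᵖ) (OffDiag A B M N) := by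
  let : Module (B ⊗[k] Aᵐᵒᵖ) M := TensorProduct.Algebra.module
  let : Module (A ⊗[k] Bᵐᵒᵖ) N := TensorProduct.Algebra.module
  have : Module.Projective (B ⊗[k] Aᵐᵒᵖ) M := hM
  have : Module.Projective (A ⊗[k] Bᵐᵒᵖ) N := hN
  let : Module ((A × B) ⊗[k] (A × B)ᵐᵒᵖ) M := Module.compHom M (envProj' k A B).toRingHom
  let : Module ((A × B) ⊗[k] (A × B)ᵐᵒᵖ) N := Module.compHom N (envProj k A B).toRingHom
  have : Module.Projective ((A × B) ⊗[k] (A × B)ᵐᵒᵖ) M :=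
    projective_of_section (envProj' k A B).toRingHom
      (factorSection k (A × B) (A × B)ᵐᵒᵖ B Aᵐᵒᵖ (LinearMap.inr k A B)
        ((opLinearEquiv k).toLinearMap ∘ₗ LinearMap.inl k A B ∘ₗ
          (opLinearEquiv k).symm.toLinearMap))
      (factorSection_mul k _ _ _ _ (fun c r => by ext <;> simp)
        (fun d s => by
          apply unop_injective
          ext <;> simp))
      (factorSection_retract k _ _ _ _ (fun r => rfl) (fun s => rfl)) (fun e x => rfl)
  have : Module.Projective ((A × B) ⊗[k] (A × B)ᵐᵒᵖ) N :=
    projective_of_section (envProj k A B).toRingHom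
      (factorSection k (A × B) (A × B)ᵐᵒᵖ A Bᵐᵒᵖ (LinearMap.inl k A B)
        ((opLinearEquiv k).toLinearMap ∘ₗ LinearMap.inr k A B ∘ₗ
          (opLinearEquiv k).symm.toLinearMap))
      (factorSection_mul k _ _ _ _ (fun c r => by ext <;> simp)
        (fun d s => by
          apply unop_injective
          ext <;> simp))
      (factorSection_retract k _ _ _ _ (fun r => rfl) (fun s => rfl)) (fun e x => rfl)
  let : Module ((A × B) ⊗[k] (A × B)ᵐᵒᵖ) (OffDiag A B M N) := TensorProduct.Algebra.module
  refine Module.Projective.of_equiv' (M := N × M)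
    { AddEquiv.refl (N × M) with
      map_smul' := fun e x => ?_ }
  change e • x = e • (show OffDiag A B M N from x)
  induction e using TensorProduct.induction_on with
  | zero =>
    exact (zero_smul ((A × B) ⊗[k] (A × B)ᵐᵒᵖ) x).trans
      (zero_smul ((A × B) ⊗[k] (A × B)ᵐᵒᵖ) (show OffDiag A B M N from x)).symm
  | add e e' h h' =>
    exact (add_smul e e' x).trans ((congrArg₂ (· + ·) h h').trans
      (add_smul e e' (show OffDiag A B M N from x)).symm)
  | tmul c d =>
    refine Eq.trans ?_ (TensorProduct.Algebra.smul_def c d (show OffDiag A B M N from x)).symm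
    exact Prod.ext (TensorProduct.Algebra.smul_def c.1 (op d.unop.2) x.1)
      (TensorProduct.Algebra.smul_def c.2 (op d.unop.1) x.2)

theorem offDiag_bimodLifting (hM : IsProjectiveBimod k B A M) (hN : IsProjectiveBimod k A B N) :
    BimodLifting k (A × B) (OffDiag A B M N) :=
  bimodLifting_of_projective (offDiag_env_projective k A B M N hM hN)

theorem offDiag_projective (hM : IsProjectiveBimod k B A M) (hN : IsProjectiveBimod k A B N) :
    Module.Projective (A × B) (OffDiag A B M N) :=
  projective_left k (A × B) (A × B)ᵐᵒᵖ (OffDiag A B M N) (offDiag_env_projective k A B M N hM hN)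

/-- A null-square algebra is a trivial extension of its diagonal. -/
def nullSquareExt : NullExt k (A × B) (OffDiag A B M N) (NullSquare A B M N) where
  proj := AlgHom.ofLinearMap
    { toFun := fun x => (x.a, x.b), map_add' := fun _ _ => rfl, map_smul' := fun _ _ => rfl }
    rfl fun _ _ => rfl
  tail :=
    { toFun := fun x => OffDiag.inN k A B M N x.n + OffDiag.inM k A B M N x.m
      map_add' := fun x y => by
        rw [NullSquare.add_n, NullSquare.add_m, map_add, map_add, add_add_add_comm]
      map_smul' := fun c x => by
        rw [NullSquare.smul_n, NullSquare.smul_m, map_smul, map_smul, ← smul_add]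
        rfl }
  incl := AlgHom.ofLinearMap
    { toFun := fun c => NullSquare.diag c
      map_add' := fun _ _ => map_add _ _ _
      map_smul' := fun c x => by ext <;> simp [NullSquare.diag] }
    (map_one (NullSquare.diag (M := M) (N := N)))
    fun c d => map_mul (NullSquare.diag (M := M) (N := N)) c d
  emb :=
    { toFun := fun x => ⟨0, OffDiag.prN k A B M N x, OffDiag.prM k A B M N x, 0⟩
      map_add' := fun x y => by ext <;> simp
      map_smul' := fun c x => by ext <;> simp }
  proj_incl c := rfl
  tail_incl c := by
    change OffDiag.inN k A B M N 0 + OffDiag.inM k A B M N 0 = 0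
    rw [map_zero, map_zero, add_zero]
  proj_emb j := rfl
  tail_emb j := Prod.ext (add_zero _) (zero_add _)
  decomp x := by
    change NullSquare.diag (x.a, x.b) + NullSquare.mk 0 (x.n + 0) (0 + x.m) 0 = x
    ext <;> simp [NullSquare.diag]
  tail_mul x y := by
    refine Prod.ext ?_ ?_
    · change (x.a • y.n + op y.b • x.n) + 0 = x.a • (y.n + 0) + op y.b • (x.n + 0)
      rw [add_zero, add_zero, add_zero]
    · change 0 + (op y.a • x.m + x.b • y.m) = x.b • (0 + y.m) + op y.a • (0 + x.m)
      rw [zero_add, zero_add, zero_add, add_comm]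

end OffDiagProjective

section

open TensorPow

section ConsLift

variable {k C J : Type u} [Field k] [Ring C] [Algebra k C]
  [AddCommGroup J] [Module k J] [Module C J] [Module Cᵐᵒᵖ J]
  {V : Type u} [AddCommGroup V] [Module k V] {n : ℕ}

theorem TensorPow.cons_cons_ext {f g : TensorPow k C J (n + 2) →ₗ[k] V}
    (h : ∀ j j' t, f (cons j (cons j' t)) = g (cons j (cons j' t))) : f = g :=
  cons_ext fun j t => LinearMap.congr_fun
    (cons_ext (f := f ∘ₗ cons j) (g := g ∘ₗ cons j) (h j)) t

variable [IsScalarTower k C J] [IsScalarTower k Cᵐᵒᵖ J] [SMulCommClass C Cᵐᵒᵖ J]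

theorem TensorPow.unsingle_single (x : J) : unsingle k C J (single k C J x) = x :=
  (single k C J).symm_apply_apply x

theorem TensorPow.cons_single_ext {f g : TensorPow k C J 1 →ₗ[k] V}
    (h : ∀ j j', f (cons j (single k C J j')) = g (cons j (single k C J j'))) : f = g :=
  cons_ext fun j t => by
    obtain ⟨x, rfl⟩ := (single k C J).surjective t
    exact h j x

theorem TensorPow.unsingle_smul (c : C) (t : TensorPow k C J 0) :
    unsingle k C J (c • t) = c • unsingle k C J t := by
  obtain ⟨x, rfl⟩ := (single k C J).surjective t
  rw [smul_single, unsingle_single, unsingle_single]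

/-- The linear map on `J ⊗_C J ⊗_C T_n` induced by a balanced trilinear map. -/
def TensorPow.consLift₂ (F : J →ₗ[k] J →ₗ[k] TensorPow k C J n →ₗ[k] V)
    (h : ∀ (c : C) j j' t, F j (op c • j') t = F j j' (c • t))
    (h' : ∀ (c : C) j j' t, F (op c • j) j' t = F j (c • j') t) :
    TensorPow k C J (n + 2) →ₗ[k] V :=
  consLift
    { toFun := fun j => consLift (F j) fun c j' t => h c j j' t
      map_add' := fun x y => cons_ext fun j t => by
        rw [LinearMap.add_apply, consLift_cons, consLift_cons, consLift_cons, map_add]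
        rfl
      map_smul' := fun c x => cons_ext fun j t => by
        rw [LinearMap.smul_apply, consLift_cons, consLift_cons, map_smul]
        rfl }
    fun c j t => by
      refine LinearMap.congr_fun (f := consLift (F (op c • j)) fun c j' t => h c _ j' t)
        (g := (consLift (F j) fun c j' t => h c j j' t) ∘ₗ Algebra.lsmul k k _ c)
        (cons_ext fun j' t => ?_) t
      change _ = consLift (F j) (fun c j' t => h c j j' t) (c • cons j' t)
      rw [smul_cons, consLift_cons, consLift_cons, h']

theorem TensorPow.consLift₂_cons (F : J →ₗ[k] J →ₗ[k] TensorPow k C J n →ₗ[k] V)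
    (h : ∀ (c : C) j j' t, F j (op c • j') t = F j j' (c • t))
    (h' : ∀ (c : C) j j' t, F (op c • j) j' t = F j (c • j') t) (j j' : J)
    (t : TensorPow k C J n) : consLift₂ F h h' (cons j (cons j' t)) = F j j' t := by
  refine (consLift_cons _ _ _ _).trans ?_
  exact consLift_cons (F j) (fun c j' t => h c j j' t) j' t

end ConsLift

section Words

variable {k A B M N : Type u} [Field k] [Ring A] [Algebra k A] [Ring B] [Algebra k B]
  [AddCommGroup M] [Module k M] [Module B M] [Module Aᵐᵒᵖ M]
  [IsScalarTower k B M] [IsScalarTower k Aᵐᵒᵖ M] [SMulCommClass B Aᵐᵒᵖ M]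
  [AddCommGroup N] [Module k N] [Module A N] [Module Bᵐᵒᵖ N]
  [IsScalarTower k A N] [IsScalarTower k Bᵐᵒᵖ N] [SMulCommClass A Bᵐᵒᵖ N]

local notation "J" => OffDiag A B M N
local notation "W" => BalTensor k B N M

namespace OffDiag

theorem idem_left_smul (x : J) :
    ((1, 0) : A × B) • x = op ((0, 1) : A × B) • x :=
  Prod.ext ((one_smul A x.1).trans (one_smul Bᵐᵒᵖ x.1).symm)
    ((zero_smul B x.2).trans (zero_smul Aᵐᵒᵖ x.2).symm)

theorem idem_right_smul (x : J) :
    ((0, 1) : A × B) • x = op ((1, 0) : A × B) • x :=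
  Prod.ext ((zero_smul A x.1).trans (zero_smul Bᵐᵒᵖ x.1).symm)
    ((one_smul B x.2).trans (one_smul Aᵐᵒᵖ x.2).symm)

theorem inN_prN (x : J) : inN k A B M N (prN k A B M N x) = ((1, 0) : A × B) • x :=
  Prod.ext (one_smul A x.1).symm (zero_smul B x.2).symm

theorem inM_prM (x : J) : inM k A B M N (prM k A B M N x) = ((0, 1) : A × B) • x :=
  Prod.ext (zero_smul A x.1).symm (one_smul B x.2).symm

end OffDiag

theorem idem_smul_add (T : Type u) [AddCommGroup T] [Module (A × B) T] (x : T) :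
    ((1, 0) : A × B) • x + ((0, 1) : A × B) • x = x := by
  rw [← add_smul, Prod.mk_add_mk, add_zero, zero_add]
  exact one_smul (A × B) x

theorem idem_op_smul_add (T : Type u) [AddCommGroup T] [Module (A × B)ᵐᵒᵖ T] (x : T) :
    op ((1, 0) : A × B) • x + op ((0, 1) : A × B) • x = x := by
  rw [← add_smul, ← MulOpposite.op_add, Prod.mk_add_mk, add_zero, zero_add]
  exact one_smul (A × B)ᵐᵒᵖ x

theorem idem_smul_even (m : ℕ) (x : TensorPow k (A × B) J (2 * m)) :
    ((1, 0) : A × B) • x = op ((0, 1) : A × B) • x := by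
  induction m with
  | zero =>
    obtain ⟨x, rfl⟩ := (single k (A × B) J).surjective x
    rw [smul_single, op_smul_single, OffDiag.idem_left_smul]
  | succ m ih =>
    refine LinearMap.congr_fun (cons_cons_ext (n := 2 * m)
      (f := Algebra.lsmul k k (TensorPow k (A × B) J (2 * m + 2)) ((1, 0) : A × B))
      (g := Algebra.lsmul k k (TensorPow k (A × B) J (2 * m + 2)) (op ((0, 1) : A × B)))
      fun j j' t => ?_) x
    change ((1, 0) : A × B) • cons j (cons j' t) = op ((0, 1) : A × B) • cons j (cons j' t)
    rw [smul_cons, OffDiag.idem_left_smul, cons_op_smul, smul_cons, OffDiag.idem_right_smul,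
      cons_op_smul, ih, op_smul_cons, op_smul_cons]

theorem toH0_even (m : ℕ) (x : TensorPow k (A × B) J (2 * m)) :
    (toH0 x : H0 k (A × B) (TensorPow k (A × B) J (2 * m))) = 0 := by
  have he := idem_smul_even m x
  have hf : ((0, 1) : A × B) • x = op ((1, 0) : A × B) • x := by
    have h1 := (idem_smul_add (A := A) (B := B) _
      x).trans (idem_op_smul_add (A := A) (B := B) _ x).symm
    rw [he, add_comm (op ((1, 0) : A × B) • x)] at h1
    exact add_left_cancel h1
  have h1 := toH0_smul (k := k) ((1, 0) : A × B) (((1, 0) : A × B) • x)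
  have h2 := toH0_smul (k := k) ((0, 1) : A × B) (((0, 1) : A × B) • x)
  rw [← mul_smul, he, ← mul_smul, ← op_mul] at h1
  rw [← mul_smul, hf, ← mul_smul, ← op_mul] at h2
  have e1 : ((1, 0) : A × B) * (1, 0) = (1, 0) := by simp
  have e2 : ((0, 1) : A × B) * (0, 1) = (0, 1) := by simp
  have e3 : ((0, 1) : A × B) * (1, 0) = 0 := by simp
  have e4 : ((1, 0) : A × B) * (0, 1) = 0 := by simp
  rw [e1, e3, op_zero, zero_smul, map_zero] at h1
  rw [e2, e4, op_zero, zero_smul, map_zero] at h2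
  rw [← idem_smul_add (A := A) (B := B) _ x, map_add, h1, h2, add_zero]

instance subsingleton_H0_even (m : ℕ) :
    Subsingleton (H0 k (A × B) (TensorPow k (A × B) J (2 * m))) :=
  subsingleton_of_forall_eq 0 fun z => by
    obtain ⟨x, rfl⟩ := toH0_surjective z
    exact toH0_even m x

variable (k A B M N) in
/-- The map `(n ⊗ m, t) ↦ n ⊗ m ⊗ t`. -/
def consPair (n : ℕ) : W →ₗ[k] TensorPow k (A × B) J n →ₗ[k] TensorPow k (A × B) J (n + 2) :=
  BalTensor.lift (TensorProduct.lift (LinearMap.mk₂ k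
    (fun y x => cons (OffDiag.inN k A B M N y) ∘ₗ cons (OffDiag.inM k A B M N x))
    (fun y y' x => by rw [map_add, map_add, LinearMap.add_comp])
    (fun c y x => by rw [map_smul, map_smul, LinearMap.smul_comp])
    (fun y x x' => by rw [map_add, map_add, LinearMap.comp_add])
    (fun c y x => by rw [map_smul, map_smul, LinearMap.comp_smul]))) fun y b x => by
      refine LinearMap.ext fun t => ?_
      change cons (OffDiag.inN k A B M N (op b • y)) (cons (OffDiag.inM k A B M N x) t)
        = cons (OffDiag.inN k A B M N y) (cons (OffDiag.inM k A B M N (b • x)) t)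
      have h1 := OffDiag.op_smul_inN (k := k) (M := M) ((0, b) : A × B) y
      have h2 := OffDiag.smul_inM (k := k) (N := N) ((0, b) : A × B) x
      rw [← h1, ← h2, cons_op_smul, smul_cons]

theorem consPair_mk (n : ℕ) (y : N) (x : M) (t : TensorPow k (A × B) J n) :
    consPair k A B M N n (BalTensor.mk k B N M (y ⊗ₜ x)) t
      = cons (OffDiag.inN k A B M N y) (cons (OffDiag.inM k A B M N x) t) := rfl

variable (k A B M N) in
/-- The map `n ⊗ m ↦ n ⊗ m`. -/
def pairSingle : W →ₗ[k] TensorPow k (A × B) J 1 :=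
  BalTensor.lift (TensorProduct.lift (LinearMap.mk₂ k
    (fun y x => cons (OffDiag.inN k A B M N y) (single k (A × B) J (OffDiag.inM k A B M N x)))
    (fun y y' x => by rw [map_add, map_add, LinearMap.add_apply])
    (fun c y x => by rw [map_smul, map_smul, LinearMap.smul_apply])
    (fun y x x' => by rw [map_add, map_add, map_add])
    (fun c y x => by rw [map_smul, map_smul, map_smul]))) fun y b x => by
      change cons (OffDiag.inN k A B M N (op b • y)) (single k _ _ (OffDiag.inM k A B M N x))
        = cons (OffDiag.inN k A B M N y) (single k _ _ (OffDiag.inM k A B M N (b • x)))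
      have h1 := OffDiag.op_smul_inN (k := k) (M := M) ((0, b) : A × B) y
      have h2 := OffDiag.smul_inM (k := k) (N := N) ((0, b) : A × B) x
      rw [← h1, ← h2, cons_op_smul, smul_single]

theorem pairSingle_mk (y : N) (x : M) : pairSingle k A B M N (BalTensor.mk k B N M (y ⊗ₜ x))
    = cons (OffDiag.inN k A B M N y) (single k (A × B) J (OffDiag.inM k A B M N x)) := rfl

variable (k A B M N) in
/-- The map `(n ⊗ m, t) ↦ t ⊗ n ⊗ m`. -/
def snocPair (n : ℕ) : W →ₗ[k] TensorPow k (A × B) J n →ₗ[k] TensorPow k (A × B) J (n + 2) :=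
  BalTensor.lift (TensorProduct.lift (LinearMap.mk₂ k
    (fun y x => snoc.flip (OffDiag.inM k A B M N x) ∘ₗ snoc.flip (OffDiag.inN k A B M N y))
    (fun y y' x => by rw [map_add, map_add, LinearMap.comp_add])
    (fun c y x => by rw [map_smul, map_smul, LinearMap.comp_smul])
    (fun y x x' => by rw [map_add, map_add, LinearMap.add_comp])
    (fun c y x => by rw [map_smul, map_smul, LinearMap.smul_comp]))) fun y b x => by
      refine LinearMap.ext fun t => ?_
      change snoc (snoc t (OffDiag.inN k A B M N (op b • y))) (OffDiag.inM k A B M N x)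
        = snoc (snoc t (OffDiag.inN k A B M N y)) (OffDiag.inM k A B M N (b • x))
      have h1 := OffDiag.op_smul_inN (k := k) (M := M) ((0, b) : A × B) y
      have h2 := OffDiag.smul_inM (k := k) (N := N) ((0, b) : A × B) x
      rw [← h1, ← h2, ← snoc_smul, op_smul_snoc]

theorem snocPair_mk (n : ℕ) (y : N) (x : M) (t : TensorPow k (A × B) J n) :
    snocPair k A B M N n (BalTensor.mk k B N M (y ⊗ₜ x)) t
      = snoc (snoc t (OffDiag.inN k A B M N y)) (OffDiag.inM k A B M N x) := rfl

theorem balTensor_induction {V : Type u} [AddCommGroup V] [Module k V] {p q : W →ₗ[k] V}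
    (h : ∀ y x, p (BalTensor.mk k B N M (y ⊗ₜ x)) = q (BalTensor.mk k B N M (y ⊗ₜ x))) (w : W) :
    p w = q w := LinearMap.congr_fun (BalTensor.hom_ext h) w

theorem smul_consPair (n : ℕ) (c : A × B) (w : W) (t : TensorPow k (A × B) J n) :
    c • consPair k A B M N n w t = consPair k A B M N n (c.1 • w) t := by
  refine balTensor_induction (p := Algebra.lsmul k k _ c ∘ₗ (consPair k A B M N n).flip t)
    (q := (consPair k A B M N n).flip t ∘ₗ Algebra.lsmul k k _ c.1) (fun y x => ?_) w
  change c • consPair k A B M N n (BalTensor.mk k B N M (y ⊗ₜ x)) t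
    = consPair k A B M N n (BalTensor.mk k B N M ((c.1 • y) ⊗ₜ x)) t
  rw [consPair_mk, consPair_mk, smul_cons, OffDiag.smul_inN]

theorem op_smul_consPair (n : ℕ) (c : (A × B)ᵐᵒᵖ) (w : W) (t : TensorPow k (A × B) J n) :
    c • consPair k A B M N n w t = consPair k A B M N n w (c • t) := by
  refine balTensor_induction (p := Algebra.lsmul k k _ c ∘ₗ (consPair k A B M N n).flip t)
    (q := (consPair k A B M N n).flip (c • t)) (fun y x => ?_) w
  change c • consPair k A B M N n (BalTensor.mk k B N M (y ⊗ₜ x)) t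
    = consPair k A B M N n (BalTensor.mk k B N M (y ⊗ₜ x)) (c • t)
  rw [consPair_mk, consPair_mk, op_smul_cons, op_smul_cons]

theorem consPair_op_smul (n : ℕ) (a : A) (w : W) (t : TensorPow k (A × B) J n) :
    consPair k A B M N n (op a • w) t = consPair k A B M N n w (((a, 0) : A × B) • t) := by
  refine balTensor_induction (p := (consPair k A B M N n).flip t ∘ₗ Algebra.lsmul k k _ (op a))
    (q := (consPair k A B M N n).flip (((a, 0) : A × B) • t)) (fun y x => ?_) w
  change consPair k A B M N n (BalTensor.mk k B N M (y ⊗ₜ (op a • x))) t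
    = consPair k A B M N n (BalTensor.mk k B N M (y ⊗ₜ x)) (((a, 0) : A × B) • t)
  have h := OffDiag.op_smul_inM (k := k) (N := N) ((a, 0) : A × B) x
  rw [consPair_mk, consPair_mk, ← h, cons_op_smul]

theorem smul_pairSingle (c : A × B) (w : W) : c • pairSingle k A B M N w =
    pairSingle k A B M N (c.1 • w) := by
  refine balTensor_induction (p := Algebra.lsmul k k _ c ∘ₗ pairSingle k A B M N)
    (q := pairSingle k A B M N ∘ₗ Algebra.lsmul k k _ c.1) (fun y x => ?_) w
  change c • pairSingle k A B M N (BalTensor.mk k B N M (y ⊗ₜ x))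
    = pairSingle k A B M N (BalTensor.mk k B N M ((c.1 • y) ⊗ₜ x))
  rw [pairSingle_mk, pairSingle_mk, smul_cons, OffDiag.smul_inN]

theorem op_smul_pairSingle (c : A × B) (w : W) :
    op c • pairSingle k A B M N w = pairSingle k A B M N (op c.1 • w) := by
  refine balTensor_induction (p := Algebra.lsmul k k _ (op c) ∘ₗ pairSingle k A B M N)
    (q := pairSingle k A B M N ∘ₗ Algebra.lsmul k k _ (op c.1)) (fun y x => ?_) w
  change op c • pairSingle k A B M N (BalTensor.mk k B N M (y ⊗ₜ x))
    = pairSingle k A B M N (BalTensor.mk k B N M (y ⊗ₜ (op c.1 • x)))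
  rw [pairSingle_mk, pairSingle_mk, op_smul_cons, op_smul_single, OffDiag.op_smul_inM]

theorem consPair_pairSingle (w v : W) :
    consPair k A B M N 1 w (pairSingle k A B M N v)
      = snocPair k A B M N 1 v (pairSingle k A B M N w) := by
  refine balTensor_induction (p := (consPair k A B M N 1).flip (pairSingle k A B M N v))
    (q := snocPair k A B M N 1 v ∘ₗ pairSingle k A B M N) (fun y x => ?_) w
  refine balTensor_induction (p := consPair k A B M N 1 (BalTensor.mk k B N M (y ⊗ₜ x)) ∘ₗ pairSingle k A B M N)
    (q := (snocPair k A B M N 1).flip (pairSingle k A B M N (BalTensor.mk k B N M (y ⊗ₜ x))))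
    (fun y' x' => ?_) v
  change consPair k A B M N 1 (BalTensor.mk k B N M (y ⊗ₜ x))
    (pairSingle k A B M N (BalTensor.mk k B N M (y' ⊗ₜ x')))
    = snocPair k A B M N 1 (BalTensor.mk k B N M (y' ⊗ₜ x'))
      (pairSingle k A B M N (BalTensor.mk k B N M (y ⊗ₜ x)))
  rw [consPair_mk, snocPair_mk, pairSingle_mk, pairSingle_mk, ← cons_snoc, ← cons_snoc, cons_snoc,
    ← cons_single, ← cons_snoc, ← cons_snoc, ← cons_single]

theorem consPair_snocPair (n : ℕ) (w v : W) (t : TensorPow k (A × B) J n) :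
    consPair k A B M N (n + 2) w (snocPair k A B M N n v t)
      = snocPair k A B M N (n + 2) v (consPair k A B M N n w t) := by
  refine balTensor_induction (p := (consPair k A B M N (n + 2)).flip (snocPair k A B M N n v t))
    (q := snocPair k A B M N (n + 2) v ∘ₗ (consPair k A B M N n).flip t) (fun y x => ?_) w
  refine balTensor_induction
    (p := consPair k A B M N (n + 2) (BalTensor.mk k B N M (y ⊗ₜ x)) ∘ₗ
      (snocPair k A B M N n).flip t)
    (q := (snocPair k A B M N (n + 2)).flip
      (consPair k A B M N n (BalTensor.mk k B N M (y ⊗ₜ x)) t))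
    (fun y' x' => ?_) v
  change consPair k A B M N (n + 2) (BalTensor.mk k B N M (y ⊗ₜ x))
      (snocPair k A B M N n (BalTensor.mk k B N M (y' ⊗ₜ x')) t)
    = snocPair k A B M N (n + 2) (BalTensor.mk k B N M (y' ⊗ₜ x'))
      (consPair k A B M N n (BalTensor.mk k B N M (y ⊗ₜ x)) t)
  rw [consPair_mk, snocPair_mk, snocPair_mk, consPair_mk, ← cons_snoc, ← cons_snoc, ← cons_snoc,
    ← cons_snoc]

end Words

end

section

open TensorPow

section H0Lift

variable {k C J : Type u} [Field k] [Ring C] [Algebra k C]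
  [AddCommGroup J] [Module k J] [Module C J] [Module Cᵐᵒᵖ J]
  [IsScalarTower k C J] [IsScalarTower k Cᵐᵒᵖ J] [SMulCommClass C Cᵐᵒᵖ J]
  {V : Type u} [AddCommGroup V] [Module k V] {n : ℕ}

/-- The linear map on `H₀(C, T_n)` induced by a trace on `T_n`. -/
def H0Lift (f : TensorPow k C J n →ₗ[k] V) (h : ∀ (c : C) t, f (c • t) = f (op c • t)) :
    H0 k C (TensorPow k C J n) →ₗ[k] V :=
  Submodule.liftQ _ f <| Submodule.span_le.2 <| by
    rintro _ ⟨c, t, rfl⟩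
    exact LinearMap.mem_ker.2 ((map_sub f _ _).trans (sub_eq_zero.2 (h c t)))

end H0Lift

section Words

variable {k A B M N : Type u} [Field k] [Ring A] [Algebra k A] [Ring B] [Algebra k B]
  [AddCommGroup M] [Module k M] [Module B M] [Module Aᵐᵒᵖ M]
  [IsScalarTower k B M] [IsScalarTower k Aᵐᵒᵖ M] [SMulCommClass B Aᵐᵒᵖ M]
  [AddCommGroup N] [Module k N] [Module A N] [Module Bᵐᵒᵖ N]
  [IsScalarTower k A N] [IsScalarTower k Bᵐᵒᵖ N] [SMulCommClass A Bᵐᵒᵖ N]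

local notation "J" => OffDiag A B M N
local notation "W" => BalTensor k B N M

variable (k A B M N) in
/-- The map `(j, j') ↦ n ⊗ m'`, where `n` is the component of `j` in `N` and `m'` that of `j'`
in `M`. -/
def pairW : J →ₗ[k] J →ₗ[k] W :=
  ((TensorProduct.mk k N M).compl₁₂ (OffDiag.prN k A B M N) (OffDiag.prM k A B M N)).compr₂
    (BalTensor.mk k B N M)

theorem pairW_apply (j j' : J) : pairW k A B M N j j'
    = BalTensor.mk k B N M (OffDiag.prN k A B M N j ⊗ₜ OffDiag.prM k A B M N j') := rfl

theorem pairW_balanced (c : A × B) (j j' : J) :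
    pairW k A B M N (op c • j) j' = pairW k A B M N j (c • j') :=
  BalTensor.mk_smul (k := k) (OffDiag.prN k A B M N j) c.2 (OffDiag.prM k A B M N j')

theorem smul_pairW (c : A × B) (j j' : J) :
    pairW k A B M N (c • j) j' = c.1 • pairW k A B M N j j' := rfl

theorem op_smul_pairW (c : A × B) (j j' : J) :
    pairW k A B M N j (op c • j') = op c.1 • pairW k A B M N j j' := rfl

section Step

variable {m n : ℕ}

/-- The map `w ⊗ t ↦ w ⊗ f t`. -/
def wordSucc (f : TensorPow k A W m →ₗ[k] TensorPow k (A × B) J n)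
    (hf : ∀ (a : A) (t : TensorPow k A W m), f (a • t)
      = ((a, 0) : A × B) • f t) : TensorPow k A W (m + 1) →ₗ[k] TensorPow k (A × B) J (n + 2) :=
  consLift ((consPair k A B M N n).compl₂ f) fun a w t => by
    change consPair k A B M N n (op a • w) (f t) = consPair k A B M N n w (f (a • t))
    rw [consPair_op_smul, hf]

theorem wordSucc_cons (f : TensorPow k A W m →ₗ[k] TensorPow k (A × B) J n)
    (hf : ∀ (a : A) (t : TensorPow k A W m), f (a • t) = ((a, 0) : A × B) • f t)
    (w : W) (t : TensorPow k A W m) :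
    wordSucc f hf (cons w t) = consPair k A B M N n w (f t) := by
  rw [wordSucc, consLift_cons, LinearMap.compl₂_apply]

theorem wordSucc_smul (f : TensorPow k A W m →ₗ[k] TensorPow k (A × B) J n)
    (hf : ∀ (a : A) (t : TensorPow k A W m), f (a • t) = ((a, 0) : A × B) • f t)
    (a : A) (t : TensorPow k A W (m + 1)) :
    wordSucc f hf (a • t) = ((a, 0) : A × B) • wordSucc f hf t := by
  refine LinearMap.congr_fun (f := wordSucc f hf ∘ₗ Algebra.lsmul k k _ a)
    (g := Algebra.lsmul k k _ ((a, 0) : A × B) ∘ₗ wordSucc f hf) (cons_ext fun w t => ?_) t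
  change wordSucc f hf (a • cons w t) = ((a, 0) : A × B) • wordSucc f hf (cons w t)
  rw [smul_cons, wordSucc_cons, wordSucc_cons, smul_consPair]

/-- The map `j ⊗ j' ⊗ t ↦ (j ⊗ j') ⊗ g t`. -/
def unwordSucc (g : TensorPow k (A × B) J n →ₗ[k] TensorPow k A W m)
    (hg : ∀ (c : A × B) (t : TensorPow k (A × B) J n), g (c • t)
      = c.1 • g t) : TensorPow k (A × B) J (n + 2) →ₗ[k] TensorPow k A W (m + 1) :=
  consLift₂ ((pairW k A B M N).compr₂ (cons.compl₂ g))
    (fun c j j' t => by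
      change cons (pairW k A B M N j (op c • j')) (g t)
        = cons (pairW k A B M N j j') (g (c • t))
      rw [op_smul_pairW, cons_op_smul, hg])
    (fun c j j' t => by
      change cons (pairW k A B M N (op c • j) j') (g t)
        = cons (pairW k A B M N j (c • j')) (g t)
      rw [pairW_balanced])

theorem unwordSucc_cons_cons (g : TensorPow k (A × B) J n →ₗ[k] TensorPow k A W m)
    (hg : ∀ (c : A × B) (t : TensorPow k (A × B) J n), g (c • t) = c.1 • g t)
    (j j' : J) (t : TensorPow k (A × B) J n) :
    unwordSucc g hg (cons j (cons j' t)) = cons (pairW k A B M N j j') (g t) := by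
  rw [unwordSucc, consLift₂_cons]
  rfl

theorem unwordSucc_smul (g : TensorPow k (A × B) J n →ₗ[k] TensorPow k A W m)
    (hg : ∀ (c : A × B) (t : TensorPow k (A × B) J n), g (c • t) = c.1 • g t)
    (c : A × B) (t : TensorPow k (A × B) J (n + 2)) :
    unwordSucc g hg (c • t) = c.1 • unwordSucc g hg t := by
  refine LinearMap.congr_fun (f := unwordSucc g hg ∘ₗ Algebra.lsmul k k _ c)
    (g := Algebra.lsmul k k _ c.1 ∘ₗ unwordSucc g hg) (cons_cons_ext fun j j' t => ?_) t
  change unwordSucc g hg (c • cons j (cons j' t))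
    = c.1 • unwordSucc g hg (cons j (cons j' t))
  rw [smul_cons, unwordSucc_cons_cons, unwordSucc_cons_cons, smul_pairW, smul_cons]

variable (k A B M N) in
/-- The map `j ⊗ j' ↦ j ⊗ j'`. -/
def unwordZero : TensorPow k (A × B) J 1 →ₗ[k] TensorPow k A W 0 :=
  consLift (((pairW k A B M N).compl₂ (unsingle k (A × B) J)).compr₂
    (single k A W).toLinearMap) fun c j t => by
      rw [LinearMap.compr₂_apply, LinearMap.compr₂_apply, LinearMap.compl₂_apply,
        LinearMap.compl₂_apply, pairW_balanced, unsingle_smul]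

theorem unwordZero_cons_single (j j' : J) :
    unwordZero k A B M N (cons j (single k (A × B) J j'))
      = single k A W (pairW k A B M N j j') := by
  rw [unwordZero, consLift_cons, LinearMap.compr₂_apply, LinearMap.compl₂_apply, unsingle_single]
  rfl

theorem unwordZero_smul (c : A × B) (t : TensorPow k (A × B) J 1) :
    unwordZero k A B M N (c • t) = c.1 • unwordZero k A B M N t := by
  refine LinearMap.congr_fun (f := unwordZero k A B M N ∘ₗ Algebra.lsmul k k _ c)
    (g := Algebra.lsmul k k _ c.1 ∘ₗ unwordZero k A B M N) (cons_single_ext fun j j' => ?_) t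
  change unwordZero k A B M N (c • cons j (single k (A × B) J j'))
    = c.1 • unwordZero k A B M N (cons j (single k (A × B) J j'))
  rw [smul_cons, unwordZero_cons_single, unwordZero_cons_single, smul_pairW, smul_single]

end Step

/-- The inclusion of `W ⊗_A ⋯ ⊗_A W`, where `W = N ⊗_B M`, in `J ⊗_C ⋯ ⊗_C J`. -/
def wordAux : ∀ m : ℕ, {f : TensorPow k A W m →ₗ[k] TensorPow k (A × B) J (2 * m + 1) //
    ∀ (a : A) t, f (a • t) = ((a, 0) : A × B) • f t}
  | 0 => ⟨pairSingle k A B M N ∘ₗ unsingle k A W, fun a t => by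
      rw [LinearMap.comp_apply, LinearMap.comp_apply, unsingle_smul, smul_pairSingle]⟩
  | m + 1 => ⟨wordSucc (n := 2 * m + 1) (wordAux m).1 (wordAux m).2,
      wordSucc_smul (n := 2 * m + 1) (wordAux m).1 (wordAux m).2⟩

variable (k A B M N) in
/-- The inclusion of `W ⊗_A ⋯ ⊗_A W`, where `W = N ⊗_B M`, in `J ⊗_C ⋯ ⊗_C J`. -/
def word (m : ℕ) : TensorPow k A W m →ₗ[k] TensorPow k (A × B) J (2 * m + 1) := (wordAux m).1

theorem word_smul {m : ℕ} (a : A) (t : TensorPow k A W m) :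
    word k A B M N m (a • t) = ((a, 0) : A × B) • word k A B M N m t := (wordAux m).2 a t

theorem word_single (w : W) : word k A B M N 0 (single k A W w) = pairSingle k A B M N w :=
  congrArg (pairSingle k A B M N) (unsingle_single w)

theorem word_cons {m : ℕ} (w : W) (t : TensorPow k A W m) :
    word k A B M N (m + 1) (cons w t) = consPair k A B M N (2 * m + 1) w (word k A B M N m t) :=
  wordSucc_cons (n := 2 * m + 1) (wordAux m).1 (wordAux m).2 w t

theorem word_op_smul {m : ℕ} (a : A) (t : TensorPow k A W m) :
    word k A B M N m (op a • t) = op ((a, 0) : A × B) • word k A B M N m t := by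
  induction m with
  | zero =>
    obtain ⟨w, rfl⟩ := (single k A W).surjective t
    rw [op_smul_single, word_single, word_single, op_smul_pairSingle]
  | succ m ih =>
    refine LinearMap.congr_fun (f := word k A B M N (m + 1) ∘ₗ Algebra.lsmul k k _ (op a))
      (g := Algebra.lsmul k k (TensorPow k (A × B) J (2 * m + 1 + 2)) (op ((a, 0) : A × B)) ∘ₗ
        word k A B M N (m + 1)) (cons_ext fun w t => ?_) t
    change word k A B M N (m + 1) (op a • cons w t)
      = op ((a, 0) : A × B) • word k A B M N (m + 1) (cons w t)
    rw [op_smul_cons, word_cons, word_cons, ih]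
    exact (op_smul_consPair _ _ _ _).symm

theorem word_snoc {m : ℕ} (t : TensorPow k A W m) (w : W) :
    word k A B M N (m + 1) (snoc t w) = snocPair k A B M N (2 * m + 1) w (word k A B M N m t) := by
  induction m with
  | zero =>
    obtain ⟨v, rfl⟩ := (single k A W).surjective t
    rw [← cons_single, word_cons, word_single, word_single]
    exact consPair_pairSingle v w
  | succ m ih =>
    refine LinearMap.congr_fun (f := word k A B M N (m + 2) ∘ₗ snoc.flip w)
      (g := snocPair k A B M N (2 * m + 1 + 2) w ∘ₗ word k A B M N (m + 1))
        (cons_ext fun v t => ?_) t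
    change word k A B M N (m + 2) (snoc (cons v t) w)
      = snocPair k A B M N (2 * m + 1 + 2) w (word k A B M N (m + 1) (cons v t))
    rw [← cons_snoc, word_cons, word_cons, ih]
    exact consPair_snocPair _ v w _

/-- The projection of `J ⊗_C ⋯ ⊗_C J` to `W ⊗_A ⋯ ⊗_A W`, where `W = N ⊗_B M`. -/
def unwordAux : ∀ m : ℕ, {f : TensorPow k (A × B) J (2 * m + 1) →ₗ[k] TensorPow k A W m //
    ∀ (c : A × B) t, f (c • t) = c.1 • f t}
  | 0 => ⟨unwordZero k A B M N, unwordZero_smul⟩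
  | m + 1 => ⟨unwordSucc (n := 2 * m + 1) (unwordAux m).1 (unwordAux m).2,
      unwordSucc_smul (n := 2 * m + 1) (unwordAux m).1 (unwordAux m).2⟩

variable (k A B M N) in
/-- The projection of `J ⊗_C ⋯ ⊗_C J` to `W ⊗_A ⋯ ⊗_A W`, where `W = N ⊗_B M`. -/
def unword (m : ℕ) : TensorPow k (A × B) J (2 * m + 1) →ₗ[k] TensorPow k A W m := (unwordAux m).1

theorem unword_smul {m : ℕ} (c : A × B) (t : TensorPow k (A × B) J (2 * m + 1)) :
    unword k A B M N m (c • t) = c.1 • unword k A B M N m t := (unwordAux m).2 c t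

theorem unword_cons_single (j j' : J) : unword k A B M N 0 (cons j (single k (A × B) J j'))
    = single k A W (pairW k A B M N j j') :=
  unwordZero_cons_single j j'

theorem unword_cons_cons {m : ℕ} (j j' : J) (t : TensorPow k (A × B) J (2 * m + 1)) :
    unword k A B M N (m + 1) (cons j (cons j' t))
      = cons (pairW k A B M N j j') (unword k A B M N m t) :=
  unwordSucc_cons_cons (n := 2 * m + 1) (unwordAux m).1 (unwordAux m).2 j j' t

theorem unword_op_smul {m : ℕ} (c : A × B) (t : TensorPow k (A × B) J (2 * m + 1)) :
    unword k A B M N m (op c • t) = op c.1 • unword k A B M N m t := by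
  induction m with
  | zero =>
    refine LinearMap.congr_fun (f := unword k A B M N 0 ∘ₗ
        Algebra.lsmul k k (TensorPow k (A × B) J 1) (op c))
      (g := Algebra.lsmul k k _ (op c.1) ∘ₗ unword k A B M N 0)
      (cons_single_ext fun j j' => ?_) t
    change unword k A B M N 0 (op c • cons j (single k (A × B) J j'))
      = op c.1 • unword k A B M N 0 (cons j (single k (A × B) J j'))
    rw [op_smul_cons, op_smul_single, unword_cons_single, unword_cons_single, op_smul_pairW,
      op_smul_single]
  | succ m ih =>
    refine LinearMap.congr_fun (f := unword k A B M N (m + 1) ∘ₗ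
        Algebra.lsmul k k (TensorPow k (A × B) J (2 * m + 1 + 2)) (op c))
      (g := Algebra.lsmul k k _ (op c.1) ∘ₗ unword k A B M N (m + 1))
      (cons_cons_ext fun j j' t => ?_) t
    change unword k A B M N (m + 1) (op c • cons j (cons j' t))
      = op c.1 • unword k A B M N (m + 1) (cons j (cons j' t))
    rw [op_smul_cons, op_smul_cons, unword_cons_cons, unword_cons_cons, ih, op_smul_cons]

theorem unword_consPair {m : ℕ} (w : W) (t : TensorPow k (A × B) J (2 * m + 1)) :
    unword k A B M N (m + 1) (consPair k A B M N (2 * m + 1) w t) = cons w (unword k A B M N m t) :=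
  balTensor_induction (p := unword k A B M N (m + 1) ∘ₗ (consPair k A B M N (2 * m + 1)).flip t)
    (q := cons.flip (unword k A B M N m t)) (fun y x => unword_cons_cons
      (OffDiag.inN k A B M N y) (OffDiag.inM k A B M N x) t) w

theorem unword_pairSingle (w : W) :
    unword k A B M N 0 (pairSingle k A B M N w) = single k A W w :=
  balTensor_induction (p := unword k A B M N 0 ∘ₗ pairSingle k A B M N)
    (q := (single k A W).toLinearMap) (fun y x => unword_cons_single
      (OffDiag.inN k A B M N y) (OffDiag.inM k A B M N x)) w

theorem unword_word {m : ℕ} (t : TensorPow k A W m) :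
    unword k A B M N m (word k A B M N m t) = t := by
  induction m with
  | zero =>
    obtain ⟨w, rfl⟩ := (single k A W).surjective t
    rw [word_single, unword_pairSingle]
  | succ m ih =>
    refine LinearMap.congr_fun (f := unword k A B M N (m + 1) ∘ₗ word k A B M N (m + 1))
      (g := LinearMap.id) (cons_ext fun w t => ?_) t
    change unword k A B M N (m + 1) (word k A B M N (m + 1) (cons w t)) = cons w t
    rw [word_cons, unword_consPair, ih]

theorem cons_idem_smul {n : ℕ} (j j' : J) (t : TensorPow k (A × B) J n) :
    cons (((1, 0) : A × B) • j) (cons (((0, 1) : A × B) • j') t)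
      = ((1, 0) : A × B) • cons j (cons j' t) := by
  rw [← smul_cons ((0, 1) : A × B), ← cons_op_smul, ← OffDiag.idem_left_smul, ← mul_smul,
    smul_cons, Prod.mk_mul_mk, one_mul, zero_mul]

theorem consPair_pairW {n : ℕ} (j j' : J) (t : TensorPow k (A × B) J n) :
    consPair k A B M N n (pairW k A B M N j j') t = ((1, 0) : A × B) • cons j (cons j' t) := by
  rw [pairW_apply, consPair_mk, OffDiag.inN_prN, OffDiag.inM_prM, cons_idem_smul]

theorem pairSingle_pairW (j j' : J) : pairSingle k A B M N (pairW k A B M N j j')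
    = ((1, 0) : A × B) • cons j (single k (A × B) J j') := by
  rw [pairW_apply, pairSingle_mk, OffDiag.inN_prN, OffDiag.inM_prM, ← smul_single,
    ← cons_op_smul, ← OffDiag.idem_left_smul, ← mul_smul, smul_cons,
    Prod.mk_mul_mk, one_mul, zero_mul]

theorem word_unword {m : ℕ} (t : TensorPow k (A × B) J (2 * m + 1)) :
    word k A B M N m (unword k A B M N m t) = ((1, 0) : A × B) • t := by
  induction m with
  | zero =>
    refine LinearMap.congr_fun (f := word k A B M N 0 ∘ₗ unword k A B M N 0)
      (g := Algebra.lsmul k k (TensorPow k (A × B) J 1) ((1, 0) : A × B))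
      (cons_single_ext fun j j' => ?_) t
    change word k A B M N 0 (unword k A B M N 0 (cons j (single k (A × B) J j')))
      = ((1, 0) : A × B) • cons j (single k (A × B) J j')
    rw [unword_cons_single, word_single, pairSingle_pairW]
  | succ m ih =>
    refine LinearMap.congr_fun (f := word k A B M N (m + 1) ∘ₗ unword k A B M N (m + 1))
      (g := Algebra.lsmul k k (TensorPow k (A × B) J (2 * m + 1 + 2)) ((1, 0) : A × B))
      (cons_cons_ext fun j j' t => ?_) t
    change word k A B M N (m + 1) (unword k A B M N (m + 1) (cons j (cons j' t)))
      = ((1, 0) : A × B) • cons j (cons j' t)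
    rw [unword_cons_cons, word_cons, ih, consPair_pairW, ← cons_op_smul,
      ← OffDiag.idem_right_smul, ← smul_cons, ← cons_op_smul, ← OffDiag.idem_left_smul,
      ← smul_cons, ← mul_smul, Prod.mk_mul_mk, one_mul, zero_mul]

theorem rotate_rotate_snocPair {n : ℕ} (w : W) (t : TensorPow k (A × B) J n) :
    rotate k (A × B) J (n + 2) (rotate k (A × B) J (n + 2) (toH0 (snocPair k A B M N n w t)))
      = toH0 (consPair k A B M N n w t) := by
  refine balTensor_induction
    (p := rotate k (A × B) J (n + 2) ∘ₗ rotate k (A × B) J (n + 2) ∘ₗ toH0 ∘ₗ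
      (snocPair k A B M N n).flip t)
    (q := toH0 ∘ₗ (consPair k A B M N n).flip t) (fun y x => ?_) w
  change rotate k (A × B) J (n + 2) (rotate k (A × B) J (n + 2)
      (toH0 (snocPair k A B M N n (BalTensor.mk k B N M (y ⊗ₜ x)) t)))
    = toH0 (consPair k A B M N n (BalTensor.mk k B N M (y ⊗ₜ x)) t)
  rw [snocPair_mk, consPair_mk, rotate_toH0_snoc, cons_snoc, rotate_toH0_snoc]

variable (k A B M N) in
/-- The map induced by `word` on zeroth homology. -/
def cycWord (m : ℕ) :
    H0 k A (TensorPow k A W m) →ₗ[k] H0 k (A × B) (TensorPow k (A × B) J (2 * m + 1)) :=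
  H0Lift (toH0 ∘ₗ word k A B M N m) fun a t => by
    rw [LinearMap.comp_apply, LinearMap.comp_apply, word_smul, word_op_smul, toH0_smul]

variable (k A B M N) in
/-- The map induced by `unword` on zeroth homology. -/
def cycUnword (m : ℕ) :
    H0 k (A × B) (TensorPow k (A × B) J (2 * m + 1)) →ₗ[k] H0 k A (TensorPow k A W m) :=
  H0Lift (toH0 ∘ₗ unword k A B M N m) fun c t => by
    rw [LinearMap.comp_apply, LinearMap.comp_apply, unword_smul, unword_op_smul, toH0_smul]

theorem cycWord_toH0 {m : ℕ} (t : TensorPow k A W m) :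
    cycWord k A B M N m (toH0 t) = toH0 (word k A B M N m t) := rfl

theorem cycUnword_toH0 {m : ℕ} (t : TensorPow k (A × B) J (2 * m + 1)) :
    cycUnword k A B M N m (toH0 t) = toH0 (unword k A B M N m t) := rfl

theorem cycUnword_cycWord {m : ℕ} (u : H0 k A (TensorPow k A W m)) :
    cycUnword k A B M N m (cycWord k A B M N m u) = u := by
  obtain ⟨t, rfl⟩ := toH0_surjective u
  rw [cycWord_toH0, cycUnword_toH0, unword_word]

theorem rotate_rotate_cycWord {m : ℕ} (u : H0 k A (TensorPow k A W m)) :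
    rotate k (A × B) J (2 * m + 1) (rotate k (A × B) J (2 * m + 1) (cycWord k A B M N m u))
      = cycWord k A B M N m (rotate k A W m u) := by
  cases m with
  | zero =>
    have h1 : rotate k A W 0 = 1 := (pow_one _).symm.trans rotate_pow_card
    have h2 := LinearMap.congr_fun (rotate_pow_card (k := k) (A := A × B) (X := J) (m := 1))
      (cycWord k A B M N 0 u)
    rw [h1]
    exact h2
  | succ m =>
    obtain ⟨t, rfl⟩ := toH0_surjective u
    refine LinearMap.congr_fun
      (f := rotate k (A × B) J (2 * m + 1 + 2) ∘ₗ rotate k (A × B) J (2 * m + 1 + 2) ∘ₗ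
        cycWord k A B M N (m + 1) ∘ₗ toH0)
      (g := cycWord k A B M N (m + 1) ∘ₗ rotate k A W (m + 1) ∘ₗ toH0)
      (snoc_ext fun t w => ?_) t
    change rotate k (A × B) J (2 * m + 1 + 2) (rotate k (A × B) J (2 * m + 1 + 2)
        (toH0 (word k A B M N (m + 1) (snoc t w))))
      = cycWord k A B M N (m + 1) (rotate k A W (m + 1) (toH0 (snoc t w)))
    rw [rotate_toH0_snoc, cycWord_toH0, word_snoc, word_cons]
    exact rotate_rotate_snocPair w _

theorem rotate_cycWord_cycUnword {m : ℕ}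
    (v : H0 k (A × B) (TensorPow k (A × B) J (2 * m + 1))) :
    rotate k (A × B) J (2 * m + 1) (cycWord k A B M N m (cycUnword k A B M N m v))
      = rotate k (A × B) J (2 * m + 1) v - cycWord k A B M N m (cycUnword k A B M N m
        (rotate k (A × B) J (2 * m + 1) v)) := by
  obtain ⟨t, rfl⟩ := toH0_surjective v
  refine LinearMap.congr_fun
    (f := rotate k (A × B) J (2 * m + 1) ∘ₗ cycWord k A B M N m ∘ₗ cycUnword k A B M N m ∘ₗ toH0)
    (g := (rotate k (A × B) J (2 * m + 1) - cycWord k A B M N m ∘ₗ cycUnword k A B M N m ∘ₗ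
      rotate k (A × B) J (2 * m + 1)) ∘ₗ toH0) (snoc_ext fun t j => ?_) t
  change rotate k (A × B) J (2 * m + 1) (toH0 (word k A B M N m (unword k A B M N m (snoc t j))))
    = rotate k (A × B) J (2 * m + 1) (toH0 (snoc t j)) - cycWord k A B M N m
      (cycUnword k A B M N m (rotate k (A × B) J (2 * m + 1) (toH0 (snoc t j))))
  rw [rotate_toH0_snoc, cycUnword_toH0, cycWord_toH0, word_unword, word_unword, smul_snoc,
    rotate_toH0_snoc, ← cons_op_smul, ← OffDiag.idem_right_smul, ← smul_cons, ← map_sub]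
  exact congrArg toH0 (eq_sub_of_add_eq ((add_comm _ _).trans (idem_smul_add _ _)))

end Words

end

section

open TensorPow

section SquareRoot

variable {k U V : Type*} [Field k] [AddCommGroup U] [Module k U] [AddCommGroup V] [Module k V]
  {t : Module.End k V} {ρ : Module.End k U} {θ : U →ₗ[k] V} {ψ : V →ₗ[k] U}

theorem off_diagonal_zero (h₁ : ∀ u, ψ (θ u) = u)
    (h₃ : ∀ v, t (θ (ψ v)) = t v - θ (ψ (t v))) (u : U) : ψ (t (θ u)) = 0 := by
  have h := h₃ (θ u)
  rw [h₁, eq_comm, sub_eq_self] at h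
  rw [← h₁ (ψ (t (θ u))), h, map_zero]

theorem square_on_diagonal (h₁ : ∀ u, ψ (θ u) = u) (h₂ : ∀ u, t (t (θ u)) = θ (ρ u))
    (h₃ : ∀ v, t (θ (ψ v)) = t v - θ (ψ (t v))) (v : V) : ρ (ψ v) = ψ (t (t v)) := by
  rw [← h₁ (ρ (ψ v)), ← h₂, h₃, map_sub, h₃, sub_sub_cancel, h₁]

/-- If `V = U ⊕ t U` and `ρ` is the restriction of `t²` to `U`, then the eigenspaces of `t` for
the square roots of `1` are isomorphic to the fixed space of `ρ`. -/
theorem ker_equiv (h₁ : ∀ u, ψ (θ u) = u) (h₂ : ∀ u, t (t (θ u)) = θ (ρ u))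
    (h₃ : ∀ v, t (θ (ψ v)) = t v - θ (ψ (t v))) {ε : k} (hε : ε * ε = 1) :
    Nonempty (LinearMap.ker (t - ε • 1) ≃ₗ[k] LinearMap.ker (ρ - 1)) := by
  have ht (v : LinearMap.ker (t - ε • 1)) : t v = ε • (v : V) :=
    sub_eq_zero.1 (LinearMap.mem_ker.1 v.2)
  have hρ (u : LinearMap.ker (ρ - 1)) : ρ u = (u : U) :=
    sub_eq_zero.1 (LinearMap.mem_ker.1 u.2)
  refine ⟨LinearEquiv.ofLinearMap
    ((ψ ∘ₗ (LinearMap.ker (t - ε • 1)).subtype).codRestrict _ fun v => sub_eq_zero.2 ?_)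
    (((θ + ε • (t ∘ₗ θ)) ∘ₗ (LinearMap.ker (ρ - 1)).subtype).codRestrict _
      fun u => sub_eq_zero.2 ?_) ?_ ?_⟩
  · change ρ (ψ v) = ψ v
    rw [square_on_diagonal h₁ h₂ h₃, ht, map_smul, ht, smul_smul, hε, one_smul]
  · change t (θ u + ε • t (θ u)) = ε • (θ u + ε • t (θ u))
    rw [map_add, map_smul, h₂, hρ, smul_add, smul_smul, hε, one_smul, add_comm]
  · refine LinearMap.ext fun u => Subtype.ext ?_
    change ψ (θ u + ε • t (θ u)) = u
    rw [map_add, map_smul, off_diagonal_zero h₁ h₃, h₁, smul_zero, add_zero]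
  · refine LinearMap.ext fun v => Subtype.ext ?_
    change θ (ψ v) + ε • t (θ (ψ v)) = v
    rw [h₃, ht, map_smul, map_smul, ← smul_sub, smul_smul, hε, one_smul, add_sub_cancel]

/-- If `V = U ⊕ t U` and `ρ` is the restriction of `t²` to `U`, then the cokernel of `t - ε`
for a square root `ε` of `1` is isomorphic to the cokernel of `ρ - 1`. -/
theorem coker_equiv (h₁ : ∀ u, ψ (θ u) = u) (h₂ : ∀ u, t (t (θ u)) = θ (ρ u))
    (h₃ : ∀ v, t (θ (ψ v)) = t v - θ (ψ (t v))) {ε : k} (hε : ε * ε = 1) :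
    Nonempty ((V ⧸ LinearMap.range (t - ε • 1)) ≃ₗ[k] U ⧸ LinearMap.range (ρ - 1)) := by
  have ht (v : V) : (LinearMap.range (t - ε • 1)).mkQ (t v)
      = ε • (LinearMap.range (t - ε • 1)).mkQ v := by
    rw [← map_smul]
    exact (Submodule.Quotient.eq _).2 ⟨v, rfl⟩
  have hρ (u : U) : (LinearMap.range (ρ - 1)).mkQ (ρ u) = (LinearMap.range (ρ - 1)).mkQ u :=
    (Submodule.Quotient.eq _).2 ⟨u, rfl⟩
  refine ⟨LinearEquiv.ofLinearMap
    (Submodule.liftQ _ ((LinearMap.range (ρ - 1)).mkQ ∘ₗ (ψ + ε • (ψ ∘ₗ t))) ?_)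
    (Submodule.liftQ _ ((LinearMap.range (t - ε • 1)).mkQ ∘ₗ θ) ?_)
    (Submodule.linearMap_qext _ (LinearMap.ext fun u => ?_))
    (Submodule.linearMap_qext _ (LinearMap.ext fun v => ?_))⟩
  · rintro _ ⟨v, rfl⟩
    change (LinearMap.range (ρ - 1)).mkQ (ψ (t v - ε • v) + ε • ψ (t (t v - ε • v))) = 0
    rw [map_sub, map_sub, map_sub, ← square_on_diagonal h₁ h₂ h₃, map_smul, map_smul, map_smul,
      map_add, map_smul, map_sub, map_sub, hρ, smul_sub, map_smul, map_smul, smul_smul, hε,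
      one_smul, sub_add_sub_cancel, sub_self]
  · rintro _ ⟨u, rfl⟩
    change (LinearMap.range (t - ε • 1)).mkQ (θ (ρ u - u)) = 0
    rw [map_sub, ← h₂, map_sub, ht, ht, smul_smul, hε, one_smul, sub_self]
  · change (LinearMap.range (ρ - 1)).mkQ (ψ (θ u) + ε • ψ (t (θ u))) = _
    rw [off_diagonal_zero h₁ h₃, h₁, smul_zero, add_zero]
    rfl
  · change (LinearMap.range (t - ε • 1)).mkQ (θ (ψ v + ε • ψ (t v))) = _
    rw [map_add, map_smul, ← sub_eq_iff_eq_add'.2 (sub_eq_iff_eq_add.1 (h₃ v).symm), smul_sub,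
      map_add, map_sub, map_smul, map_smul, ht, ht, smul_smul, smul_smul, hε, one_smul, one_smul,
      add_sub_cancel]
    rfl

end SquareRoot

section CyclicRep

variable {k A X : Type u} [Field k] [Ring A] [Algebra k A]
  [AddCommGroup X] [Module k X] [Module A X] [Module Aᵐᵒᵖ X]
  [IsScalarTower k A X] [IsScalarTower k Aᵐᵒᵖ X] [SMulCommClass A Aᵐᵒᵖ X] {m : ℕ}

theorem cyclicRep_generator :
    cyclicRep k A X m (Multiplicative.ofAdd 1) = rotate k A X m := by
  change rotate k A X m ^ (ZMod.val (1 : ZMod (m + 1))) = _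
  cases m with
  | zero =>
    rw [ZMod.val_one_eq_one_mod, Nat.zero_add, Nat.mod_self, pow_zero]
    exact rotate_pow_card.symm.trans (pow_one _)
  | succ m =>
    have : Fact (1 < m + 1 + 1) := ⟨by omega⟩
    rw [ZMod.val_one, pow_one]

theorem cyclicRep_invariants :
    (cyclicRep k A X m).invariants = LinearMap.ker (rotate k A X m - 1) := by
  refine le_antisymm (fun x hx => ?_) fun x hx g => ?_
  · rw [← cyclicRep_generator]
    exact sub_eq_zero.2 (hx _)
  · have h : rotate k A X m x = x := sub_eq_zero.1 hx
    change (rotate k A X m ^ _) x = x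
    generalize ZMod.val (Multiplicative.toAdd g) = n
    induction n with
    | zero => rfl
    | succ n ih => rw [pow_succ, Module.End.mul_apply, h, ih]

theorem cyclicRep_coinvariants_ker :
    Representation.Coinvariants.ker (cyclicRep k A X m)
      = LinearMap.range (rotate k A X m - 1) := by
  refine le_antisymm (Submodule.span_le.2 ?_) ?_
  · rintro _ ⟨⟨g, x⟩, rfl⟩
    change (rotate k A X m ^ _) x - x ∈ LinearMap.range (rotate k A X m - 1)
    generalize ZMod.val (Multiplicative.toAdd g) = n
    induction n with
    | zero =>
      rw [pow_zero, Module.End.one_apply, sub_self]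
      exact zero_mem _
    | succ n ih =>
      rw [pow_succ', Module.End.mul_apply, ← sub_add_sub_cancel _ ((rotate k A X m ^ n) x)]
      exact add_mem ⟨_, rfl⟩ ih
  · rintro _ ⟨x, rfl⟩
    rw [← cyclicRep_generator]
    exact Representation.Coinvariants.sub_mem_ker (ρ := cyclicRep k A X m) _ x

end CyclicRep

section KoszulTor

variable {k A B M N : Type u} [Field k] [Ring A] [Algebra k A] [Ring B] [Algebra k B]
  [AddCommGroup M] [Module k M] [Module B M] [Module Aᵐᵒᵖ M]
  [IsScalarTower k B M] [IsScalarTower k Aᵐᵒᵖ M] [SMulCommClass B Aᵐᵒᵖ M]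
  [AddCommGroup N] [Module k N] [Module A N] [Module Bᵐᵒᵖ N]
  [IsScalarTower k A N] [IsScalarTower k Bᵐᵒᵖ N] [SMulCommClass A Bᵐᵒᵖ N]

local notation "J" => OffDiag A B M N
local notation "Λ" => NullSquare A B M N

variable (k A B M N) in
/-- The kernel of the product of a null-square algebra, in terms of its off-diagonal part. -/
abbrev kosKernel : BimodCat k Λ := (kosAct k (A × B) J (-1 : k) 0).bimod (nullSquareExt k A B M N)

theorem ker_rotate_equiv (m : ℕ) {ε : k} (hε : ε * ε = 1) :
    Nonempty (LinearMap.ker (rotate k (A × B) J (2 * m + 1) - ε • 1) ≃ₗ[k]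
      (cyclicNM k A B M N m).invariants) := by
  obtain ⟨e⟩ := ker_equiv (cycUnword_cycWord (k := k) (A := A) (B := B) (M := M) (N := N) (m := m))
    rotate_rotate_cycWord rotate_cycWord_cycUnword hε
  exact ⟨e.trans (LinearEquiv.ofEq _ _ (cyclicRep_invariants (k := k) (A := A)
    (X := BalTensor k B N M) (m := m)).symm)⟩

theorem coker_rotate_equiv (m : ℕ) {ε : k} (hε : ε * ε = 1) :
    Nonempty ((H0 k (A × B) (TensorPow k (A × B) J (2 * m + 1)) ⧸
      LinearMap.range (rotate k (A × B) J (2 * m + 1) - ε • 1)) ≃ₗ[k]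
        (cyclicNM k A B M N m).Coinvariants) := by
  obtain ⟨e⟩ := coker_equiv (cycUnword_cycWord (k := k) (A := A) (B := B)
    (M := M) (N := N) (m := m))
    rotate_rotate_cycWord rotate_cycWord_cycUnword hε
  exact ⟨e.trans (Submodule.quotEquivOfEq _ _ (cyclicRep_coinvariants_ker (k := k) (A := A)
    (X := BalTensor k B N M) (m := m)).symm)⟩

variable (k A B M N) in
/-- The sequences that resolve `kosKernel`. -/
def kosSeqs (n : ℕ) : ShortComplex (BimodCat k Λ) :=
  kosSeq (nullSquareExt k A B M N) ((-1 : k) ^ (n + 1)) n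

theorem kosSeqs_succ (n : ℕ) : (kosSeqs k A B M N n).X₁ = (kosSeqs k A B M N (n + 1)).X₃ :=
  congrArg (fun ε : k => (kosAct k (A × B) J ε (n + 1)).bimod (nullSquareExt k A B M N))
    ((neg_one_mul _).symm.trans (pow_succ' (-1 : k) (n + 1)).symm)

theorem kosSeqs_zero : (kosSeqs k A B M N 0).X₃ = kosKernel k A B M N :=
  congrArg (fun ε : k => (kosAct k (A × B) J ε 0).bimod (nullSquareExt k A B M N)) (pow_one _)

theorem sign_mul_sign (n : ℕ) : (-1 : k) ^ n * (-1) ^ n = 1 := by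
  rw [← mul_pow, neg_one_mul, neg_neg, one_pow]

theorem kosSeqs_shortExact (n : ℕ) : (kosSeqs k A B M N n).ShortExact :=
  kosSeq_shortExact (nullSquareExt k A B M N) ((-1 : k) ^ (n + 1)) n

theorem kosSeqs_projective (hM : IsProjectiveBimod k B A M) (hN : IsProjectiveBimod k A B N)
    (n : ℕ) : Projective (kosSeqs k A B M N n).X₂ :=
  have := offDiag_projective k A B M N hM hN
  NullExt.projective_free (n := n) (nullSquareExt k A B M N) (offDiag_bimodLifting k A B M N hM hN)

theorem tor_kosKernel (hM : IsProjectiveBimod k B A M) (hN : IsProjectiveBimod k A B N) (n : ℕ) :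
    Nonempty (TorObj (n + 1) (kosKernel k A B M N) (bimod k Λ Λ) ≃ₗ[k]
      LinearMap.ker (bimodTensorMap (kosSeqs k A B M N n).f (𝟙 (bimod k Λ Λ)))) := by
  obtain ⟨e⟩ := tor_iterated_shift (kosSeqs k A B M N) kosSeqs_shortExact
    (kosSeqs_projective hM hN) kosSeqs_succ (bimod k Λ Λ) n 0
  rw [kosSeqs_zero, Nat.zero_add] at e
  exact ⟨e⟩

theorem tor_kosKernel_odd (hM : IsProjectiveBimod k B A M) (hN : IsProjectiveBimod k A B N)
    (m : ℕ) : Nonempty (TorObj (2 * m + 1) (kosKernel k A B M N) (bimod k Λ Λ) ≃ₗ[k]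
      (cyclicNM k A B M N m).invariants) := by
  obtain ⟨e⟩ := tor_kosKernel hM hN (2 * m)
  have : Subsingleton (H0 k (A × B) (TensorPow k (A × B) J (2 * m + 2))) :=
    subsingleton_H0_even (m + 1)
  obtain ⟨e'⟩ := ker_kosIncl_equiv (nullSquareExt k A B M N) ((-1 : k) ^ (2 * m + 1)) (2 * m)
  obtain ⟨e''⟩ := ker_rotate_equiv (A := A) (B := B) (M := M) (N := N) m
    (sign_mul_sign (k := k) (2 * m + 1))
  exact ⟨(e.trans e').trans e''⟩

theorem kosTensor_even (m : ℕ) {ε : k} (hε : ε * ε = 1) :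
    Nonempty (BimodTensor ((kosAct k (A × B) J ε (2 * m)).bimod (nullSquareExt k A B M N))
      (bimod k Λ Λ) ≃ₗ[k] (cyclicNM k A B M N m).Coinvariants) := by
  obtain ⟨e⟩ := kos_snd_equiv (nullSquareExt k A B M N) ε (2 * m)
  obtain ⟨e'⟩ := coker_rotate_equiv (A := A) (B := B) (M := M) (N := N) m hε
  exact ⟨e.trans e'⟩

theorem tor_kosKernel_even (hM : IsProjectiveBimod k B A M) (hN : IsProjectiveBimod k A B N)
    (m : ℕ) : Nonempty (TorObj (2 * m) (kosKernel k A B M N) (bimod k Λ Λ) ≃ₗ[k]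
      (cyclicNM k A B M N m).Coinvariants) := by
  cases m with
  | zero =>
    obtain ⟨e⟩ := kosTensor_even (A := A) (B := B) (M := M) (N := N) 0
      ((neg_one_mul (-1 : k)).trans (neg_neg 1))
    exact ⟨(torZeroEquiv _ _).trans e⟩
  | succ m =>
    obtain ⟨e⟩ := tor_kosKernel hM hN (2 * m + 1)
    have : Subsingleton (H0 k (A × B) (TensorPow k (A × B) J (2 * m + 1 + 1))) :=
      subsingleton_H0_even (m + 1)
    have h : LinearMap.ker (bimodTensorMap (kosSeqs k A B M N (2 * m + 1)).f (𝟙 (bimod k Λ Λ)))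
        = ⊤ := LinearMap.ker_eq_top.2
      (kosIncl_tensor_eq_zero (nullSquareExt k A B M N) ((-1 : k) ^ (2 * m + 2)) (2 * m + 1))
    have hε : -(-1 : k) ^ (2 * m + 2) * -(-1) ^ (2 * m + 2) = 1 :=
      (neg_mul_neg _ _).trans (sign_mul_sign _)
    obtain ⟨e'⟩ := kosTensor_even (A := A) (B := B) (M := M) (N := N) (m + 1) hε
    exact ⟨(e.trans (LinearEquiv.ofTop _ h)).trans e'⟩

end KoszulTor

end

section

open TensorPow

section NullExt

variable {k C J L : Type u} [Field k] [Ring C] [Algebra k C] [Ring L] [Algebra k L]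
  [AddCommGroup J] [Module k J] [Module C J] [Module Cᵐᵒᵖ J] (D : NullExt k C J L)

theorem NullExt.tail_mul_incl (x : L) (c : C) : D.tail (x * D.incl c) = op c • D.tail x := by
  rw [D.tail_mul, D.tail_incl, D.proj_incl, smul_zero, zero_add]

theorem NullExt.tail_incl_mul (c : C) (x : L) : D.tail (D.incl c * x) = c • D.tail x := by
  rw [D.tail_mul, D.tail_incl, D.proj_incl, smul_zero, add_zero]

theorem NullExt.tail_one : D.tail 1 = 0 := by
  rw [← map_one D.incl, D.tail_incl]

theorem NullExt.mul_decomp (x y : L) :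
    x * y = x * D.incl (D.proj y) + D.incl (D.proj x) * D.emb (D.tail y) := by
  have h : x * D.emb (D.tail y) = D.incl (D.proj x) * D.emb (D.tail y) := by
    nth_rw 1 [← D.decomp x]
    rw [add_mul, D.emb_mul_emb, add_zero]
  nth_rw 1 [← D.decomp y]
  rw [mul_add, h]

end NullExt

section RelativeKernel

variable {k A B M N : Type u} [Field k] [Ring A] [Algebra k A] [Ring B] [Algebra k B]
  [AddCommGroup M] [Module k M] [Module B M] [Module Aᵐᵒᵖ M]
  [IsScalarTower k B M] [IsScalarTower k Aᵐᵒᵖ M] [SMulCommClass B Aᵐᵒᵖ M]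
  [AddCommGroup N] [Module k N] [Module A N] [Module Bᵐᵒᵖ N]
  [IsScalarTower k A N] [IsScalarTower k Bᵐᵒᵖ N] [SMulCommClass A Bᵐᵒᵖ N]

local notation "J" => OffDiag A B M N
local notation "Λ" => NullSquare A B M N
local notation "D" => nullSquareExt k A B M N

variable (k A B M N) in
/-- The canonical bilinear map to the relative tensor product. -/
def relPair : Λ →ₗ[k] Λ →ₗ[k] BalTensor k (A × B) Λ Λ :=
  (TensorProduct.mk k Λ Λ).compr₂ (BalTensor.mk k (A × B) Λ Λ)

theorem relPair_mul_incl (x y : Λ) (c : A × B) :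
    relPair k A B M N (x * NullExt.incl D c) y = relPair k A B M N x (NullExt.incl D c * y) :=
  BalTensor.mk_smul (k := k) x c y

theorem smul_relPair (r x y : Λ) : r • relPair k A B M N x y = relPair k A B M N (r * x) y := rfl

theorem op_smul_relPair (r x y : Λ) :
    op r • relPair k A B M N x y = relPair k A B M N x (y * r) := rfl

theorem relMulLin_relPair (x y : Λ) : relMulLin k A B M N (relPair k A B M N x y) = x * y := rfl

variable (k A B M N) in
/-- The map `j ⊗ j' ↦ j ⊗ j'`. -/
def relTwo : TensorPow k (A × B) J 1 →ₗ[k] BalTensor k (A × B) Λ Λ :=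
  consLift ((relPair k A B M N).compl₁₂ (NullExt.emb D)
    (NullExt.emb D ∘ₗ unsingle k (A × B) J)) fun c j t => by
      change relPair k A B M N (NullExt.emb D (op c • j)) (NullExt.emb D (unsingle k (A × B) J t))
        = relPair k A B M N (NullExt.emb D j) (NullExt.emb D (unsingle k (A × B) J (c • t)))
      rw [unsingle_smul, NullExt.emb_smul, NullExt.emb_op_smul, relPair_mul_incl]

theorem relTwo_cons (j : J) (t : TensorPow k (A × B) J 0) : relTwo k A B M N (cons j t)
    = relPair k A B M N (NullExt.emb D j) (NullExt.emb D (unsingle k (A × B) J t)) := by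
  rw [relTwo, consLift_cons]
  rfl

variable (k A B M N) in
/-- The map `j ↦ 1 ⊗ j - j ⊗ 1`. -/
def relOneSub : J →ₗ[k] BalTensor k (A × B) Λ Λ :=
  relPair k A B M N 1 ∘ₗ NullExt.emb D - (relPair k A B M N).flip 1 ∘ₗ NullExt.emb D

theorem relOneSub_apply (j : J) : relOneSub k A B M N j
    = relPair k A B M N 1 (NullExt.emb D j) - relPair k A B M N (NullExt.emb D j) 1 := rfl

theorem relOneSub_smul (c : A × B) (j : J) :
    relOneSub k A B M N (c • j) = NullExt.incl D c • relOneSub k A B M N j := by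
  rw [relOneSub_apply, relOneSub_apply, smul_sub, smul_relPair, smul_relPair, NullExt.emb_smul,
    ← relPair_mul_incl, one_mul, mul_one]

theorem relOneSub_op_smul (c : A × B) (j : J) :
    relOneSub k A B M N (op c • j) = op (NullExt.incl D c) • relOneSub k A B M N j := by
  rw [relOneSub_apply, relOneSub_apply, smul_sub, op_smul_relPair, op_smul_relPair,
    NullExt.emb_op_smul, relPair_mul_incl, one_mul, mul_one]

theorem emb_smul_relOneSub (i j : J) : NullExt.emb D i • relOneSub k A B M N j
    = relPair k A B M N (NullExt.emb D i) (NullExt.emb D j) := by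
  rw [relOneSub_apply, smul_sub, smul_relPair, smul_relPair, NullExt.emb_mul_emb, mul_one,
    map_zero, LinearMap.zero_apply, sub_zero]

theorem op_emb_smul_relOneSub (i j : J) : op (NullExt.emb D i) • relOneSub k A B M N j
    = -relPair k A B M N (NullExt.emb D j) (NullExt.emb D i) := by
  rw [relOneSub_apply, smul_sub, op_smul_relPair, op_smul_relPair, NullExt.emb_mul_emb, one_mul,
    map_zero, zero_sub]

theorem relTwo_ind {S : Type u} [AddCommGroup S] [Module k S]
    {f g : TensorPow k (A × B) J 1 →ₗ[k] S}
    (h : ∀ j j', f (cons j (single k (A × B) J j')) = g (cons j (single k (A × B) J j')))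
    (t : TensorPow k (A × B) J 1) : f t = g t :=
  LinearMap.congr_fun (cons_single_ext h) t

theorem relTwo_single (j j' : J) : relTwo k A B M N (cons j (single k (A × B) J j'))
    = relPair k A B M N (NullExt.emb D j) (NullExt.emb D j') := by
  rw [relTwo_cons, unsingle_single]

theorem relTwo_smul (c : A × B) (t : TensorPow k (A × B) J 1) :
    relTwo k A B M N (c • t) = NullExt.incl D c • relTwo k A B M N t := by
  refine relTwo_ind (f := relTwo k A B M N ∘ₗ Algebra.lsmul k k _ c)
    (g := Algebra.lsmul k k _ (NullExt.incl D c) ∘ₗ relTwo k A B M N) (fun j j' => ?_) t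
  change relTwo k A B M N (c • cons j (single k (A × B) J j'))
    = NullExt.incl D c • relTwo k A B M N (cons j (single k (A × B) J j'))
  rw [smul_cons, relTwo_single, relTwo_single, smul_relPair, NullExt.emb_smul]

theorem relTwo_op_smul (c : A × B) (t : TensorPow k (A × B) J 1) :
    relTwo k A B M N (op c • t) = op (NullExt.incl D c) • relTwo k A B M N t := by
  refine relTwo_ind (f := relTwo k A B M N ∘ₗ Algebra.lsmul k k _ (op c))
    (g := Algebra.lsmul k k _ (op (NullExt.incl D c)) ∘ₗ relTwo k A B M N) (fun j j' => ?_) t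
  change relTwo k A B M N (op c • cons j (single k (A × B) J j'))
    = op (NullExt.incl D c) • relTwo k A B M N (cons j (single k (A × B) J j'))
  rw [op_smul_cons, op_smul_single, relTwo_single, relTwo_single, op_smul_relPair,
    NullExt.emb_op_smul]

theorem emb_smul_relTwo (i : J) (t : TensorPow k (A × B) J 1) :
    NullExt.emb D i • relTwo k A B M N t = 0 := by
  refine relTwo_ind (f := Algebra.lsmul k k _ (NullExt.emb D i) ∘ₗ relTwo k A B M N) (g := 0)
    (fun j j' => ?_) t
  change NullExt.emb D i • relTwo k A B M N (cons j (single k (A × B) J j')) = 0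
  rw [relTwo_single, smul_relPair, NullExt.emb_mul_emb, map_zero, LinearMap.zero_apply]

theorem op_emb_smul_relTwo (i : J) (t : TensorPow k (A × B) J 1) :
    op (NullExt.emb D i) • relTwo k A B M N t = 0 := by
  refine relTwo_ind (f := Algebra.lsmul k k _ (op (NullExt.emb D i)) ∘ₗ relTwo k A B M N)
    (g := 0) (fun j j' => ?_) t
  change op (NullExt.emb D i) • relTwo k A B M N (cons j (single k (A × B) J j')) = 0
  rw [relTwo_single, op_smul_relPair, NullExt.emb_mul_emb, map_zero]

variable (k A B M N) in
/-- The map `(j, t) ↦ 1 ⊗ j - j ⊗ 1 + t`. -/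
def relIncl : TensorPow k (A × B) J 0 × TensorPow k (A × B) J 1 →ₗ[k]
    BalTensor k (A × B) Λ Λ :=
  (relOneSub k A B M N ∘ₗ unsingle k (A × B) J).coprod (relTwo k A B M N)

theorem relIncl_apply (x : J) (y : TensorPow k (A × B) J 1) :
    relIncl k A B M N (single k (A × B) J x, y) = relOneSub k A B M N x + relTwo k A B M N y :=
  congrArg (fun z => relOneSub k A B M N z + relTwo k A B M N y) (unsingle_single x)

variable (k A B M N) in
/-- The retraction `x ⊗ y ↦ (c(x) j(y), j(x) ⊗ j(y))`. -/
def relRetract : BalTensor k (A × B) Λ Λ →ₗ[k]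
    TensorPow k (A × B) J 0 × TensorPow k (A × B) J 1 :=
  BalTensor.lift (TensorProduct.lift (LinearMap.mk₂ k
    (fun x y => (single k (A × B) J (NullExt.proj D x • NullExt.tail D y),
      cons (NullExt.tail D x) (single k (A × B) J (NullExt.tail D y))))
    (fun x x' y => by
      rw [map_add, map_add, add_smul, map_add, map_add, LinearMap.add_apply, Prod.mk_add_mk])
    (fun c x y => Prod.ext
      (by rw [map_smul (NullExt.proj D), smul_assoc, LinearEquiv.map_smul, Prod.smul_fst])
      (by rw [LinearMap.map_smul, LinearMap.map_smul, LinearMap.smul_apply, Prod.smul_snd]))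
    (fun x y y' => by
      rw [map_add, smul_add, map_add, map_add, map_add, Prod.mk_add_mk])
    (fun c x y => Prod.ext
      (by rw [LinearMap.map_smul, smul_comm, LinearEquiv.map_smul, Prod.smul_fst])
      (by rw [LinearMap.map_smul, LinearEquiv.map_smul, LinearMap.map_smul, Prod.smul_snd]))))
    fun x c y => Prod.ext
      (by
        change single k (A × B) J (NullExt.proj D (x * NullExt.incl D c) • NullExt.tail D y)
          = single k (A × B) J (NullExt.proj D x • NullExt.tail D (NullExt.incl D c * y))
        rw [map_mul, NullExt.tail_incl_mul, NullExt.proj_incl, mul_smul])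
      (by
        change cons (NullExt.tail D (x * NullExt.incl D c)) (single k (A × B) J (NullExt.tail D y))
          = cons (NullExt.tail D x) (single k (A × B) J (NullExt.tail D (NullExt.incl D c * y)))
        rw [NullExt.tail_incl_mul, NullExt.tail_mul_incl, cons_op_smul, smul_single])

theorem relRetract_relPair (x y : Λ) : relRetract k A B M N (relPair k A B M N x y)
    = (single k (A × B) J (NullExt.proj D x • NullExt.tail D y),
      cons (NullExt.tail D x) (single k (A × B) J (NullExt.tail D y))) := rfl

theorem relRetract_relOneSub (j : J) :
    relRetract k A B M N (relOneSub k A B M N j) = (single k (A × B) J j, 0) := by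
  rw [relOneSub_apply, map_sub, relRetract_relPair, relRetract_relPair, NullExt.tail_one, map_one,
    NullExt.tail_emb, map_zero, map_zero, one_smul, smul_zero, map_zero, LinearMap.zero_apply,
    map_zero, Prod.mk_sub_mk, sub_zero, sub_zero]

theorem relRetract_relTwo (t : TensorPow k (A × B) J 1) :
    relRetract k A B M N (relTwo k A B M N t) = (0, t) := by
  refine relTwo_ind (f := relRetract k A B M N ∘ₗ relTwo k A B M N) (g := LinearMap.inr k _ _)
    (fun j j' => ?_) t
  change relRetract k A B M N (relTwo k A B M N (cons j (single k (A × B) J j')))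
    = (0, cons j (single k (A × B) J j'))
  rw [relTwo_single, relRetract_relPair, NullExt.tail_emb, NullExt.tail_emb, NullExt.proj_emb,
    zero_smul, map_zero]

theorem relRetract_relIncl (z : TensorPow k (A × B) J 0 × TensorPow k (A × B) J 1) :
    relRetract k A B M N (relIncl k A B M N z) = z := by
  obtain ⟨x, y⟩ := z
  obtain ⟨x, rfl⟩ := (single k (A × B) J).surjective x
  rw [relIncl_apply, map_add, relRetract_relOneSub, relRetract_relTwo, Prod.mk_add_mk, add_zero,
    zero_add]

theorem relMulLin_relIncl (z : TensorPow k (A × B) J 0 × TensorPow k (A × B) J 1) :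
    relMulLin k A B M N (relIncl k A B M N z) = 0 := by
  obtain ⟨x, y⟩ := z
  obtain ⟨x, rfl⟩ := (single k (A × B) J).surjective x
  have h : relMulLin k A B M N (relTwo k A B M N y) = 0 :=
    relTwo_ind (f := relMulLin k A B M N ∘ₗ relTwo k A B M N) (g := 0) (fun j j' =>
      (congrArg (relMulLin k A B M N) (relTwo_single j j')).trans
        (NullExt.emb_mul_emb D j j')) y
  rw [relIncl_apply, map_add, h, relOneSub_apply, map_sub, relMulLin_relPair, relMulLin_relPair,
    one_mul, mul_one, sub_self, add_zero]

theorem relIncl_relRetract (z : BalTensor k (A × B) Λ Λ) :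
    relIncl k A B M N (relRetract k A B M N z) + relPair k A B M N (relMulLin k A B M N z) 1
      = z := by
  refine LinearMap.congr_fun (f := relIncl k A B M N ∘ₗ relRetract k A B M N +
    (relPair k A B M N).flip 1 ∘ₗ relMulLin k A B M N) (g := LinearMap.id)
    (BalTensor.hom_ext fun x y => ?_) z
  change relIncl k A B M N (relRetract k A B M N (relPair k A B M N x y))
    + relPair k A B M N (relMulLin k A B M N (relPair k A B M N x y)) 1 = relPair k A B M N x y
  rw [relRetract_relPair, relIncl_apply, relTwo_single, relOneSub_apply, NullExt.emb_smul,
    ← relPair_mul_incl, one_mul, relMulLin_relPair, sub_add_eq_add_sub, ← LinearMap.add_apply,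
    ← map_add, NullExt.decomp, NullExt.mul_decomp D x y, map_add, LinearMap.add_apply,
    relPair_mul_incl, mul_one, sub_add_add_cancel, ← map_add, add_comm (NullExt.emb D _),
    NullExt.decomp]

variable (k A B M N) in
/-- The embedding of `kosKernel` in the relative tensor product. -/
def kosKernelHom : kosKernel k A B M N ⟶ relTensor k A B M N :=
  NullAct.homOf D ((bimodIn k Λ (BalTensor k (A × B) Λ Λ)).toLinearMap ∘ₗ relIncl k A B M N)
    (fun c z => by
      obtain ⟨x, y⟩ := z
      obtain ⟨x, rfl⟩ := (single k (A × B) J).surjective x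
      change bimodIn k Λ _ (relIncl k A B M N (c • single k (A × B) J x, c • y))
        = NullExt.incl D c • bimodIn k Λ _ (relIncl k A B M N (single k (A × B) J x, y))
      rw [smul_bimodIn, smul_single, relIncl_apply, relIncl_apply, relOneSub_smul, relTwo_smul,
        smul_add])
    (fun c z => by
      obtain ⟨x, y⟩ := z
      obtain ⟨x, rfl⟩ := (single k (A × B) J).surjective x
      change bimodIn k Λ _ (relIncl k A B M N (op c • single k (A × B) J x, op c • y))
        = op (NullExt.incl D c) • bimodIn k Λ _ (relIncl k A B M N (single k (A × B) J x, y))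
      rw [op_smul_bimodIn, op_smul_single, relIncl_apply, relIncl_apply, relOneSub_op_smul,
        relTwo_op_smul, smul_add])
    (fun j z => by
      obtain ⟨x, y⟩ := z
      obtain ⟨x, rfl⟩ := (single k (A × B) J).surjective x
      have h := relIncl_apply (k := k) 0 (cons j (single k (A × B) J x))
      rw [map_zero] at h
      change bimodIn k Λ _ (relIncl k A B M N (0, cons j (single k (A × B) J x)))
        = NullExt.emb D j • bimodIn k Λ _ (relIncl k A B M N (single k (A × B) J x, y))
      rw [smul_bimodIn, h, relIncl_apply, map_zero, zero_add, smul_add, emb_smul_relOneSub,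
        emb_smul_relTwo, add_zero, relTwo_single])
    (fun j z => by
      obtain ⟨x, y⟩ := z
      obtain ⟨x, rfl⟩ := (single k (A × B) J).surjective x
      have h := relIncl_apply (k := k) 0 ((-1 : k) • snoc (single k (A × B) J x) j)
      rw [map_zero] at h
      change bimodIn k Λ _ (relIncl k A B M N (0, (-1 : k) • snoc (single k (A × B) J x) j))
        = op (NullExt.emb D j) • bimodIn k Λ _ (relIncl k A B M N (single k (A × B) J x, y))
      rw [op_smul_bimodIn, h, relIncl_apply, map_zero, zero_add, smul_add, op_emb_smul_relOneSub,
        op_emb_smul_relTwo, add_zero, map_smul, ← cons_single, relTwo_single, neg_one_smul])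

theorem kosKernelHom_cls (z : TensorPow k (A × B) J 0 × TensorPow k (A × B) J 1) :
    kosKernelHom k A B M N ((kosAct k (A × B) J (-1 : k) 0).cls D z)
      = bimodIn k Λ _ (relIncl k A B M N z) := NullAct.homOf_cls _ _ _ _ _ _ _

theorem relMul_bimodIn (z : BalTensor k (A × B) Λ Λ) :
    relMul k A B M N (bimodIn k Λ _ z) = bimodIn k Λ _ (relMulLin k A B M N z) := rfl

variable (k A B M N) in
/-- The kernel of the product map in terms of the off-diagonal part. -/
def relSeqKernelIso : kosKernel k A B M N ≅ (relSeq k A B M N).X₁ :=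
  (LinearEquiv.ofBijective ((kosKernelHom k A B M N).hom.codRestrict
    (LinearMap.ker (relMul k A B M N).hom) fun x => by
      obtain ⟨z, rfl⟩ := ((kosAct k (A × B) J (-1 : k) 0).cls D).surjective x
      refine LinearMap.mem_ker.2 ((congrArg (relMul k A B M N) (kosKernelHom_cls z)).trans ?_)
      rw [relMul_bimodIn, relMulLin_relIncl, map_zero]) <| by
    refine ⟨fun x y h => ?_, fun x => ?_⟩
    · obtain ⟨x, rfl⟩ := ((kosAct k (A × B) J (-1 : k) 0).cls D).surjective x
      obtain ⟨y, rfl⟩ := ((kosAct k (A × B) J (-1 : k) 0).cls D).surjective y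
      have h' := (kosKernelHom_cls x).symm.trans
        ((congrArg Subtype.val h).trans (kosKernelHom_cls y))
      rw [← relRetract_relIncl x, (bimodIn k Λ _).injective h', relRetract_relIncl]
    · obtain ⟨x, hx⟩ := x
      obtain ⟨z, rfl⟩ := (bimodIn k Λ (BalTensor k (A × B) Λ Λ)).surjective x
      have h0 : relMulLin k A B M N z = 0 := LinearMap.mem_ker.1 hx
      refine ⟨(kosAct k (A × B) J (-1 : k) 0).cls D (relRetract k A B M N z), Subtype.ext ?_⟩
      refine (kosKernelHom_cls _).trans (congrArg (bimodIn k Λ (BalTensor k (A × B) Λ Λ)) ?_)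
      have h := relIncl_relRetract z
      rwa [h0, map_zero, LinearMap.zero_apply, add_zero] at h).toModuleIso

theorem relSeq_shortExact : (relSeq k A B M N).ShortExact where
  exact := (ShortComplex.moduleCat_exact_iff _).2 fun x hx => ⟨⟨x, hx⟩, rfl⟩
  mono_f := (ModuleCat.mono_iff_injective _).2 Subtype.val_injective
  epi_g := (ModuleCat.epi_iff_surjective _).2 fun x => by
    obtain ⟨x, rfl⟩ := (bimodIn k Λ Λ).surjective x
    refine ⟨bimodIn k Λ (BalTensor k (A × B) Λ Λ) (relPair k A B M N x 1), ?_⟩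
    refine (relMul_bimodIn _).trans (congrArg (bimodIn k Λ Λ) ?_)
    rw [relMulLin_relPair, mul_one]

variable (k A B M N) in
/-- The homology of the kernel of the product map in terms of the off-diagonal part. -/
def torRelKernelEquiv (n : ℕ) : TorObj n (relSeq k A B M N).X₁ (bimod k Λ Λ) ≃ₗ[k]
    TorObj n (kosKernel k A B M N) (bimod k Λ Λ) :=
  (((tor k Λ n).mapIso (relSeqKernelIso k A B M N).symm).app (bimod k Λ Λ)).toLinearEquiv

end RelativeKernel

end

section Conjugate

variable {k : Type*} [Field k] {X Y Z X' Y' Z' : Type*}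
  [AddCommGroup X] [Module k X] [AddCommGroup Y] [Module k Y] [AddCommGroup Z] [Module k Z]
  [AddCommGroup X'] [Module k X'] [AddCommGroup Y'] [Module k Y'] [AddCommGroup Z'] [Module k Z']

theorem exact_conj {f : X → Y} {g : Y → Z} (h : Function.Exact f g) (a : X ≃ X') (b : Y ≃ₗ[k] Y')
    (c : Z ≃ₗ[k] Z') {f' : X' → Y'} {g' : Y' → Z'} (hf : ∀ x, f' (a x) = b (f x))
    (hg : ∀ y, g' (b y) = c (g y)) : Function.Exact f' g' := by
  intro y'
  obtain ⟨y, rfl⟩ := b.surjective y'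
  rw [hg, LinearEquiv.map_eq_zero_iff, h y]
  constructor
  · rintro ⟨x, rfl⟩
    exact ⟨a x, hf x⟩
  · rintro ⟨x', hx⟩
    obtain ⟨x, rfl⟩ := a.surjective x'
    exact ⟨x, b.injective ((hf x).symm.trans hx)⟩

end Conjugate

section KernelTor

variable {k A B M N : Type u} [Field k] [Ring A] [Algebra k A] [Ring B] [Algebra k B]
  [AddCommGroup M] [Module k M] [Module B M] [Module Aᵐᵒᵖ M]
  [IsScalarTower k B M] [IsScalarTower k Aᵐᵒᵖ M] [SMulCommClass B Aᵐᵒᵖ M]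
  [AddCommGroup N] [Module k N] [Module A N] [Module Bᵐᵒᵖ N]
  [IsScalarTower k A N] [IsScalarTower k Bᵐᵒᵖ N] [SMulCommClass A Bᵐᵒᵖ N]

theorem tor_relTensor (hM : IsProjectiveBimod k B A M) (hN : IsProjectiveBimod k A B N) (n : ℕ) :
    Nonempty (TorObj n (relTensor k A B M N)
      (bimod k (NullSquare A B M N) (NullSquare A B M N)) ≃ₗ[k] HH k A n × HH k B n) := by
  have := projective_left k A Bᵐᵒᵖ N hN
  have := projective_right k A Bᵐᵒᵖ N hN
  have := projective_left k B Aᵐᵒᵖ M hM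
  have := projective_right k B Aᵐᵒᵖ M hM
  exact tor_relTensor_equiv n

theorem tor_relKernel_odd (hM : IsProjectiveBimod k B A M) (hN : IsProjectiveBimod k A B N)
    (m : ℕ) : Nonempty (TorObj (2 * m + 1) (relSeq k A B M N).X₁
      (bimod k (NullSquare A B M N) (NullSquare A B M N)) ≃ₗ[k]
        (cyclicNM k A B M N m).invariants) :=
  (tor_kosKernel_odd hM hN m).map fun e => (torRelKernelEquiv k A B M N _).trans e

theorem tor_relKernel_even (hM : IsProjectiveBimod k B A M) (hN : IsProjectiveBimod k A B N)
    (m : ℕ) : Nonempty (TorObj (2 * m) (relSeq k A B M N).X₁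
      (bimod k (NullSquare A B M N) (NullSquare A B M N)) ≃ₗ[k]
        (cyclicNM k A B M N m).Coinvariants) :=
  (tor_kosKernel_even hM hN m).map fun e => (torRelKernelEquiv k A B M N _).trans e

end KernelTor

end

end NullSquareHH

theorem mainTheorem5 (k A B M N : Type u) [Field k] [Ring A] [Algebra k A] [Ring B] [Algebra k B]
    [AddCommGroup M] [Module k M] [Module B M] [Module Aᵐᵒᵖ M]
    [IsScalarTower k B M] [IsScalarTower k Aᵐᵒᵖ M] [SMulCommClass B Aᵐᵒᵖ M]
    [AddCommGroup N] [Module k N] [Module A N] [Module Bᵐᵒᵖ N]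
    [IsScalarTower k A N] [IsScalarTower k Bᵐᵒᵖ N] [SMulCommClass A Bᵐᵒᵖ N]
    (hM : IsProjectiveBimod k B A M) (hN : IsProjectiveBimod k A B N) :
    -- the sequence `0 → K → Λ ⊗_C Λ → Λ → 0` is exact
    (relSeq k A B M N).ShortExact ∧
    ∃ -- the maps of the long exact sequence
      (iOdd : ∀ m, (cyclicNM k A B M N m).invariants →ₗ[k]
        HH k A (2 * m + 1) × HH k B (2 * m + 1))
      (iEven : ∀ m, (cyclicNM k A B M N m).Coinvariants →ₗ[k] HH k A (2 * m) × HH k B (2 * m))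
      (p : ∀ n, HH k A n × HH k B n →ₗ[k] HH k (NullSquare A B M N) n)
      (dOdd : ∀ m, HH k (NullSquare A B M N) (2 * m + 1) →ₗ[k]
        (cyclicNM k A B M N m).Coinvariants)
      (dEven : ∀ m, HH k (NullSquare A B M N) (2 * m + 2) →ₗ[k]
        (cyclicNM k A B M N m).invariants),
      -- exactness
      (∀ m, Function.Exact (dEven m) (iOdd m)) ∧
      (∀ m, Function.Exact (iOdd m) (p (2 * m + 1))) ∧
      (∀ m, Function.Exact (p (2 * m + 1)) (dOdd m)) ∧
      (∀ m, Function.Exact (dOdd m) (iEven m)) ∧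
      (∀ m, Function.Exact (iEven m) (p (2 * m))) ∧
      (∀ m, Function.Exact (p (2 * m + 2)) (dEven m)) ∧
      Function.Surjective (p 0) ∧
      -- it is the long exact sequence of `Tor^{Λ-Λ}(-, Λ)` for `0 → K → Λ ⊗_C Λ → Λ → 0`
      ∃ (κOdd : ∀ m, ((tor k (NullSquare A B M N) (2 * m + 1)).obj (relSeq k A B M N).X₁).obj
            (bimod k (NullSquare A B M N) (NullSquare A B M N)) ≃ₗ[k]
          (cyclicNM k A B M N m).invariants)
        (κEven : ∀ m, ((tor k (NullSquare A B M N) (2 * m)).obj (relSeq k A B M N).X₁).obj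
            (bimod k (NullSquare A B M N) (NullSquare A B M N)) ≃ₗ[k]
          (cyclicNM k A B M N m).Coinvariants)
        (φ : ∀ n, ((tor k (NullSquare A B M N) n).obj (relSeq k A B M N).X₂).obj
            (bimod k (NullSquare A B M N) (NullSquare A B M N)) ≃ₗ[k] HH k A n × HH k B n)
        (δ : ∀ n, HH k (NullSquare A B M N) (n + 1) ⟶
          ((tor k (NullSquare A B M N) n).obj (relSeq k A B M N).X₁).obj
            (bimod k (NullSquare A B M N) (NullSquare A B M N))),
        (∀ n, IsTorConnecting (relSeq k A B M N)
          (bimod k (NullSquare A B M N) (NullSquare A B M N)) n (δ n)) ∧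
        (∀ m x, iOdd m (κOdd m x) = φ (2 * m + 1)
          ((((tor k (NullSquare A B M N) (2 * m + 1)).map (relSeq k A B M N).f).app _).hom x)) ∧
        (∀ m x, iEven m (κEven m x) = φ (2 * m)
          ((((tor k (NullSquare A B M N) (2 * m)).map (relSeq k A B M N).f).app _).hom x)) ∧
        (∀ n x, p n (φ n x) =
          (((tor k (NullSquare A B M N) n).map (relSeq k A B M N).g).app _).hom x) ∧
        (∀ m x, dOdd m x = κEven m ((δ (2 * m)).hom x)) ∧
        (∀ m x, dEven m x = κOdd m ((δ (2 * m + 1)).hom x)) := by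
  let Y := bimod k (NullSquare A B M N) (NullSquare A B M N)
  have hS := relSeq_shortExact (k := k) (A := A) (B := B) (M := M) (N := N)
  let κOdd := fun m => (tor_relKernel_odd hM hN m).some
  let κEven := fun m => (tor_relKernel_even hM hN m).some
  let φ := fun n => (tor_relTensor hM hN n).some
  let f := fun n => (torMap n (relSeq k A B M N).f Y).hom
  let p := fun n => (torMap n (relSeq k A B M N).g Y).hom ∘ₗ (φ n).symm.toLinearMap
  let δ := fun n => torδ hS Y n
  have hp (n) (x) : p n (φ n x) = (torMap n (relSeq k A B M N).g Y).hom x :=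
    congrArg (torMap n (relSeq k A B M N).g Y).hom ((φ n).symm_apply_apply x)
  have hO (m) (x) : φ (2 * m + 1) (f (2 * m + 1) ((κOdd m).symm (κOdd m x))) =
    φ (2 * m + 1) (f (2 * m + 1) x) :=
    congrArg (fun z => φ (2 * m + 1) (f (2 * m + 1) z)) ((κOdd m).symm_apply_apply x)
  have hE (m) (x) : φ (2 * m) (f (2 * m) ((κEven m).symm (κEven m x))) = φ (2 * m) (f (2 * m) x) :=
    congrArg (fun z => φ (2 * m) (f (2 * m) z)) ((κEven m).symm_apply_apply x)
  refine ⟨hS, fun m => (φ (2 * m + 1)).toLinearMap ∘ₗ f (2 * m + 1) ∘ₗ (κOdd m).symm.toLinearMap,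
    fun m => (φ (2 * m)).toLinearMap ∘ₗ f (2 * m) ∘ₗ (κEven m).symm.toLinearMap, p,
    fun m => (κEven m).toLinearMap ∘ₗ (δ (2 * m)).hom,
    fun m => (κOdd m).toLinearMap ∘ₗ (δ (2 * m + 1)).hom,
    fun m => ?_, fun m => ?_, fun m => ?_, fun m => ?_, fun m => ?_, fun m => ?_, ?_,
    κOdd, κEven, φ, δ, fun n => isTorConnecting_torδ hS Y n, hO, hE, hp,
    fun m x => rfl, fun m x => rfl⟩
  · exact exact_conj (tor_exact₁ hS Y (2 * m + 1)) (Equiv.refl _) (κOdd m) (φ (2 * m + 1))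
      (fun x => rfl) (hO m)
  · exact exact_conj (tor_exact₂ hS Y (2 * m + 1)) (κOdd m).toEquiv (φ (2 * m + 1))
      (LinearEquiv.refl k _) (hO m) (hp _)
  · exact exact_conj (tor_exact₃ hS Y (2 * m)) (φ (2 * m + 1)).toEquiv (LinearEquiv.refl k _)
      (κEven m) (hp _) fun x => rfl
  · exact exact_conj (tor_exact₁ hS Y (2 * m)) (Equiv.refl _) (κEven m) (φ (2 * m))
      (fun x => rfl) (hE m)
  · exact exact_conj (tor_exact₂ hS Y (2 * m)) (κEven m).toEquiv (φ (2 * m))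
      (LinearEquiv.refl k _) (hE m) (hp _)
  · exact exact_conj (tor_exact₃ hS Y (2 * m + 1)) (φ (2 * m + 2)).toEquiv (LinearEquiv.refl k _)
      (κOdd m) (hp _) fun x => rfl
  · intro z
    obtain ⟨x, hx⟩ := tor_zero_surjective hS Y z
    exact ⟨φ 0 x, (hp 0 x).trans hx⟩
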